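/- **Theorem 1.1.** Let $p\ge 1$ and let $X$ be a compact complex manifold of dimension $n\ge p$ whose holomorphic tangent bundle $T_X$ is BC-$p$ positive; that is, $X$ admits a (smooth) Hermitian metric $h$ on $T_X$, with Chern curvature tensor $$R_{i\bar jk\bar l}=-\frac{\partial^2 h_{k\bar l}}{\partial z^i\partial\bar z^j}+\sum_{a,b}h^{a\bar b}\,\frac{\partial h_{k\bar b}}{\partial z^i}\,\frac{\partial h_{a\bar l}}{\partial\bar z^j},$$ such that for every $x\in X$ and every $p$-dimensional complex subspace $\Sigma\subset T_{X,x}$ there is $v\in T_{X,x}$ with $\sum_{i=1}^p R(v,\bar v,e_i,\bar e_i)>0$, where $e_1,\dots,e_p$ is a unitary basis of $\Sigma$ (the sum does not depend on the basis). Let $Y$ be a non-empty compact complex manifold of dimension $p$ and let $f:X\dashrightarrow Y$ be a dominant meromorphic map. Then the canonical line bundle $K_Y=\Lambda^pT_Y^*$ is not pseudo-effective. Here a meromorphic map $f:X\dashrightarrow Y$ is a holomorphic map $f:X\setminus Z\to Y$, where $Z\subset X$ is an analytic subset of codimension at least $2$, such that the closure of its graph is an analytic subset of $X\times Y$. It is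 dominant if its image $f(X\setminus Z)$ contains a dense open subset of $Y$. A line bundle $L$ on $Y$ is pseudo-effective if it admits a singular Hermitian metric with semi-positive curvature, i.e. a metric whose weights $\varphi$ with respect to local trivializations ($|s|^2=e^{-\varphi}$ for the local holomorphic frame $s$) are plurisubharmonic and not identically $-\infty$ on any non-empty open set. -/

import Mathlib

open Set Filter Topology
open scoped Manifold ContDiff ComplexConjugate

noncomputable section

namespace CplxGeom

/-- The model space `ℂⁿ`. A complex manifold of dimension `n` is a Hausdorff space `X` with
`[ChartedSpace (Cn n) X] [IsManifold 𝓘(ℂ, Cn n) ω X]`. -/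
abbrev Cn (n : ℕ) : Type := EuclideanSpace ℂ (Fin n)

/-! ### Analytic subsets and meromorphic maps -/

section Analytic

variable {E H M : Type*} [NormedAddCommGroup E] [NormedSpace ℂ E] [TopologicalSpace H]
  (I : ModelWithCorners ℂ E H) [TopologicalSpace M] [ChartedSpace H M]

/-- `A` is a (closed) analytic subset of the complex manifold `M`: near every point of `M` it is
the common zero set of finitely many holomorphic functions. -/
def IsAnalyticSubset (A : Set M) : Prop :=
  ∀ x : M, ∃ U : Set M, IsOpen U ∧ x ∈ U ∧ ∃ (k : ℕ) (F : Fin k → M → ℂ),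
    (∀ i, ContMDiffOn I 𝓘(ℂ, ℂ) ω (F i) U) ∧ A ∩ U = {y ∈ U | ∀ i, F i y = 0}

/-- The analytic subset `A` has codimension at least two (everywhere), i.e. it contains no piece of
a hypersurface: if `g` is holomorphic on an open set `U` and has a zero there, then the zero set
of `g` in `U` is not contained in `A`. (The case `g = 0` says that `A` has no interior; at a
regular point of dimension `n - 1`, `A` is locally the zero set of a coordinate function.) -/
def HasCodimAtLeastTwo (A : Set M) : Prop :=
  ∀ (U : Set M) (g : M → ℂ), IsOpen U → ContMDiffOn I 𝓘(ℂ, ℂ) ω g U →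
    (∃ y ∈ U, g y = 0) → ¬ {y ∈ U | g y = 0} ⊆ A

end Analytic

section Meromorphic

variable (n p : ℕ) (X Y : Type*) [TopologicalSpace X] [ChartedSpace (Cn n) X]
  [TopologicalSpace Y] [ChartedSpace (Cn p) Y]

/-- A meromorphic map `X ⇢ Y` of complex manifolds: a holomorphic map defined on the complement of
an analytic subset of codimension at least two, such that the closure of its graph is an
analytic subset of `X × Y`. The values of `toFun` on `indet` carry no meaning. -/
structure MeromorphicMap where
  toFun : X → Y
  indet : Set X
  isAnalyticSubset_indet : IsAnalyticSubset 𝓘(ℂ, Cn n) indet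
  hasCodimAtLeastTwo_indet : HasCodimAtLeastTwo 𝓘(ℂ, Cn n) indet
  holomorphicOn : ContMDiffOn 𝓘(ℂ, Cn n) 𝓘(ℂ, Cn p) ω toFun indetᶜ
  isAnalyticSubset_graph : IsAnalyticSubset (𝓘(ℂ, Cn n).prod 𝓘(ℂ, Cn p))
    (closure {q : X × Y | q.1 ∉ indet ∧ q.2 = toFun q.1})

variable {n p X Y}

/-- A meromorphic map is dominant if its image (the image of the complement of the indeterminacy
set) contains a dense open subset of the target. -/
def MeromorphicMap.IsDominant (f : MeromorphicMap n p X Y) : Prop :=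
  ∃ V : Set Y, IsOpen V ∧ Dense V ∧ V ⊆ f.toFun '' f.indetᶜ

end Meromorphic

/-! ### Plurisubharmonic functions, pseudo-effective line bundles, the canonical bundle -/

/-- `u : U → [-∞, ∞)` is plurisubharmonic on the open subset `U` of a complex vector space: it is
upper semicontinuous and satisfies the sub-mean value inequality on every closed disc
`{a + ζ b : |ζ| ≤ 1} ⊆ U` of a complex line. The mean value of `u` over the boundary circle,
an element of `[-∞, ∞)`, is the infimum over `m : ℝ` of the mean values of the bounded functions
`max u m`. -/
structure IsPSHOn {E : Type*} [NormedAddCommGroup E] [NormedSpace ℂ E]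
    (u : E → EReal) (U : Set E) : Prop where
  lt_top : ∀ z ∈ U, u z < ⊤
  usc : UpperSemicontinuousOn u U
  submean : ∀ a b : E, (∀ ζ : ℂ, ‖ζ‖ ≤ 1 → a + ζ • b ∈ U) → ∀ m : ℝ,
    u a ≤ ((Real.circleAverage (fun ζ : ℂ ↦ (max (u (a + ζ • b)) (m : EReal)).toReal) 0 1 : ℝ) :
      EReal)

/-- `u` is plurisubharmonic on the open subset `U` of a complex manifold, i.e. it is so in the
charts. -/
def IsPSHOnManifold (p : ℕ) {Y : Type*} [TopologicalSpace Y] [ChartedSpace (Cn p) Y]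
    (u : Y → EReal) (U : Set Y) : Prop :=
  ∀ e ∈ atlas (Cn p) Y, IsPSHOn (u ∘ e.symm) (e.target ∩ e.symm ⁻¹' U)

/-- A line bundle `L` on the complex manifold `Y`, given by its trivializations and transition
functions, is pseudo-effective: it has a singular Hermitian metric `h` with semi-positive
curvature. Here `h` is given by its weights `φ i`, `|s i|²_h = exp (- φ i)` for the frame `s i`
of the `i`-th trivialization; as `s i = g i j • s j` with `g i j = L.coordChange i j x 1`, the
weights satisfy `φ j = φ i + log |g i j|²`. They have to be plurisubharmonic, and not identically
`-∞` on a non-empty open set. -/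
def IsPseudoEffective (p : ℕ) {Y : Type*} [TopologicalSpace Y] [ChartedSpace (Cn p) Y]
    {ι : Type*} (L : VectorBundleCore ℂ Y ℂ ι) : Prop :=
  ∃ φ : ι → Y → EReal,
    (∀ i, IsPSHOnManifold p (φ i) (L.baseSet i)) ∧
    (∀ i, ∀ V ⊆ L.baseSet i, IsOpen V → V.Nonempty → ∃ y ∈ V, φ i y ≠ ⊥) ∧
    ∀ i j, ∀ y ∈ L.baseSet i ∩ L.baseSet j,
      φ j y = φ i y + ((Real.log (‖L.coordChange i j y 1‖ ^ 2) : ℝ) : EReal)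

/-- The canonical line bundle `K_Y = Λᵖ T_Y^*` of a complex manifold of dimension `p`. It is
trivialized over the domain of a chart `w i` by `dw i = dw i¹ ∧ ⋯ ∧ dw iᵖ`, and
`dw i = det (∂ w i / ∂ w j) • dw j`; the Jacobian matrix `∂ w i / ∂ w j` is the transition map
from `w j` to `w i` of the tangent bundle. -/
def canonicalBundle (p : ℕ) (Y : Type*) [TopologicalSpace Y] [ChartedSpace (Cn p) Y]
    [IsManifold 𝓘(ℂ, Cn p) ω Y] : VectorBundleCore ℂ Y ℂ (atlas (Cn p) Y) where
  baseSet i := i.1.source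
  isOpen_baseSet i := i.1.open_source
  indexAt := achart (Cn p)
  mem_baseSet_at := mem_chart_source (Cn p)
  coordChange i j y :=
    ((tangentBundleCore 𝓘(ℂ, Cn p) Y).coordChange j i y).det • ContinuousLinearMap.id ℂ ℂ
  coordChange_self i y hy v := by
    have : (tangentBundleCore 𝓘(ℂ, Cn p) Y).coordChange i i y = ContinuousLinearMap.id ℂ _ := by
      ext1 w
      exact (tangentBundleCore 𝓘(ℂ, Cn p) Y).coordChange_self i y hy w
    rw [this]
    simp [ContinuousLinearMap.det]
  continuousOn_coordChange i j := by
    have h := (tangentBundleCore 𝓘(ℂ, Cn p) Y).continuousOn_coordChange j i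
    rw [inter_comm] at h
    exact (ContinuousLinearMap.continuous_det.comp_continuousOn h).smul continuousOn_const
  coordChange_comp i j k y hy v := by
    have : ((tangentBundleCore 𝓘(ℂ, Cn p) Y).coordChange j i y).comp
        ((tangentBundleCore 𝓘(ℂ, Cn p) Y).coordChange k j y) =
        (tangentBundleCore 𝓘(ℂ, Cn p) Y).coordChange k i y := by
      ext1 w
      exact (tangentBundleCore 𝓘(ℂ, Cn p) Y).coordChange_comp k j i y ⟨⟨hy.2, hy.1.2⟩, hy.1.1⟩ w
    rw [← this]
    simp [ContinuousLinearMap.det]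
    ring

/-! ### Hermitian metrics, Chern curvature, BC-`p` positivity of the tangent bundle -/

/-- The Wirtinger derivative `∂f/∂zⁱ`. -/
def dz {n : ℕ} (i : Fin n) (f : Cn n → ℂ) (z : Cn n) : ℂ :=
  (1 / 2) * (fderiv ℝ f z (EuclideanSpace.single i 1)
    - Complex.I * fderiv ℝ f z (EuclideanSpace.single i Complex.I))

/-- The Wirtinger derivative `∂f/∂z̄ⁱ`. -/
def dzbar {n : ℕ} (i : Fin n) (f : Cn n → ℂ) (z : Cn n) : ℂ :=
  (1 / 2) * (fderiv ℝ f z (EuclideanSpace.single i 1)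
    + Complex.I * fderiv ℝ f z (EuclideanSpace.single i Complex.I))

section Hermitian

variable {n : ℕ} {X : Type*} [TopologicalSpace X] [ChartedSpace (Cn n) X]

/-- For a family of sesquilinear forms on the tangent spaces of `X` and a chart `e` with
coordinates `z¹, …, zⁿ`, the coefficient `h_{k l̄} = h(∂/∂zᵏ, ∂/∂zˡ)` as a function on the range
of `e`. -/
def localCoeff
    (h : ∀ x : X, TangentSpace 𝓘(ℂ, Cn n) x →ₗ[ℂ] TangentSpace 𝓘(ℂ, Cn n) x →ₗ⋆[ℂ] ℂ)
    (e : OpenPartialHomeomorph X (Cn n)) (k l : Fin n) (z : Cn n) : ℂ :=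
  h (e.symm z)
    (mfderiv 𝓘(ℂ, Cn n) 𝓘(ℂ, Cn n) e.symm z (EuclideanSpace.single k (1 : ℂ) : Cn n))
    (mfderiv 𝓘(ℂ, Cn n) 𝓘(ℂ, Cn n) e.symm z (EuclideanSpace.single l (1 : ℂ) : Cn n))

variable (n X) in
/-- A (smooth) Hermitian metric on the (holomorphic) tangent bundle of the complex manifold `X`,
linear in the first and conjugate linear in the second argument. -/
structure HermitianMetric where
  form : ∀ x : X, TangentSpace 𝓘(ℂ, Cn n) x →ₗ[ℂ] TangentSpace 𝓘(ℂ, Cn n) x →ₗ⋆[ℂ] ℂ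
  conj_symm : ∀ (x : X) (u v : TangentSpace 𝓘(ℂ, Cn n) x), conj (form x u v) = form x v u
  pos : ∀ (x : X) (u : TangentSpace 𝓘(ℂ, Cn n) x), u ≠ 0 → 0 < (form x u u).re
  smooth : ∀ e ∈ atlas (Cn n) X, ∀ k l : Fin n, ContDiffOn ℝ ∞ (localCoeff form e k l) e.target

namespace HermitianMetric

variable (h : HermitianMetric n X)

/-- The matrix `(h_{k l̄})` of the metric in the chart `e`. -/
def localMatrix (e : OpenPartialHomeomorph X (Cn n)) (z : Cn n) : Matrix (Fin n) (Fin n) ℂ :=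
  Matrix.of fun k l ↦ localCoeff h.form e k l z

/-- The components
`R_{i j̄ k l̄} = - ∂²h_{k l̄} / ∂zⁱ∂z̄ʲ + ∑_{a, b} h^{a b̄} (∂h_{k b̄} / ∂zⁱ) (∂h_{a l̄} / ∂z̄ʲ)`
of the Chern curvature tensor in the chart `e`. Here `(h^{a b̄})` is the transpose of the inverse
matrix of `(h_{k l̄})`, i.e. `∑_b h_{k b̄} h^{a b̄} = δ_{k a}`. -/
def curvatureCoeff (e : OpenPartialHomeomorph X (Cn n)) (z : Cn n) (i j k l : Fin n) : ℂ :=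
  - dz i (dzbar j (localCoeff h.form e k l)) z
    + ∑ a, ∑ b, (h.localMatrix e z)⁻¹ b a
        * dz i (localCoeff h.form e k b) z * dzbar j (localCoeff h.form e a l) z

/-- `R(v, v̄, u, ū)` for tangent vectors `u`, `v` at `x`, where `R` is the Chern curvature tensor.
It is a real number, computed in the preferred chart at `x`. -/
def curvature (x : X) (v u : TangentSpace 𝓘(ℂ, Cn n) x) : ℝ :=
  let e := chartAt (Cn n) x
  let V : Cn n := mfderiv 𝓘(ℂ, Cn n) 𝓘(ℂ, Cn n) e x v
  let W : Cn n := mfderiv 𝓘(ℂ, Cn n) 𝓘(ℂ, Cn n) e x u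
  (∑ i, ∑ j, ∑ k, ∑ l,
    h.curvatureCoeff e (e x) i j k l * V i * conj (V j) * W k * conj (W l)).re

/-- The family `ε` of tangent vectors at `x` is orthonormal (unitary) for the metric. -/
def IsUnitary {p : ℕ} (x : X) (ε : Fin p → TangentSpace 𝓘(ℂ, Cn n) x) : Prop :=
  ∀ i j, h.form x (ε i) (ε j) = if i = j then 1 else 0

end HermitianMetric

end Hermitian

/-- The tangent bundle of the `n`-dimensional complex manifold `X` is BC-`p` positive: it has a
Hermitian metric such that for every `p`-dimensional subspace `S` of a tangent space there is a
tangent vector `v` with `∑ R(v, v̄, ε i, ε̄ i) > 0` for the unitary bases `ε` of `S` (the sum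
does not depend on the basis). -/
def IsBCPositive (p n : ℕ) (X : Type*) [TopologicalSpace X] [ChartedSpace (Cn n) X] : Prop :=
  ∃ h : HermitianMetric n X, ∀ (x : X) (S : Submodule ℂ (TangentSpace 𝓘(ℂ, Cn n) x)),
    Module.finrank ℂ S = p → ∃ v : TangentSpace 𝓘(ℂ, Cn n) x,
      ∀ ε : Fin p → TangentSpace 𝓘(ℂ, Cn n) x, (∀ i, ε i ∈ S) → h.IsUnitary x ε →
        0 < ∑ i, h.curvature x v (ε i)

end CplxGeom

end

/-! Suppose `K_Y` carries weights `φ` as in the definition of pseudo-effectivity. Then `e^φ` defines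
a log-plurisubharmonic squared length on `Λᵖ T_Y`, and pulling it back by `df` gives `m(x, ξ₁, …,
ξ_p) = e^φ |det df(ξᵢ)|²`, log-plurisubharmonic on `p`-tuples of tangent vectors of `X` off the
indeterminacy set `Z` (`IsCanonicalWeight.isLogPSH`). Given the Hermitian metric, maximize `m ·
exp(-∑ |ξᵢ|²)`.

At a maximum the `ξᵢ` are unitary: `m` scales by `|det A|²` under linear combinations, so lengths
and angles are fixed by varying `ξ` alone. Now move in a direction `V` and extend each `ξᵢ` to be
parallel to first order for the Chern connection. The mixed second derivative of `∑ |ξᵢ|²` is then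
`-∑ R(V, V̄, ξᵢ, ξ̄ᵢ)` (`exists_hasJet_normSq`). If this sum were positive, `log m - ∑ |ξᵢ|²` would
be strictly subharmonic along the disc and could have no maximum. Hence the sum is non-positive for
every `V`, against BC-`p` positivity on the span of the `ξᵢ`.

Three points need care. The supremum is finite because local bounds for log-plurisubharmonic
functions extend across sets of codimension two (`exists_local_bound_of_codim_two`). It is positive
because `f` is somewhere submersive, by a holomorphic Sard theorem
(`dimH_image_le_of_finrank_range_le`), and `φ` is not `-∞` on an open set. Finally it may be
approached only at `Z`; one then maximizes with an extra factor `exp(-ε|z - z₀|²) (∑ |gⱼ|²)^δ`,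
where the `gⱼ` cut out `Z`, and lets `ε` tend to zero (`IsExtremalAt.exists_unitary_curvature_le`).

Since `φ` is only semicontinuous, plurisubharmonicity is used throughout as a touching condition
(`IsLogPSH`), which behaves well under maxima, products and holomorphic substitution. -/

namespace CplxGeom

/-! ### Plurisubharmonicity as a touching condition -/

section LogPSH

variable {E : Type*} [NormedAddCommGroup E] [NormedSpace ℂ E]

lemma upperSemicontinuous_toReal_max {α : Type*} [TopologicalSpace α] {u : α → EReal}
    (hu : UpperSemicontinuous u) (htop : ∀ x, u x < ⊤) (m : ℝ) :
    UpperSemicontinuous fun x ↦ (max (u x) (m : EReal)).toReal := by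
  intro x y hy
  have hne : ∀ x, max (u x) (m : EReal) < ⊤ := fun x ↦ max_lt (htop x) (EReal.coe_lt_top m)
  have hbot : ∀ x, max (u x) (m : EReal) ≠ ⊥ := fun x ↦
    ((EReal.bot_lt_coe m).trans_le (le_max_right _ _)).ne'
  have key : ∀ x, (max (u x) (m : EReal)).toReal < y ↔ max (u x) (m : EReal) < (y : EReal) := by
    intro x
    conv_rhs => rw [← EReal.coe_toReal (hne x).ne (hbot x)]
    exact EReal.coe_lt_coe_iff.symm
  rw [key] at hy
  filter_upwards [hu x y (lt_of_le_of_lt (le_max_left _ _) hy)] with z hz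
  rw [key]
  exact max_lt hz (lt_of_le_of_lt (le_max_right _ _) hy)

lemma circleAverage_re_of_differentiableOn {K : ℂ → ℂ}
    (hK : ∀ z ∈ Metric.closedBall (0 : ℂ) 1, AnalyticAt ℂ K z) :
    Real.circleAverage (fun z ↦ (K z).re) 0 1 = (K 0).re := by
  have : InnerProductSpace.HarmonicOnNhd (fun z ↦ (K z).re) (Metric.closedBall (0 : ℂ) |1|) := by
    intro z hz
    rw [abs_one] at hz
    exact (hK z hz).harmonicAt_re
  exact this.circleAverage_eq

/-- A plurisubharmonic function is not touched from above, along a complex line, by the real part of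
a holomorphic function minus a positive multiple of `‖t‖ ^ 2`. -/
lemma IsPSHOn.not_eventually_le_affine {u : E → EReal} {U : Set E} (hu : IsPSHOn u U)
    (hU : IsOpen U) {a : E} (ha : a ∈ U) (b : E) (hne : u a ≠ ⊥) {K : ℂ → ℂ}
    (hK : AnalyticAt ℂ K 0) (hK0 : K 0 = 0) {c : ℝ} (hc : 0 < c) :
    ¬ ∀ᶠ t : ℂ in 𝓝 0, u (a + t • b) ≤ (((u a).toReal + (K t).re - c * ‖t‖ ^ 2 : ℝ) : EReal) := by
  intro h
  have hUe : ∀ᶠ t : ℂ in 𝓝 0, a + t • b ∈ U := by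
    have : ContinuousAt (fun t : ℂ ↦ a + t • b) 0 := by fun_prop
    exact this.eventually_mem (hU.mem_nhds (by simpa using ha))
  obtain ⟨s', hs', hs⟩ := Metric.eventually_nhds_iff_ball.1
    (h.and (hUe.and hK.eventually_analyticAt))
  set s := s' / 2 with hsdef
  have hspos : 0 < s := by positivity
  have hmem : ∀ t : ℂ, ‖t‖ ≤ 1 → (s : ℂ) * t ∈ Metric.ball (0 : ℂ) s' := by
    intro t ht
    rw [mem_ball_zero_iff, norm_mul, Complex.norm_real, Real.norm_of_nonneg hspos.le]
    nlinarith
  set A := (u a).toReal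
  set Q : ℂ → ℝ := fun t ↦ A - c * s ^ 2 + (K (s * t)).re with hQ
  have hKs : ∀ z ∈ Metric.closedBall (0 : ℂ) 1, AnalyticAt ℂ (fun t : ℂ ↦ K (s * t)) z := by
    intro z hz
    have := (hs _ (hmem z (mem_closedBall_zero_iff.1 hz))).2.2
    exact this.comp_of_eq (f := fun t : ℂ ↦ (s : ℂ) * t)
      (analyticAt_const.mul analyticAt_id) rfl
  have hQc : ContinuousOn Q (Metric.closedBall (0 : ℂ) 1) := by
    refine continuousOn_const.add (Complex.continuous_re.comp_continuousOn ?_)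
    exact fun z hz ↦ (hKs z hz).continuousAt.continuousWithinAt
  have hsub : Metric.sphere (0 : ℂ) |1| ⊆ Metric.closedBall (0 : ℂ) 1 := by
    rw [abs_one]; exact Metric.sphere_subset_closedBall
  obtain ⟨m, hm⟩ := ((isCompact_closedBall (0 : ℂ) 1).image_of_continuousOn hQc).bddBelow
  have hline : ∀ t : ℂ, a + t • (s : ℂ) • b = a + ((s : ℂ) * t) • b := by
    intro t; rw [smul_smul, mul_comm]
  have hinU : ∀ t : ℂ, ‖t‖ ≤ 1 → a + t • (s : ℂ) • b ∈ U := by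
    intro t ht
    rw [hline]
    exact (hs _ (hmem t ht)).2.1
  have hmean := hu.submean a ((s : ℂ) • b) hinU m
  have hbd : ∀ t ∈ Metric.sphere (0 : ℂ) |1|,
      (max (u (a + t • (s : ℂ) • b)) (m : EReal)).toReal ≤ Q t := by
    intro t ht
    have ht1 : ‖t‖ = 1 := by simpa using ht
    have h1 := (hs _ (hmem t ht1.le)).1
    rw [← hline, norm_mul, Complex.norm_real, ht1, mul_one, Real.norm_of_nonneg hspos.le] at h1
    have h2 : max (u (a + t • (s : ℂ) • b)) (m : EReal) ≤ (Q t : EReal) := by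
      refine max_le (h1.trans (EReal.coe_le_coe_iff.2 ?_)) (EReal.coe_le_coe_iff.2 ?_)
      · simp only [hQ]; linarith
      · exact hm (mem_image_of_mem _ (hsub ht))
    have h3 := EReal.toReal_le_toReal h2
      ((EReal.bot_lt_coe m).trans_le (le_max_right _ _)).ne' (EReal.coe_ne_top _)
    simpa using h3
  have hQint : CircleIntegrable Q 0 1 := by
    refine (hQc.mono ?_).circleIntegrable'
    exact hsub
  -- A non-integrable function has average `0` by default, so monotonicity of averages needs this.
  -- Semicontinuity gives measurability, and `m` and `M` bound the function.
  have hint : CircleIntegrable (fun ζ : ℂ ↦ (max (u (a + ζ • (s : ℂ) • b)) (m : EReal)).toReal)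
      0 1 := by
    have husc : UpperSemicontinuous fun θ : ℝ ↦
        (max (u (a + circleMap 0 1 θ • (s : ℂ) • b)) (m : EReal)).toReal := by
      have hin : ∀ θ : ℝ, a + circleMap 0 1 θ • (s : ℂ) • b ∈ U := fun θ ↦
        hinU _ (by simp [circleMap])
      apply upperSemicontinuous_toReal_max
        (u := fun θ : ℝ ↦ u (a + circleMap 0 1 θ • (s : ℂ) • b))
      · intro θ y hy
        have h1 := hu.usc _ (hin θ) y hy
        rw [hU.nhdsWithin_eq (hin θ)] at h1
        have hcont : Continuous fun θ : ℝ ↦ a + circleMap 0 1 θ • (s : ℂ) • b := by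
          have := continuous_circleMap 0 1
          fun_prop
        exact hcont.continuousAt.eventually h1
      · exact fun θ ↦ hu.lt_top _ (hin θ)
    obtain ⟨M, hM⟩ := ((isCompact_closedBall (0 : ℂ) 1).image_of_continuousOn hQc).bddAbove
    rw [circleIntegrable_def]
    refine (intervalIntegrable_const (c := max |m| |M|)).mono_fun
      husc.measurable.aestronglyMeasurable (MeasureTheory.ae_of_all _ fun θ ↦ ?_)
    have hc1 : circleMap 0 1 θ ∈ Metric.sphere (0 : ℂ) |1| := by simp [circleMap]
    have h1 := hbd _ hc1
    have h2 : Q (circleMap 0 1 θ) ≤ M := hM (mem_image_of_mem _ (hsub hc1))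
    have h3 : m ≤ (max (u (a + circleMap 0 1 θ • (s : ℂ) • b)) (m : EReal)).toReal := by
      have := EReal.toReal_le_toReal
        (le_max_right (u (a + circleMap 0 1 θ • (s : ℂ) • b)) (m : EReal))
        (EReal.coe_ne_bot _) (max_lt (hu.lt_top _ (hinU _ (by simp [circleMap])))
          (EReal.coe_lt_top m)).ne
      simpa using this
    beta_reduce
    rw [Real.norm_eq_abs, Real.norm_of_nonneg (le_max_of_le_left (abs_nonneg m))]
    exact abs_le_max_abs_abs h3 (h1.trans h2)
  have havg := Real.circleAverage_mono hint hQint hbd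
  have hQavg : Real.circleAverage Q 0 1 = A - c * s ^ 2 := by
    have hre : CircleIntegrable (fun t : ℂ ↦ (K (s * t)).re) 0 1 := by
      refine ContinuousOn.circleIntegrable' (Complex.continuous_re.comp_continuousOn ?_)
      exact fun z hz ↦ (hKs z (hsub hz)).continuousAt.continuousWithinAt
    rw [hQ, Real.circleAverage_fun_add (circleIntegrable_const _ _ _) hre,
      Real.circleAverage_const, circleAverage_re_of_differentiableOn hKs]
    simp [hK0]
  rw [hQavg] at havg
  have hfin : u a = (A : EReal) := (EReal.coe_toReal (hu.lt_top a ha).ne hne).symm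
  rw [hfin] at hmean
  have h5 := (EReal.coe_le_coe_iff.1 hmean).trans havg
  nlinarith [mul_pos hc (pow_pos hspos 2)]

/-- The exponential of an extended real weight, as a nonnegative real number. -/
noncomputable def expWeight {α : Type*} (u : α → EReal) (z : α) : ℝ := (EReal.exp (u z)).toReal

lemma expWeight_nonneg {α : Type*} (u : α → EReal) (z : α) : 0 ≤ expWeight u z :=
  ENNReal.toReal_nonneg

lemma expWeight_of_coe {α : Type*} {u : α → EReal} {z : α} {r : ℝ} (h : u z = r) :
    expWeight u z = Real.exp r := by
  simp [expWeight, h, ENNReal.toReal_ofReal (Real.exp_pos r).le]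

lemma expWeight_pos_iff {α : Type*} {u : α → EReal} {z : α} (h : u z < ⊤) :
    0 < expWeight u z ↔ u z ≠ ⊥ := by
  rw [expWeight, ENNReal.toReal_pos_iff]
  simp [h, bot_lt_iff_ne_bot]

lemma expWeight_le_iff {α : Type*} {u : α → EReal} {z : α} (h : u z < ⊤) (r : ℝ) :
    expWeight u z ≤ Real.exp r ↔ u z ≤ (r : EReal) := by
  induction hz : u z with
  | bot => simp [expWeight, hz, (Real.exp_pos r).le]
  | top => simp [hz] at h
  | coe x => rw [expWeight_of_coe hz, Real.exp_le_exp, EReal.coe_le_coe_iff]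

lemma expWeight_lt_iff {α : Type*} {u : α → EReal} {z : α} (h : u z < ⊤) (r : ℝ) :
    expWeight u z < Real.exp r ↔ u z < (r : EReal) := by
  induction hz : u z with
  | bot => simp [expWeight, hz, Real.exp_pos r]
  | top => simp [hz] at h
  | coe x => rw [expWeight_of_coe hz, Real.exp_lt_exp, EReal.coe_lt_coe_iff]

lemma expWeight_upperSemicontinuousWithinAt {α : Type*} [TopologicalSpace α] {u : α → EReal}
    {s : Set α} {z : α} (hz : z ∈ s) (htop : ∀ x ∈ s, u x < ⊤)
    (hu : UpperSemicontinuousWithinAt u s z) :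
    UpperSemicontinuousWithinAt (expWeight u) s z := by
  intro y hy
  have hy0 : 0 < y := (expWeight_nonneg u z).trans_lt hy
  rw [← Real.exp_log hy0, expWeight_lt_iff (htop z hz)] at hy
  filter_upwards [hu _ hy, self_mem_nhdsWithin] with x hx hxs
  rwa [← Real.exp_log hy0, expWeight_lt_iff (htop x hxs)]

lemma upperSemicontinuousWithinAt_mul {α : Type*} [TopologicalSpace α] {m c : α → ℝ}
    {s : Set α} {z : α} (hm : UpperSemicontinuousWithinAt m s z)
    (hc : ContinuousWithinAt c s z) (hc0 : ∀ x ∈ s, 0 ≤ c x) :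
    UpperSemicontinuousWithinAt (fun x ↦ m x * c x) s z := by
  intro y hy
  have h1 : ∀ᶠ a in 𝓝[>] (m z), a * c z < y := by
    have : ContinuousAt (fun a : ℝ ↦ a * c z) (m z) := by fun_prop
    exact (this.eventually_lt continuousAt_const hy).filter_mono nhdsWithin_le_nhds
  obtain ⟨a, ha, hma⟩ := (h1.and self_mem_nhdsWithin).exists
  have h2 : ∀ᶠ x in 𝓝[s] z, a * c x < y :=
    (continuousWithinAt_const.mul hc).eventually_lt continuousWithinAt_const ha
  filter_upwards [h2, hm a hma, self_mem_nhdsWithin] with x hx1 hx2 hxs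
  exact (mul_le_mul_of_nonneg_right hx2.le (hc0 x hxs)).trans_lt hx1

/-- `log m` is plurisubharmonic on `Ω` in the viscosity sense: along holomorphic discs `γ`, at a
point where `m ≠ 0`, it is not touched from above by the real part of a holomorphic
function minus a positive multiple of `‖ζ‖ ^ 2`. -/
def IsLogPSH (m : E → ℝ) (Ω : Set E) : Prop :=
  ∀ γ : ℂ → E, AnalyticAt ℂ γ 0 → γ 0 ∈ Ω → 0 < m (γ 0) → ∀ K : ℂ → ℂ, AnalyticAt ℂ K 0 →
    K 0 = 0 → ∀ c : ℝ, 0 < c →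
      ¬ ∀ᶠ ζ : ℂ in 𝓝 0, m (γ ζ) ≤ m (γ 0) * Real.exp ((K ζ).re - c * ‖ζ‖ ^ 2)

end LogPSH

/-! ### From complex lines to holomorphic discs -/

section Disc

variable {E : Type*} [NormedAddCommGroup E] [InnerProductSpace ℂ E] [FiniteDimensional ℂ E]

/-- Doubling of variables: the point `w` is freed from the disc and its distance to `F ζ` is
penalized with weight `N`. At a maximum one may move `w` along the affine line tangent to the disc,
where the statement for complex lines applies. -/
lemma IsPSHOn.isLogPSH {u : E → EReal} {U : Set E} (hu : IsPSHOn u U) (hU : IsOpen U) :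
    IsLogPSH (expWeight u) U := by
  have := FiniteDimensional.proper ℂ E
  have aff : ∀ a ∈ U, ∀ b : E, 0 < expWeight u a → ∀ K : ℂ → ℂ, AnalyticAt ℂ K 0 → K 0 = 0 →
      ∀ c : ℝ, 0 < c → ¬ ∀ᶠ t : ℂ in 𝓝 0,
        expWeight u (a + t • b) ≤ expWeight u a * Real.exp ((K t).re - c * ‖t‖ ^ 2) := by
    intro a ha b hpos K hK hK0 c hc h
    have hne := (expWeight_pos_iff (hu.lt_top a ha)).1 hpos
    refine hu.not_eventually_le_affine hU ha b hne hK hK0 hc ?_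
    have hUe : ∀ᶠ t : ℂ in 𝓝 0, a + t • b ∈ U := by
      have : ContinuousAt (fun t : ℂ ↦ a + t • b) 0 := by fun_prop
      exact this.eventually_mem (hU.mem_nhds (by simpa using ha))
    filter_upwards [h, hUe] with t ht htU
    rw [expWeight_of_coe (EReal.coe_toReal (hu.lt_top a ha).ne hne).symm, ← Real.exp_add,
      expWeight_le_iff (hu.lt_top _ htU)] at ht
    rwa [add_sub_assoc]
  intro F hF hF0 hpos K hK hK0 c hc h
  set m := expWeight u with hm
  set m0 := m (F 0) with hm0
  have musc : ∀ z ∈ U, UpperSemicontinuousWithinAt m U z := fun z hz ↦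
    expWeight_upperSemicontinuousWithinAt hz hu.lt_top (hu.usc z hz)
  have mnn : ∀ z, 0 ≤ m z := expWeight_nonneg u
  obtain ⟨ρ', hρ', hρ⟩ := Metric.eventually_nhds_iff_ball.1
    (h.and (hF.eventually_analyticAt.and hK.eventually_analyticAt))
  obtain ⟨σ, hσ, hσU⟩ := Metric.nhds_basis_closedBall.mem_iff.1 (hU.mem_nhds hF0)
  set ρ := ρ' / 2 with hρdef
  have hρpos : 0 < ρ := by positivity
  have hρin : ∀ ζ ∈ Metric.closedBall (0 : ℂ) ρ, ζ ∈ Metric.ball (0 : ℂ) ρ' := fun ζ hζ ↦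
    Metric.closedBall_subset_ball (by linarith) hζ
  set P : Set (ℂ × E) := Metric.closedBall (0 : ℂ) ρ ×ˢ Metric.closedBall (F 0) σ with hP
  have hPc : IsCompact P := (isCompact_closedBall _ _).prod (isCompact_closedBall _ _)
  have h0P : ((0 : ℂ), F 0) ∈ P := ⟨by simp [hρpos.le], by simp [hσ.le]⟩
  -- Half of the margin `c` is kept, so that on the graph `w = F ζ` the quantity `m w * exp (e ζ)`
  -- has its strict maximum at `ζ = 0`. This locates the limit of the maximizers as `N` grows.
  set e : ℂ → ℝ := fun ζ ↦ -(K ζ).re + c / 2 * ‖ζ‖ ^ 2 with he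
  have hecont : ContinuousOn e (Metric.closedBall (0 : ℂ) ρ) := by
    refine ContinuousOn.add ?_ (by fun_prop)
    refine (Complex.continuous_re.comp_continuousOn ?_).neg
    exact fun ζ hζ ↦ (hρ ζ (hρin ζ hζ)).2.2.continuousAt.continuousWithinAt
  have hFcont : ContinuousOn F (Metric.closedBall (0 : ℂ) ρ) :=
    fun ζ hζ ↦ (hρ ζ (hρin ζ hζ)).2.1.continuousAt.continuousWithinAt
  have hfst : MapsTo (Prod.fst : ℂ × E → ℂ) P (Metric.closedBall (0 : ℂ) ρ) := fun q hq ↦ hq.1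
  have hsnd : MapsTo (Prod.snd : ℂ × E → E) P U := fun q hq ↦ hσU hq.2
  have musc' : ∀ q ∈ P, UpperSemicontinuousWithinAt (fun q : ℂ × E ↦ m q.2) P q := by
    intro q hq y hy
    have h1 := musc q.2 (hsnd hq) y hy
    exact (continuous_snd.continuousWithinAt.tendsto_nhdsWithin hsnd).eventually h1
  have hexp : ∀ N : ℝ, UpperSemicontinuousOn
      (fun q : ℂ × E ↦ m q.2 * Real.exp (e q.1 - N * ‖q.2 - F q.1‖ ^ 2)) P := by
    intro N q hq
    refine upperSemicontinuousWithinAt_mul (musc' q hq) ?_ (fun _ _ ↦ (Real.exp_pos _).le)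
    have h1 : ContinuousOn (fun q : ℂ × E ↦ e q.1) P := hecont.comp continuousOn_fst hfst
    have h2 : ContinuousOn (fun q : ℂ × E ↦ F q.1) P := hFcont.comp continuousOn_fst hfst
    exact (Real.continuous_exp.comp_continuousOn
      (h1.sub (continuousOn_const.mul ((continuousOn_snd.sub h2).norm.pow 2)))) q hq
  have hmax : ∀ N : ℕ, ∃ q ∈ P, IsMaxOn
      (fun q : ℂ × E ↦ m q.2 * Real.exp (e q.1 - N * ‖q.2 - F q.1‖ ^ 2)) P q := fun N ↦
    (hexp N).exists_isMaxOn ⟨_, h0P⟩ hPc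
  choose q hqP hqmax using hmax
  have hval : ∀ N : ℕ, m0 ≤ m (q N).2 * Real.exp (e (q N).1 - N * ‖(q N).2 - F (q N).1‖ ^ 2) := by
    intro N
    have := hqmax N h0P
    simpa [he, hK0] using this
  obtain ⟨C, hC⟩ := (hexp 0).bddAbove_of_isCompact hPc
  have hC' : ∀ q ∈ P, m q.2 * Real.exp (e q.1) ≤ C := by
    intro q hq
    simpa using hC (mem_image_of_mem _ hq)
  have hdist : ∀ N : ℕ, N * ‖(q N).2 - F (q N).1‖ ^ 2 ≤ C / m0 := by
    intro N
    set d := (N : ℝ) * ‖(q N).2 - F (q N).1‖ ^ 2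
    have h1 := hval N
    rw [Real.exp_sub, ← mul_div_assoc, le_div_iff₀ (Real.exp_pos _)] at h1
    have h2 := h1.trans (hC' _ (hqP N))
    have h3 := Real.add_one_le_exp d
    rw [le_div_iff₀ hpos]
    nlinarith
  have hval' : ∀ N : ℕ, m0 ≤ m (q N).2 * Real.exp (e (q N).1) := by
    intro N
    refine (hval N).trans (mul_le_mul_of_nonneg_left (Real.exp_le_exp.2 ?_) (mnn _))
    have : (0 : ℝ) ≤ N * ‖(q N).2 - F (q N).1‖ ^ 2 := by positivity
    linarith
  obtain ⟨qs, hqs, φ, hφ, hlim⟩ := hPc.tendsto_subseq hqP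
  have hζs := hρ qs.1 (hρin _ hqs.1)
  have hqsF : qs.2 = F qs.1 := by
    have h1 : Tendsto (fun k ↦ ‖(q (φ k)).2 - F (q (φ k)).1‖ ^ 2) atTop
        (𝓝 (‖qs.2 - F qs.1‖ ^ 2)) := by
      have hF1 := hζs.2.1.continuousAt.tendsto.comp ((continuous_fst.tendsto qs).comp hlim)
      exact ((((continuous_snd.tendsto qs).comp hlim).sub hF1).norm).pow 2
    have h2 : Tendsto (fun k ↦ ‖(q (φ k)).2 - F (q (φ k)).1‖ ^ 2) atTop (𝓝 0) := by
      have h3 : Tendsto (fun k : ℕ ↦ C / m0 / ((φ k : ℕ) : ℝ)) atTop (𝓝 0) :=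
        Tendsto.div_atTop tendsto_const_nhds
          (tendsto_natCast_atTop_atTop.comp hφ.tendsto_atTop)
      refine tendsto_of_tendsto_of_tendsto_of_le_of_le' tendsto_const_nhds h3
        (Eventually.of_forall fun k ↦ by positivity) ?_
      filter_upwards [eventually_gt_atTop 0] with k hk
      have hφk : (0 : ℝ) < φ k := by
        exact_mod_cast lt_of_lt_of_le hk (hφ.id_le k)
      rw [le_div_iff₀ hφk, mul_comm]
      exact hdist _
    have h3 := tendsto_nhds_unique h1 h2
    have : ‖qs.2 - F qs.1‖ = 0 := by simpa using h3
    exact sub_eq_zero.1 (norm_eq_zero.1 this)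
  have hqsval : m0 ≤ m qs.2 * Real.exp (e qs.1) := by
    by_contra hlt
    push Not at hlt
    have h0 := hexp 0 qs hqs m0 (by simpa using hlt)
    have h1 : Tendsto (q ∘ φ) atTop (𝓝[P] qs) :=
      tendsto_nhdsWithin_iff.2 ⟨hlim, Eventually.of_forall fun k ↦ hqP _⟩
    obtain ⟨k, hk⟩ := (h1.eventually h0).exists
    have h2 := hval' (φ k)
    simp only [Function.comp, zero_mul, sub_zero] at hk
    linarith
  have hζ0 : qs.1 = 0 := by
    have h1 := hζs.1
    rw [hqsF] at hqsval
    have h2 : m0 ≤ m0 * Real.exp (-(c / 2 * ‖qs.1‖ ^ 2)) := by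
      refine hqsval.trans ((mul_le_mul_of_nonneg_right h1 (Real.exp_pos _).le).trans_eq ?_)
      rw [mul_assoc, ← Real.exp_add]
      congr 2
      simp only [he]; ring
    have h3 : 1 ≤ Real.exp (-(c / 2 * ‖qs.1‖ ^ 2)) := by
      by_contra hlt; push Not at hlt; nlinarith
    rw [Real.one_le_exp_iff] at h3
    have h4 : ‖qs.1‖ ^ 2 = 0 := by nlinarith [sq_nonneg ‖qs.1‖]
    exact norm_eq_zero.1 (by simpa using h4)
  have hqs0 : qs = (0, F 0) := Prod.ext hζ0 (by rw [hqsF, hζ0])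
  have hint : ∀ᶠ k in atTop, (q (φ k)) ∈ Metric.ball (0 : ℂ) ρ ×ˢ Metric.ball (F 0) σ := by
    rw [hqs0] at hlim
    exact hlim.eventually ((Metric.isOpen_ball.prod Metric.isOpen_ball).mem_nhds
      ⟨Metric.mem_ball_self hρpos, Metric.mem_ball_self hσ⟩)
  obtain ⟨k, hk⟩ := hint.exists
  obtain ⟨N, hN⟩ : ∃ N : ℕ, N = φ k := ⟨_, rfl⟩
  rw [← hN] at hk
  rcases hqN : q N with ⟨ζ₁, w₁⟩
  have hmaxN := hqmax N
  have hvalN := hval N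
  rw [hqN] at hk hmaxN hvalN
  simp only at hvalN
  have hζ₁ := hρ ζ₁ (hρin _ (Metric.ball_subset_closedBall hk.1))
  have hw₁ : 0 < m w₁ := by
    by_contra hle
    have := le_antisymm (not_lt.1 hle) (mnn w₁)
    rw [this, zero_mul] at hvalN
    linarith
  -- Moving `ζ` by `t` and `w` by `t • F' ζ₁` changes `w - F ζ` by `G t = o(t)` only. In `‖a₀ + G t‖
  -- ^ 2` the cross term is the real part of a holomorphic function, and `N * ‖G t‖ ^ 2` uses up at
  -- most `c / 4` of the remaining margin `c / 2`.
  set b : E := deriv F ζ₁ with hb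
  set a₀ : E := w₁ - F ζ₁ with ha₀
  set G : ℂ → E := fun t ↦ F ζ₁ + t • b - F (ζ₁ + t) with hG
  have hshift : AnalyticAt ℂ (fun t : ℂ ↦ ζ₁ + t) 0 := analyticAt_const.add analyticAt_id
  have hGan : AnalyticAt ℂ G 0 := by
    refine (analyticAt_const.add (analyticAt_id.smul analyticAt_const)).sub ?_
    exact hζ₁.2.1.comp_of_eq hshift (by simp)
  have hGo : ∀ᶠ t : ℂ in 𝓝 0, N * ‖G t‖ ^ 2 ≤ c / 4 * ‖t‖ ^ 2 := by
    have hd : HasDerivAt F b ζ₁ := hζ₁.2.1.differentiableAt.hasDerivAt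
    rw [hasDerivAt_iff_isLittleO_nhds_zero] at hd
    obtain ⟨η, hη, hηN⟩ : ∃ η : ℝ, 0 < η ∧ N * η ^ 2 ≤ c / 4 := by
      refine ⟨Real.sqrt (c / (4 * (N + 1))), Real.sqrt_pos.2 (by positivity), ?_⟩
      rw [Real.sq_sqrt (by positivity), ← mul_div_assoc, div_le_div_iff₀ (by positivity)
        (by norm_num)]
      nlinarith
    filter_upwards [hd.bound hη] with t ht
    have h1 : ‖G t‖ ≤ η * ‖t‖ := by
      refine le_trans (le_of_eq ?_) ht
      rw [← norm_neg]; congr 1; simp only [hG]; abel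
    calc N * ‖G t‖ ^ 2 ≤ N * (η * ‖t‖) ^ 2 := by gcongr
      _ = (N * η ^ 2) * ‖t‖ ^ 2 := by ring
      _ ≤ _ := by gcongr
  refine aff w₁ (hσU (Metric.ball_subset_closedBall hk.2)) b hw₁
    (fun t ↦ K (ζ₁ + t) - K ζ₁ - c * (starRingEnd ℂ ζ₁ * t) + 2 * N * inner ℂ a₀ (G t)) ?_ ?_
    (c / 4) (by positivity) ?_
  · refine (((hζ₁.2.2.comp_of_eq hshift (by simp)).sub analyticAt_const).sub
      (analyticAt_const.mul (analyticAt_const.mul analyticAt_id))).add (analyticAt_const.mul ?_)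
    exact ((innerSL ℂ a₀).analyticAt _).comp hGan
  · simp [hG]
  · have hin : ∀ᶠ t : ℂ in 𝓝 0, (ζ₁ + t, w₁ + t • b) ∈ P := by
      have hc1 : ContinuousAt (fun t : ℂ ↦ (ζ₁ + t, w₁ + t • b)) 0 := by fun_prop
      have := hc1.eventually_mem (s := Metric.ball (0 : ℂ) ρ ×ˢ Metric.ball (F 0) σ)
        ((Metric.isOpen_ball.prod Metric.isOpen_ball).mem_nhds (by simpa using hk))
      filter_upwards [this] with t ht
      exact ⟨Metric.ball_subset_closedBall ht.1, Metric.ball_subset_closedBall ht.2⟩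
    filter_upwards [hGo, hin] with t ht htP
    have h1 : m (w₁ + t • b) * Real.exp (e (ζ₁ + t) - N * ‖w₁ + t • b - F (ζ₁ + t)‖ ^ 2) ≤
      m w₁ * Real.exp (e ζ₁ - N * ‖w₁ - F ζ₁‖ ^ 2) := hmaxN htP
    rw [← le_div_iff₀ (Real.exp_pos _), mul_div_assoc, ← Real.exp_sub] at h1
    refine h1.trans (mul_le_mul_of_nonneg_left (Real.exp_le_exp.2 ?_) (mnn _))
    have h2 : w₁ + t • b - F (ζ₁ + t) = a₀ + G t := by simp only [ha₀, hG]; abel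
    have h3 : ‖ζ₁ + t‖ ^ 2 = ‖ζ₁‖ ^ 2 + 2 * (starRingEnd ℂ ζ₁ * t).re + ‖t‖ ^ 2 := by
      simp only [← Complex.normSq_eq_norm_sq, Complex.normSq_apply, Complex.add_re, Complex.add_im,
        Complex.mul_re, Complex.conj_re, Complex.conj_im]
      ring
    rw [h2, @norm_add_sq ℂ]
    simp only [he, h3, ← ha₀, Complex.add_re, Complex.sub_re, RCLike.re_eq_complex_re]
    have h4 : ((c : ℂ) * (starRingEnd ℂ ζ₁ * t)).re = c * (starRingEnd ℂ ζ₁ * t).re :=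
      Complex.re_ofReal_mul _ _
    have h5 : ((2 : ℂ) * N * inner ℂ a₀ (G t)).re = 2 * N * (inner ℂ a₀ (G t)).re := by
      have : ((2 : ℂ) * N) = ((2 * N : ℝ) : ℂ) := by push_cast; ring
      rw [this, Complex.re_ofReal_mul]
    rw [h4, h5]
    nlinarith

end Disc

/-! ### Zero sets and straightening of analytic maps -/

section AnalyticTools

variable {E F : Type*} [NormedAddCommGroup E] [NormedSpace ℂ E]
  [NormedAddCommGroup F] [NormedSpace ℂ F]

/-- Under `H`, the directional derivatives of a function vanishing on `S` again vanish on `S`, so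
the argument repeats at every order. -/
lemma iteratedFDeriv_eq_zero_of_forall_fderiv_eq_zero {U S : Set E} (hU : IsOpen U) (hSU : S ⊆ U)
    (H : ∀ h : E → ℂ, AnalyticOnNhd ℂ h U → (∀ z ∈ S, h z = 0) → ∀ z ∈ S, fderiv ℂ h z = 0)
    (n : ℕ) : ∀ h : E → ℂ, AnalyticOnNhd ℂ h U → (∀ z ∈ S, h z = 0) → ∀ z ∈ S,
      iteratedFDeriv ℂ n h z = 0 := by
  induction n with
  | zero =>
    intro h _ h0 z hz
    ext v
    simp [h0 z hz]
  | succ n ih =>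
    intro h hh h0 z hz
    ext v
    rw [iteratedFDeriv_succ_apply_right]
    set w := v (Fin.last n)
    have han : AnalyticOnNhd ℂ (fderiv ℂ h) U := hh.fderiv_of_isOpen hU
    have h1 := ih (fun y ↦ fderiv ℂ h y w)
      (fun y hy ↦ ((ContinuousLinearMap.apply ℂ ℂ w).analyticAt _).comp (han y hy))
      (fun y hy ↦ by rw [H h hh h0 y hy]; simp) z hz
    have h2 := (ContinuousLinearMap.apply ℂ ℂ w).iteratedFDeriv_comp_left
      (f := fderiv ℂ h) (x := z) (n := ω) (i := n) (han z (hSU hz)).contDiffAt (by simp)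
    have h3 : iteratedFDeriv ℂ n (fun y ↦ fderiv ℂ h y w) z =
      iteratedFDeriv ℂ n (⇑((ContinuousLinearMap.apply ℂ ℂ) w) ∘ fderiv ℂ h) z := rfl
    rw [← h3, h1] at h2
    have h4 := congrArg (fun T ↦ T (Fin.init v)) h2
    simpa using h4.symm

/-- If a nonzero analytic function vanishes on the nonempty set `S`, then some analytic function
vanishing on `S` has nonzero differential at some point of `S`. -/
lemma exists_analytic_fderiv_ne_zero {U S : Set E} (hU : IsOpen U) (hUc : IsPreconnected U)
    (hSU : S ⊆ U) (hS : S.Nonempty) {g : E → ℂ} (hg : AnalyticOnNhd ℂ g U)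
    (hgS : ∀ z ∈ S, g z = 0) (hne : ∃ z ∈ U, g z ≠ 0) :
    ∃ h : E → ℂ, AnalyticOnNhd ℂ h U ∧ (∀ z ∈ S, h z = 0) ∧ ∃ z ∈ S, fderiv ℂ h z ≠ 0 := by
  -- Otherwise all Taylor coefficients of `g` at a point of `S` vanish, and `g` is zero by the
  -- identity theorem.
  by_contra! H
  obtain ⟨z, hz⟩ := hS
  obtain ⟨x, hx, hgx⟩ := hne
  refine hgx (hg.eqOn_zero_of_preconnected_of_eventuallyEq_zero hUc (hSU hz) ?_ hx)
  obtain ⟨p, r, hp⟩ := hg z (hSU hz)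
  have hev : ∀ᶠ y in 𝓝 z, y - z ∈ Metric.eball (0 : E) r := by
    have : ContinuousAt (fun y : E ↦ y - z) z := by fun_prop
    exact this.eventually_mem (by simpa using Metric.eball_mem_nhds (0 : E) hp.r_pos)
  filter_upwards [hev] with y hy
  have h1 := hp.hasSum_iteratedFDeriv hy
  simp only [iteratedFDeriv_eq_zero_of_forall_fderiv_eq_zero hU hSU H _ g hg hgS z hz,
    zero_apply, smul_zero, add_sub_cancel] at h1
  exact h1.unique hasSum_zero

/-- A holomorphic map with surjective differential is a coordinate projection in suitable
holomorphic coordinates. -/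
lemma exists_analytic_straightening [FiniteDimensional ℂ E] [FiniteDimensional ℂ F]
    {h : E → F} {z : E} (hh : AnalyticAt ℂ h z) (hsurj : (fderiv ℂ h z).range = ⊤) {N : Set E}
    (hN : N ∈ 𝓝 z) :
    ∃ r > 0, ∃ Ψ : F × (fderiv ℂ h z).ker → E, AnalyticOnNhd ℂ Ψ (Metric.ball (h z, 0) r) ∧
      Ψ (h z, 0) = z ∧ MapsTo Ψ (Metric.ball (h z, 0) r) N ∧
      (∀ q ∈ Metric.ball (h z, 0) r, h (Ψ q) = q.1) ∧
      ∀ V ⊆ Metric.ball (h z, 0) r, IsOpen V → IsOpen (Ψ '' V) := by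
  have : CompleteSpace E := FiniteDimensional.complete ℂ E
  have : CompleteSpace F := FiniteDimensional.complete ℂ F
  have hs : HasStrictFDerivAt h (fderiv ℂ h z) z := hh.hasStrictFDerivAt
  have hker := (fderiv ℂ h z).ker_closedComplemented_of_finiteDimensional_range
  -- The coordinates are `h` itself and a projection of `x - z` to the kernel of the differential;
  -- `Ψ` is their local inverse.
  set φ := HasStrictFDerivAt.implicitFunctionDataOfComplemented h (fderiv ℂ h z) hs hsurj hker
    with hφ
  set Φ := φ.toOpenPartialHomeomorph with hΦ
  have hpt : φ.pt = z := rfl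
  have hzs : z ∈ Φ.source := φ.pt_mem_toOpenPartialHomeomorph_source
  have hΦ1 : ∀ x, (Φ x).1 = h x := fun x ↦ rfl
  have hΦz : Φ z = (h z, 0) := by
    refine Prod.ext rfl ?_
    change (Classical.choose hker) (z - z) = 0
    simp
  have hΦan : AnalyticAt ℂ Φ z := by
    refine hh.prod ?_
    change AnalyticAt ℂ (fun x ↦ (Classical.choose hker) (x - z)) z
    exact ((Classical.choose hker).analyticAt _).comp (analyticAt_id.sub analyticAt_const)
  have hsym : AnalyticAt ℂ Φ.symm (Φ z) :=
    Φ.analyticAt_symm' hzs hΦan φ.hasStrictFDerivAt.hasFDerivAt.fderiv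
  rw [hΦz] at hsym
  have htgt : Φ.target ∈ 𝓝 ((h z, 0) : F × (fderiv ℂ h z).ker) := by
    rw [← hΦz]; exact Φ.open_target.mem_nhds (Φ.map_source hzs)
  have hsz : Φ.symm (h z, 0) = z := by rw [← hΦz]; exact Φ.left_inv hzs
  have hNev : ∀ᶠ q in 𝓝 ((h z, 0) : F × (fderiv ℂ h z).ker), Φ.symm q ∈ N :=
    hsym.continuousAt.eventually_mem (by rwa [hsz])
  obtain ⟨r, hr, hb⟩ := Metric.eventually_nhds_iff_ball.1
    (hsym.eventually_analyticAt.and (hNev.and htgt))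
  refine ⟨r, hr, Φ.symm, fun q hq ↦ (hb q hq).1, hsz, fun q hq ↦ (hb q hq).2.1, ?_, ?_⟩
  · intro q hq
    rw [← hΦ1, Φ.right_inv (hb q hq).2.2]
  · intro V hV hVo
    exact Φ.symm.isOpen_image_of_subset_source hVo fun q hq ↦ (hb q (hV hq)).2.2

end AnalyticTools

/-! ### Calculus of log-plurisubharmonic functions and the maximum principle -/

section LogPSH

variable {E E' : Type*} [NormedAddCommGroup E] [NormedSpace ℂ E]
  [NormedAddCommGroup E'] [NormedSpace ℂ E']

lemma IsLogPSH.comp {m : E → ℝ} {Ω : Set E} (hm : IsLogPSH m Ω) {Ψ : E' → E} {Ω' : Set E'}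
    (hΨ : AnalyticOnNhd ℂ Ψ Ω') (hmaps : MapsTo Ψ Ω' Ω) : IsLogPSH (fun z ↦ m (Ψ z)) Ω' := by
  intro γ hγ h0 hpos K hK hK0 c hc h
  exact hm (fun ζ ↦ Ψ (γ ζ)) ((hΨ _ h0).comp hγ) (hmaps h0) hpos K hK hK0 c hc h

/-- A branch of the logarithm normalized at `0`. It lets the modulus of a zero-free holomorphic
factor be absorbed into the harmonic part of a test function. -/
lemma exists_analytic_log {κ : ℂ → ℂ} (hκ : AnalyticAt ℂ κ 0) (h0 : κ 0 ≠ 0) :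
    ∃ K : ℂ → ℂ, AnalyticAt ℂ K 0 ∧ K 0 = 0 ∧
      ∀ᶠ ζ : ℂ in 𝓝 0, ‖κ ζ‖ = ‖κ 0‖ * Real.exp (K ζ).re := by
  refine ⟨fun ζ ↦ Complex.log (κ ζ / κ 0), ?_, by simp [h0], ?_⟩
  · refine (hκ.div analyticAt_const h0).clog ?_
    simp [h0]
  · filter_upwards [hκ.continuousAt.eventually_ne h0] with ζ hζ
    rw [Complex.log_re, Real.exp_log (norm_pos_iff.2 (div_ne_zero hζ h0)), norm_div]
    field_simp [norm_ne_zero_iff.2 h0]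

lemma IsLogPSH.mul_norm_sq {m : E → ℝ} {Ω : Set E} (hm : IsLogPSH m Ω) (hm0 : ∀ z, 0 ≤ m z)
    {κ : E → ℂ} (hκ : AnalyticOnNhd ℂ κ Ω) : IsLogPSH (fun z ↦ m z * ‖κ z‖ ^ 2) Ω := by
  intro γ hγ h0 hpos K hK hK0 c hc h
  have hκ0 : κ (γ 0) ≠ 0 := by
    intro h; simp [h] at hpos
  have hm0' : 0 < m (γ 0) := lt_of_le_of_ne (hm0 _) fun h ↦ by simp [← h] at hpos
  obtain ⟨L, hL, hL0, hLe⟩ := exists_analytic_log ((hκ _ h0).comp hγ) hκ0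
  refine hm γ hγ h0 hm0' (fun ζ ↦ K ζ - 2 * L ζ) (hK.sub (analyticAt_const.mul hL))
    (by simp [hK0, hL0]) c hc ?_
  filter_upwards [h, hLe] with ζ h1 h2
  simp only [Function.comp] at h2
  have h3 : 0 < ‖κ (γ 0)‖ ^ 2 := by positivity
  rw [h2, mul_pow, ← Real.exp_nat_mul] at h1
  have h4 : (K ζ - 2 * L ζ).re - c * ‖ζ‖ ^ 2 = ((K ζ).re - c * ‖ζ‖ ^ 2) - (2 : ℕ) * (L ζ).re := by
    simp; ring
  rw [h4, Real.exp_sub _ ((2 : ℕ) * (L ζ).re), ← mul_div_assoc, le_div_iff₀ (Real.exp_pos _)]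
  refine le_of_mul_le_mul_right ?_ h3
  linarith

/-- A positive power of `∑ ‖g j‖ ^ 2` is log-plurisubharmonic. -/
lemma exists_analytic_le_sum_norm_sq_rpow {k : ℕ} {g : Fin k → ℂ → ℂ}
    (hg : ∀ j, AnalyticAt ℂ (g j) 0) (hpos : 0 < ∑ j, ‖g j 0‖ ^ 2) {δ : ℝ} (hδ : 0 < δ) :
    ∃ K : ℂ → ℂ, AnalyticAt ℂ K 0 ∧ K 0 = 0 ∧ ∀ᶠ ζ : ℂ in 𝓝 0,
      (∑ j, ‖g j 0‖ ^ 2) ^ δ * Real.exp (K ζ).re ≤ (∑ j, ‖g j ζ‖ ^ 2) ^ δ := by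
  set G : ℂ → ℝ := fun ζ ↦ ∑ j, ‖g j ζ‖ ^ 2 with hG
  -- By Cauchy–Schwarz `‖κ ζ‖ ^ 2 ≤ G 0 * G ζ`, with equality at `0`: the harmonic function `2 log
  -- ‖κ‖ - log (G 0)` supports `log G` from below.
  set κ : ℂ → ℂ := fun ζ ↦ ∑ j, conj (g j 0) * g j ζ with hκ
  have hκan : AnalyticAt ℂ κ 0 := by
    apply Finset.analyticAt_fun_sum
    exact fun j _ ↦ analyticAt_const.mul (hg j)
  have hκ0 : κ 0 = (G 0 : ℂ) := by
    simp [hκ, hG, Complex.conj_mul']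
  have hκne : κ 0 ≠ 0 := by rw [hκ0]; exact_mod_cast hpos.ne'
  obtain ⟨L, hL, hL0, hLe⟩ := exists_analytic_log hκan hκne
  refine ⟨fun ζ ↦ (2 * δ : ℝ) * L ζ, analyticAt_const.mul hL, by simp [hL0], ?_⟩
  filter_upwards [hLe] with ζ hζ
  have hCS : ‖κ ζ‖ ^ 2 ≤ G 0 * G ζ := by
    have h1 : ‖κ ζ‖ ≤ ∑ j, ‖g j 0‖ * ‖g j ζ‖ := by
      refine (norm_sum_le _ _).trans_eq ?_
      simp
    calc ‖κ ζ‖ ^ 2 ≤ (∑ j, ‖g j 0‖ * ‖g j ζ‖) ^ 2 := by gcongr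
      _ ≤ _ := Finset.sum_mul_sq_le_sq_mul_sq _ _ _
  have hn : ‖κ 0‖ = G 0 := by
    rw [hκ0, Complex.norm_real, Real.norm_of_nonneg hpos.le]
  rw [hζ, hn] at hCS
  have h2 : G 0 * Real.exp (2 * (L ζ).re) ≤ G ζ := by
    refine le_of_mul_le_mul_left ?_ hpos
    calc G 0 * (G 0 * Real.exp (2 * (L ζ).re)) = (G 0 * Real.exp (L ζ).re) ^ 2 := by
          rw [two_mul, Real.exp_add]; ring
      _ ≤ _ := hCS
  calc G 0 ^ δ * Real.exp (((2 * δ : ℝ) : ℂ) * L ζ).re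
      = (G 0 * Real.exp (2 * (L ζ).re)) ^ δ := by
        rw [Real.mul_rpow hpos.le (Real.exp_pos _).le, ← Real.exp_mul, Complex.re_ofReal_mul]
        congr 2; ring
    _ ≤ G ζ ^ δ := Real.rpow_le_rpow (by positivity) h2 hδ.le

/-- Where `G` vanishes, the factor `G ^ δ` tends to zero, so a local upper bound on `m` replaces
semicontinuity. Maxima therefore exist on compact sets that meet the exceptional set. -/
lemma upperSemicontinuousOn_mul_rpow {α : Type*} [TopologicalSpace α] {D : Set α} {m G : α → ℝ}
    (hG0 : ∀ x ∈ D, 0 ≤ G x) (hG : ContinuousOn G D)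
    (hm : ∀ x ∈ D, G x ≠ 0 → UpperSemicontinuousWithinAt m D x)
    (hbd : ∀ x ∈ D, G x = 0 → ∃ C : ℝ, ∀ᶠ y in 𝓝[D] x, G y ≠ 0 → m y ≤ C) {δ : ℝ} (hδ : 0 < δ) :
    UpperSemicontinuousOn (fun x ↦ m x * G x ^ δ) D := by
  intro x hx
  have hcont : ContinuousWithinAt (fun x ↦ G x ^ δ) D x := (hG x hx).rpow_const (Or.inr hδ.le)
  by_cases hGx : G x = 0
  · intro y hy
    simp only [hGx, Real.zero_rpow hδ.ne', mul_zero] at hy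
    obtain ⟨C, hC⟩ := hbd x hx hGx
    have h1 : ∀ᶠ z in 𝓝[D] x, C * G z ^ δ < y := by
      have h2 := (continuousWithinAt_const (b := C)).mul hcont
      refine h2.eventually_lt continuousWithinAt_const ?_
      simpa [hGx, Real.zero_rpow hδ.ne'] using hy
    filter_upwards [h1, hC, self_mem_nhdsWithin] with z h1 h2 hz
    by_cases hGz : G z = 0
    · simpa [hGz, Real.zero_rpow hδ.ne'] using hy
    · exact (mul_le_mul_of_nonneg_right (h2 hGz) (Real.rpow_nonneg (hG0 z hz) _)).trans_lt h1
  · exact upperSemicontinuousWithinAt_mul (hm x hx hGx) hcont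
      fun z hz ↦ Real.rpow_nonneg (hG0 z hz) _

/-- Maximum principle on the disc for a function that is log-subharmonic and locally bounded off the
common zeros of the holomorphic functions `g j`. -/
lemma le_of_le_on_circle {m : ℂ → ℝ} {k : ℕ} {g : Fin k → ℂ → ℂ} {r C : ℝ} (hC : 0 ≤ C)
    (hm0 : ∀ z, 0 ≤ m z) (hg : ∀ j, AnalyticOnNhd ℂ (g j) (Metric.closedBall 0 r))
    (hm : IsLogPSH m {ζ ∈ Metric.ball 0 r | ∃ j, g j ζ ≠ 0})
    (husc : ∀ ζ ∈ Metric.closedBall (0 : ℂ) r, (∃ j, g j ζ ≠ 0) → UpperSemicontinuousAt m ζ)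
    (hbd : ∀ ζ ∈ Metric.closedBall (0 : ℂ) r, ∃ C : ℝ, ∀ᶠ y in 𝓝 ζ, (∃ j, g j y ≠ 0) → m y ≤ C)
    (hcirc : ∀ ζ ∈ Metric.sphere (0 : ℂ) r, (∃ j, g j ζ ≠ 0) → m ζ ≤ C) {ζ : ℂ}
    (hζ : ζ ∈ Metric.ball (0 : ℂ) r) (hgζ : ∃ j, g j ζ ≠ 0) : m ζ ≤ C := by
  by_contra! hlt
  set D := Metric.closedBall (0 : ℂ) r with hD
  set G : ℂ → ℝ := fun ζ ↦ ∑ j, ‖g j ζ‖ ^ 2 with hGdef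
  have hr : 0 < r := Metric.pos_of_mem_ball hζ
  have hζD : ζ ∈ D := Metric.ball_subset_closedBall hζ
  have hGne : ∀ x, G x ≠ 0 ↔ ∃ j, g j x ≠ 0 := by
    intro x
    rw [not_iff_comm, hGdef]
    simp only [Finset.sum_eq_zero_iff_of_nonneg (fun i _ ↦ sq_nonneg ‖g i x‖)]
    simp
  have hG0 : ∀ x, 0 ≤ G x := fun x ↦ Finset.sum_nonneg fun _ _ ↦ sq_nonneg _
  have hGcont : ContinuousOn G D :=
    continuousOn_finsetSum _ fun j _ ↦ ((hg j).continuousOn.norm.pow 2)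
  obtain ⟨B, hB⟩ := ((isCompact_closedBall (0 : ℂ) r).image_of_continuousOn hGcont).bddAbove
  have hGB : ∀ x ∈ D, G x ≤ max B 1 := fun x hx ↦
    (hB (mem_image_of_mem _ hx)).trans (le_max_left _ _)
  have hGpos : 0 < G ζ := lt_of_le_of_ne (hG0 ζ) ((hGne ζ).2 hgζ).symm
  set B' := max B 1
  have hB'pos : 0 < B' := lt_of_lt_of_le one_pos (le_max_right _ _)
  -- The factor `exp (ε * ‖x‖ ^ 2)` creates strict subharmonicity and `G ^ δ` makes the product
  -- vanish where `m` is uncontrolled. Both exponents are so small that the violation at `ζ` still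
  -- exceeds every value on the circle.
  obtain ⟨ε, hε, hεlt⟩ : ∃ ε : ℝ, 0 < ε ∧ C * Real.exp (ε * r ^ 2) < m ζ := by
    have h1 : ∀ᶠ ε : ℝ in 𝓝[>] 0, C * Real.exp (ε * r ^ 2) < m ζ := by
      have : ContinuousAt (fun ε : ℝ ↦ C * Real.exp (ε * r ^ 2)) 0 := by fun_prop
      exact (this.eventually_lt continuousAt_const (by simpa using hlt)).filter_mono
        nhdsWithin_le_nhds
    obtain ⟨ε, h2, h3⟩ := (h1.and self_mem_nhdsWithin).exists
    exact ⟨ε, h3, h2⟩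
  obtain ⟨δ, hδ, hδlt⟩ : ∃ δ : ℝ, 0 < δ ∧
      C * Real.exp (ε * r ^ 2) * B' ^ δ < m ζ * G ζ ^ δ := by
    have h1 : ∀ᶠ δ : ℝ in 𝓝[>] 0, C * Real.exp (ε * r ^ 2) * B' ^ δ < m ζ * G ζ ^ δ := by
      have hc1 : ContinuousAt (fun δ : ℝ ↦ C * Real.exp (ε * r ^ 2) * B' ^ δ) 0 :=
        continuousAt_const.mul (Real.continuousAt_const_rpow hB'pos.ne')
      have hc2 : ContinuousAt (fun δ : ℝ ↦ m ζ * G ζ ^ δ) 0 :=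
        continuousAt_const.mul (Real.continuousAt_const_rpow hGpos.ne')
      exact (hc1.eventually_lt hc2 (by simpa using hεlt)).filter_mono nhdsWithin_le_nhds
    obtain ⟨δ, h2, h3⟩ := (h1.and self_mem_nhdsWithin).exists
    exact ⟨δ, h3, h2⟩
  have husc1 : UpperSemicontinuousOn (fun x ↦ m x * G x ^ δ) D := by
    refine upperSemicontinuousOn_mul_rpow (fun x _ ↦ hG0 x) hGcont ?_ ?_ hδ
    · intro x hx hGx
      exact (husc x hx ((hGne x).1 hGx)).upperSemicontinuousWithinAt D
    · intro x hx _
      obtain ⟨C', hC'⟩ := hbd x hx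
      exact ⟨C', (hC'.filter_mono nhdsWithin_le_nhds).mono fun y hy h ↦ hy ((hGne y).1 h)⟩
  have husc2 : UpperSemicontinuousOn (fun x ↦ m x * G x ^ δ * Real.exp (ε * ‖x‖ ^ 2)) D :=
    fun x hx ↦ upperSemicontinuousWithinAt_mul (husc1 x hx)
      (by fun_prop) fun _ _ ↦ (Real.exp_pos _).le
  obtain ⟨x, hxD, hxmax⟩ := husc2.exists_isMaxOn ⟨ζ, hζD⟩ (isCompact_closedBall _ _)
  have hx1 : C * Real.exp (ε * r ^ 2) * B' ^ δ < m x * G x ^ δ * Real.exp (ε * ‖x‖ ^ 2) := by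
    refine hδlt.trans_le (le_trans ?_ (hxmax hζD))
    refine le_mul_of_one_le_right (mul_nonneg (hm0 _) (Real.rpow_nonneg (hG0 _) _)) ?_
    exact Real.one_le_exp (by positivity)
  have hx0 : 0 < m x * G x ^ δ * Real.exp (ε * ‖x‖ ^ 2) := lt_of_le_of_lt (by positivity) hx1
  have hGx : G x ≠ 0 := by
    intro h; simp [h, Real.zero_rpow hδ.ne'] at hx0
  have hGxpos : 0 < G x := lt_of_le_of_ne (hG0 x) hGx.symm
  have hmx : 0 < m x := lt_of_le_of_ne (hm0 x) fun h ↦ by simp [← h] at hx0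
  have hxball : x ∈ Metric.ball (0 : ℂ) r := by
    by_contra hxb
    have hxn : ‖x‖ = r := le_antisymm (by simpa [hD] using hxD) (by simpa using hxb)
    have h1 := hcirc x (by simpa using hxn) ((hGne x).1 hGx)
    have h2 : G x ^ δ ≤ B' ^ δ := Real.rpow_le_rpow (hG0 x) (hGB x hxD) hδ.le
    rw [hxn] at hx1
    have h3 : m x * G x ^ δ ≤ C * B' ^ δ := mul_le_mul h1 h2 (Real.rpow_nonneg (hG0 _) _) hC
    nlinarith [Real.exp_pos (ε * r ^ 2)]
  have hshift : AnalyticAt ℂ (fun t : ℂ ↦ x + t) 0 := analyticAt_const.add analyticAt_id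
  -- An interior maximum is a forbidden touching: `L` supports `G ^ δ` from below, and `‖x + t‖ ^ 2`
  -- is harmonic up to the term `‖t‖ ^ 2`.
  obtain ⟨L, hL, hL0, hLe⟩ := exists_analytic_le_sum_norm_sq_rpow (g := fun j t ↦ g j (x + t))
    (fun j ↦ (hg j x hxD).comp_of_eq hshift (by simp)) (by simpa using hGxpos) hδ
  refine hm (fun t ↦ x + t) hshift (by simpa using ⟨by simpa using hxball, (hGne x).1 hGx⟩)
    (by simpa using hmx) (fun t ↦ - L t - 2 * ε * (conj x * t))
    (hL.neg.sub (analyticAt_const.mul (analyticAt_const.mul analyticAt_id))) (by simp [hL0]) ε hε ?_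
  have hin : ∀ᶠ t : ℂ in 𝓝 0, x + t ∈ D := by
    have : ContinuousAt (fun t : ℂ ↦ x + t) 0 := by fun_prop
    have h1 : ∀ᶠ t : ℂ in 𝓝 0, x + t ∈ Metric.ball (0 : ℂ) r :=
      this.eventually_mem (Metric.isOpen_ball.mem_nhds (by simpa using hxball))
    filter_upwards [h1] with t ht using Metric.ball_subset_closedBall ht
  filter_upwards [hLe, hin] with t h1 htD
  have h2 : m (x + t) * G (x + t) ^ δ * Real.exp (ε * ‖x + t‖ ^ 2) ≤
    m x * G x ^ δ * Real.exp (ε * ‖x‖ ^ 2) := hxmax htD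
  simp only [add_zero] at h1 ⊢
  have h3 : ‖x + t‖ ^ 2 = ‖x‖ ^ 2 + 2 * (conj x * t).re + ‖t‖ ^ 2 := by
    simp only [← Complex.normSq_eq_norm_sq, Complex.normSq_apply, Complex.add_re, Complex.add_im,
      Complex.mul_re, Complex.conj_re, Complex.conj_im]
    ring
  have hGδ : 0 < G x ^ δ := Real.rpow_pos_of_pos hGxpos _
  have h4 : m (x + t) * (G x ^ δ * Real.exp (L t).re) * Real.exp (ε * ‖x + t‖ ^ 2) ≤
      m x * G x ^ δ * Real.exp (ε * ‖x‖ ^ 2) := by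
    refine le_trans ?_ h2
    gcongr
    exact hm0 _
  have h5 : (-L t - 2 * ε * (conj x * t)).re - ε * ‖t‖ ^ 2 =
      ε * ‖x‖ ^ 2 - ((L t).re + ε * ‖x + t‖ ^ 2) := by
    have : ((2 : ℂ) * ε * (conj x * t)).re = 2 * ε * (conj x * t).re := by
      have : ((2 : ℂ) * ε) = ((2 * ε : ℝ) : ℂ) := by push_cast; ring
      rw [this, Complex.re_ofReal_mul]
    rw [h3, Complex.sub_re, this, Complex.neg_re]
    ring
  rw [h5, Real.exp_sub, Real.exp_add, ← mul_div_assoc, le_div_iff₀ (by positivity)]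
  refine le_of_mul_le_mul_left ?_ hGδ
  linarith

end LogPSH

/-! ### Local bounds across analytic sets of codimension two -/

section Removable

variable {E : Type*} [NormedAddCommGroup E] [NormedSpace ℂ E] [FiniteDimensional ℂ E]

/-- A family of log-plurisubharmonic functions, locally uniformly bounded off an analytic subset of
codimension at least two, is locally uniformly bounded near that subset. -/
theorem exists_local_bound_of_codim_two {ι : Type*} {m : ι → E → ℝ} {Ω Z : Set E}
    (hZ : ∀ z ∈ Ω, ∃ U : Set E, IsOpen U ∧ z ∈ U ∧ U ⊆ Ω ∧ ∃ (k : ℕ) (g : Fin k → E → ℂ),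
      (∀ j, AnalyticOnNhd ℂ (g j) U) ∧ Z ∩ U = {y ∈ U | ∀ j, g j y = 0})
    (hcodim : ∀ V ⊆ Ω, IsOpen V → ∀ g : E → ℂ, AnalyticOnNhd ℂ g V → (∃ y ∈ V, g y = 0) →
      ¬ {y ∈ V | g y = 0} ⊆ Z)
    (hm0 : ∀ a z, 0 ≤ m a z) (hm : ∀ a, IsLogPSH (m a) (Ω \ Z))
    (husc : ∀ a, ∀ z ∈ Ω \ Z, UpperSemicontinuousAt (m a) z)
    (hbd : ∀ z ∈ Ω \ Z, ∃ C : ℝ, ∀ᶠ y in 𝓝 z, y ∉ Z → ∀ a, m a y ≤ C) :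
    ∀ z ∈ Ω, ∃ C : ℝ, ∀ᶠ y in 𝓝 z, y ∉ Z → ∀ a, m a y ≤ C := by
  by_contra! hbad
  -- `S` consists of the points without a local bound. Near a suitable one of its points it lies in
  -- a smooth hypersurface `h = 0`, however singular `Z` may be there; no stratification of `Z` is
  -- needed.
  set S : Set E := {z ∈ Ω | ¬ ∃ C : ℝ, ∀ᶠ y in 𝓝 z, y ∉ Z → ∀ a, m a y ≤ C} with hS
  have hSZ : S ⊆ Z := by
    intro z hz
    by_contra hzZ
    exact hz.2 (hbd z ⟨hz.1, hzZ⟩)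
  obtain ⟨z₁, hz₁Ω, hz₁⟩ := hbad
  have hz₁S : z₁ ∈ S := ⟨hz₁Ω, by push Not; exact hz₁⟩
  obtain ⟨U, hU, hz₁U, hUΩ, k, g, hg, hgZ⟩ := hZ z₁ hz₁Ω
  obtain ⟨R, hR, hRU⟩ := Metric.isOpen_iff.1 hU z₁ hz₁U
  set B := Metric.ball z₁ R with hB
  have hmemZ : ∀ y ∈ B, (y ∈ Z ↔ ∀ j, g j y = 0) := by
    intro y hy
    have : y ∈ Z ∩ U ↔ y ∈ {y ∈ U | ∀ j, g j y = 0} := by rw [hgZ]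
    simpa [hRU hy] using this
  have hBΩ : B ⊆ Ω := hRU.trans hUΩ
  -- The codimension condition for the zero function says that `Z` has empty interior.
  obtain ⟨x, hxB, j, hj⟩ : ∃ x ∈ B, ∃ j, g j x ≠ 0 := by
    by_contra! h
    exact hcodim B hBΩ Metric.isOpen_ball 0 (fun _ _ ↦ analyticAt_const)
      ⟨z₁, Metric.mem_ball_self hR, rfl⟩ fun y hy ↦ (hmemZ y hy.1).2 (h y hy.1)
  obtain ⟨h, hh, hhS, z₀, hz₀, hdh⟩ := exists_analytic_fderiv_ne_zero (S := S ∩ B)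
    Metric.isOpen_ball (convex_ball z₁ R).isPreconnected inter_subset_right
    ⟨z₁, hz₁S, Metric.mem_ball_self hR⟩ (fun y hy ↦ hg j y (hRU hy))
    (fun z hz ↦ (hmemZ z hz.2).1 (hSZ hz.1) j) ⟨x, hxB, hj⟩
  have hsurj : (fderiv ℂ h z₀).range = ⊤ :=
    LinearMap.range_eq_top.2 (LinearMap.surjective fun h0 ↦ hdh (by ext v; exact congrArg (· v) h0))
  set K := (fderiv ℂ h z₀).ker with hK
  obtain ⟨r, hr, Ψ, hΨ, hΨ0, hΨB, hhΨ, hΨo⟩ : ∃ r > 0, ∃ Ψ : ℂ × K → E,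
      AnalyticOnNhd ℂ Ψ (Metric.ball (0, 0) r) ∧ Ψ (0, 0) = z₀ ∧ MapsTo Ψ (Metric.ball (0, 0) r) B ∧
      (∀ q ∈ Metric.ball (0, 0) r, h (Ψ q) = q.1) ∧
      ∀ V ⊆ Metric.ball (0, 0) r, IsOpen V → IsOpen (Ψ '' V) := by
    have key := exists_analytic_straightening (hh z₀ hz₀.2) hsurj
      (Metric.isOpen_ball.mem_nhds hz₀.2)
    rwa [hhS z₀ hz₀] at key
  have hball : ∀ ρ : ℝ, Metric.ball ((0, 0) : ℂ × K) ρ = Metric.ball 0 ρ ×ˢ Metric.ball 0 ρ :=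
    fun ρ ↦ (ball_prod_same _ _ _).symm
  set ρ := r / 2 with hρ
  have hρ0 : 0 < ρ := by positivity
  have hin : ∀ (ζ : ℂ) (w : K), ‖ζ‖ ≤ ρ → ‖w‖ ≤ ρ → (ζ, w) ∈ Metric.ball ((0, 0) : ℂ × K) r := by
    intro ζ w h1 h2
    rw [hball]
    constructor <;> rw [mem_ball_zero_iff] <;> linarith
  -- points with nonzero first coordinate are good
  have hgood : ∀ q ∈ Metric.ball ((0, 0) : ℂ × K) r, (q.1 ≠ 0 ∨ ∃ j, g j (Ψ q) ≠ 0) →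
      ∃ C : ℝ, ∀ᶠ y in 𝓝 q, Ψ y ∉ Z → ∀ a, m a (Ψ y) ≤ C := by
    intro q hq hne
    have hΨqB : Ψ q ∈ B := hΨB hq
    have hnS : Ψ q ∉ S := by
      intro hS'
      rcases hne with h1 | ⟨j, h1⟩
      · exact h1 (by rw [← hhΨ q hq]; exact hhS _ ⟨hS', hΨqB⟩)
      · exact h1 ((hmemZ _ hΨqB).1 (hSZ hS') j)
    have : ∃ C : ℝ, ∀ᶠ y in 𝓝 (Ψ q), y ∉ Z → ∀ a, m a y ≤ C := by
      by_contra h'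
      exact hnS ⟨hBΩ hΨqB, h'⟩
    obtain ⟨C, hC⟩ := this
    exact ⟨C, (hΨ q hq).continuousAt.eventually hC⟩
  -- In the coordinates `Ψ` the set `S` lies in `ζ = 0`, so `T` misses it. Compactness gives one
  -- bound on `T` for the whole family, to be carried inside by the maximum principle on the discs
  -- with `w` fixed.
  set T : Set (ℂ × K) := Metric.sphere 0 ρ ×ˢ Metric.closedBall 0 ρ with hT
  have hTc : IsCompact T := by
    have : ProperSpace K := FiniteDimensional.proper ℂ K
    exact (isCompact_sphere _ _).prod (isCompact_closedBall _ _)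
  obtain ⟨C, hC0, hC⟩ : ∃ C : ℝ, 0 ≤ C ∧ ∀ q ∈ T, Ψ q ∉ Z → ∀ a, m a (Ψ q) ≤ C := by
    refine hTc.induction_on (p := fun T ↦ ∃ C : ℝ, 0 ≤ C ∧ ∀ q ∈ T, Ψ q ∉ Z → ∀ a, m a (Ψ q) ≤ C)
      ⟨0, le_rfl, by simp⟩ ?_ ?_ ?_
    · rintro s t hst ⟨C, hC0, hC⟩
      exact ⟨C, hC0, fun q hq ↦ hC q (hst hq)⟩
    · rintro s t ⟨C, hC0, hC⟩ ⟨C', hC0', hC'⟩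
      refine ⟨max C C', le_max_of_le_left hC0, ?_⟩
      rintro q (hq | hq) h1 a
      · exact (hC q hq h1 a).trans (le_max_left _ _)
      · exact (hC' q hq h1 a).trans (le_max_right _ _)
    · rintro ⟨ζ, w⟩ hq
      have h1 : ‖ζ‖ = ρ := by simpa using hq.1
      have h2 : ‖w‖ ≤ ρ := by simpa using hq.2
      obtain ⟨C, hC⟩ := hgood (ζ, w) (hin ζ w h1.le h2) (Or.inl fun h0 : ζ = 0 ↦ by
        rw [h0, norm_zero] at h1; linarith)
      refine ⟨_, mem_nhdsWithin_of_mem_nhds hC, max C 0, le_max_right _ _, ?_⟩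
      intro q hq h1 a
      exact (hq h1 a).trans (le_max_left _ _)
  -- vertical discs missing the bad set
  have hvert : ∀ (ζ : ℂ) (w : K), ‖ζ‖ < ρ → ‖w‖ < ρ → (∃ j, g j (Ψ (0, w)) ≠ 0) →
      Ψ (ζ, w) ∉ Z → ∀ a, m a (Ψ (ζ, w)) ≤ C := by
    intro ζ w hζ hw hne hζZ a
    have hline : ∀ ζ ∈ Metric.closedBall (0 : ℂ) ρ, AnalyticAt ℂ (fun ζ : ℂ ↦ Ψ (ζ, w)) ζ := by
      intro ζ hζ
      exact (hΨ _ (hin ζ w (by simpa using hζ) hw.le)).comp_of_eq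
        (f := fun ζ : ℂ ↦ (ζ, w)) (analyticAt_id.prod analyticAt_const) rfl
    have hB' : ∀ ζ ∈ Metric.closedBall (0 : ℂ) ρ, Ψ (ζ, w) ∈ B := fun ζ hζ ↦
      hΨB (hin ζ w (by simpa using hζ) hw.le)
    have hnZ : ∀ ζ ∈ Metric.closedBall (0 : ℂ) ρ, (Ψ (ζ, w) ∉ Z ↔ ∃ j, g j (Ψ (ζ, w)) ≠ 0) := by
      intro ζ hζ
      rw [hmemZ _ (hB' ζ hζ)]; push Not; rfl
    refine le_of_le_on_circle (m := fun ζ ↦ m a (Ψ (ζ, w))) (g := fun j ζ ↦ g j (Ψ (ζ, w))) hC0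
      (fun _ ↦ hm0 _ _) ?_ ?_ ?_ ?_ ?_ (by simpa using hζ)
      ((hnZ ζ (by simpa using hζ.le)).1 hζZ)
    · intro j ζ hζ
      exact (hg j _ (hRU (hB' ζ hζ))).comp_of_eq (f := fun ζ : ℂ ↦ Ψ (ζ, w)) (hline ζ hζ) rfl
    · refine (hm a).comp (Ψ := fun ζ : ℂ ↦ Ψ (ζ, w)) ?_ ?_
      · exact fun ζ hζ ↦ hline ζ (Metric.ball_subset_closedBall hζ.1)
      · intro ζ hζ
        have hζ' := Metric.ball_subset_closedBall hζ.1
        exact ⟨hBΩ (hB' ζ hζ'), (hnZ ζ hζ').2 hζ.2⟩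
    · intro ζ hζ hne y hy
      exact (hline ζ hζ).continuousAt.eventually
        (husc a _ ⟨hBΩ (hB' ζ hζ), (hnZ ζ hζ).2 hne⟩ y hy)
    · intro ζ hζ
      have h1 : ζ ≠ 0 ∨ ∃ j, g j (Ψ (ζ, w)) ≠ 0 := by
        by_cases h0 : ζ = 0
        · rw [h0]; exact Or.inr hne
        · exact Or.inl h0
      obtain ⟨C', hC'⟩ := hgood (ζ, w) (hin ζ w (by simpa using hζ) hw.le) h1
      refine ⟨C', ?_⟩
      have hc : ContinuousAt (fun ζ : ℂ ↦ (ζ, w)) ζ := by fun_prop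
      have hc2 := (hline ζ hζ).continuousAt.eventually_mem
        (Metric.isOpen_ball.mem_nhds (hB' ζ hζ))
      filter_upwards [hc.eventually hC', hc2] with y hy hyB h2
      refine hy ?_ a
      rw [hmemZ _ hyB]; push Not; exact h2
    · intro ζ hζ hne
      exact hC (ζ, w) ⟨hζ, by simpa using hw.le⟩
        ((hnZ ζ (Metric.sphere_subset_closedBall hζ)).2 hne) a
  -- some `g j` is not identically zero on the hypersurface
  obtain ⟨w₁, hw₁, j₁, hj₁⟩ : ∃ w : K, ‖w‖ < ρ ∧ ∃ j, g j (Ψ (0, w)) ≠ 0 := by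
    by_contra! hzero
    have hsub : Metric.ball ((0, 0) : ℂ × K) ρ ⊆ Metric.ball (0, 0) r :=
      Metric.ball_subset_ball (by linarith)
    have hVB : Ψ '' Metric.ball (0, 0) ρ ⊆ B := by
      rintro _ ⟨q, hq, rfl⟩; exact hΨB (hsub hq)
    refine hcodim (Ψ '' Metric.ball (0, 0) ρ) (hVB.trans hBΩ) (hΨo _ hsub Metric.isOpen_ball) h
      (hh.mono hVB) ⟨z₀, ⟨(0, 0), Metric.mem_ball_self hρ0, hΨ0⟩, hhS _ hz₀⟩ ?_
    rintro _ ⟨⟨⟨ζ, w⟩, hq, rfl⟩, hq0⟩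
    rw [hhΨ _ (hsub hq)] at hq0
    rw [hmemZ _ (hVB ⟨_, hq, rfl⟩)]
    simp only at hq0
    rw [hq0] at hq ⊢
    rw [hball] at hq
    exact hzero w (by simpa using hq.2)
  -- There remain the `w` with `Ψ (0, w) ∈ Z`. On the complex line from `w` to `w₁`, other such
  -- parameters do not accumulate at `w`, so all nearby values are at most `C`. A value larger than
  -- `C` at the centre would then be an isolated peak, which the touching condition excludes.
  have hall : ∀ q ∈ Metric.ball ((0, 0) : ℂ × K) ρ, Ψ q ∉ Z → ∀ a, m a (Ψ q) ≤ C := by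
    rintro ⟨ζ, w⟩ hq hqZ a
    rw [hball] at hq
    have hζ : ‖ζ‖ < ρ := by simpa using hq.1
    have hw : ‖w‖ < ρ := by simpa using hq.2
    by_contra! hlt
    have hqr := hin ζ w hζ.le hw.le
    set γ : ℂ → ℂ × K := fun t ↦ (ζ, w + t • (w₁ - w)) with hγ
    have hγan : AnalyticAt ℂ γ 0 :=
      analyticAt_const.prod (analyticAt_const.add (analyticAt_id.smul analyticAt_const))
    have hγ0 : γ 0 = (ζ, w) := by simp [hγ]
    have hGne : ∀ᶠ t in 𝓝[≠] (0 : ℂ), g j₁ (Ψ (0, w + t • (w₁ - w))) ≠ 0 := by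
      set W : Set ℂ := {t : ℂ | w + t • (w₁ - w) ∈ Metric.ball (0 : K) ρ} with hW
      have hWan : AnalyticOnNhd ℂ (fun t : ℂ ↦ g j₁ (Ψ (0, w + t • (w₁ - w)))) W := by
        intro t ht
        have h1 : ((0 : ℂ), w + t • (w₁ - w)) ∈ Metric.ball ((0, 0) : ℂ × K) r :=
          hin 0 _ (by simpa using hρ0.le) (by simpa using (mem_ball_zero_iff.1 ht).le)
        refine ((hg j₁ _ (hRU (hΨB h1))).comp (hΨ _ h1)).comp_of_eq
          (f := fun t : ℂ ↦ ((0 : ℂ), w + t • (w₁ - w))) ?_ rfl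
        exact analyticAt_const.prod (analyticAt_const.add (analyticAt_id.smul analyticAt_const))
      have hWc : IsPreconnected W := by
        have : Convex ℝ W := by
          intro s hs t ht α β hα hβ hαβ
          have h3 := convex_ball (0 : K) ρ hs ht hα hβ hαβ
          have h4 : w + (α • s + β • t) • (w₁ - w) =
              α • (w + s • (w₁ - w)) + β • (w + t • (w₁ - w)) := by
            have : w = α • w + β • w := by rw [← add_smul, hαβ, one_smul]
            rw [smul_add, smul_add, add_smul, smul_assoc, smul_assoc]
            nth_rewrite 1 [this]
            abel
          rw [← h4] at h3
          exact h3
        exact this.isPreconnected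
      have h0W : (0 : ℂ) ∈ W := by simpa [hW] using hw
      rcases (hWan 0 h0W).eventually_eq_zero_or_eventually_ne_zero with h1 | h1
      · exfalso
        have := hWan.eqOn_zero_of_preconnected_of_eventuallyEq_zero hWc h0W h1
          (show (1 : ℂ) ∈ W by simpa [hW] using hw₁)
        simp only [one_smul, add_sub_cancel, Pi.zero_apply] at this
        exact hj₁ this
      · exact h1
    have hΨγ : AnalyticAt ℂ (fun t ↦ Ψ (γ t)) 0 := (hΨ _ hqr).comp_of_eq hγan hγ0
    have hnZ : ∀ᶠ t in 𝓝 (0 : ℂ), Ψ (γ t) ∉ Z := by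
      have h1 : Ψ (γ 0) ∈ B := by rw [hγ0]; exact hΨB hqr
      have h2 : ∃ j, g j (Ψ (γ 0)) ≠ 0 := by
        rw [hγ0]
        by_contra! h2
        exact hqZ ((hmemZ _ (hΨB hqr)).2 h2)
      obtain ⟨j, hj⟩ := h2
      have h3 : ContinuousAt (fun t ↦ g j (Ψ (γ t))) 0 :=
        ((hg j _ (hRU h1)).continuousAt).comp (f := fun t ↦ Ψ (γ t)) hΨγ.continuousAt
      filter_upwards [h3.eventually_ne hj, hΨγ.continuousAt.eventually_mem
        (Metric.isOpen_ball.mem_nhds h1)] with t ht htB htZ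
      exact ht ((hmemZ _ htB).1 htZ j)
    have hsmall : ∀ᶠ t in 𝓝 (0 : ℂ), ‖w + t • (w₁ - w)‖ < ρ := by
      have : ContinuousAt (fun t : ℂ ↦ ‖w + t • (w₁ - w)‖) 0 := by fun_prop
      exact this.eventually_lt continuousAt_const (by simpa using hw)
    have hexp : ∀ᶠ t in 𝓝 (0 : ℂ), C ≤ m a (Ψ (ζ, w)) * Real.exp (0 - 1 * ‖t‖ ^ 2) := by
      have : ContinuousAt (fun t : ℂ ↦ m a (Ψ (ζ, w)) * Real.exp (0 - 1 * ‖t‖ ^ 2)) 0 := by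
        fun_prop
      filter_upwards [continuousAt_const.eventually_lt (f := fun _ ↦ C) this
        (by simpa using hlt)] with t ht using ht.le
    refine hm a (fun t ↦ Ψ (γ t)) hΨγ (by rw [hγ0]; exact ⟨hBΩ (hΨB hqr), hqZ⟩)
      (by rw [hγ0]; exact hC0.trans_lt hlt) 0 analyticAt_const rfl 1 one_pos ?_
    rw [eventually_nhdsWithin_iff] at hGne
    filter_upwards [hGne, hnZ, hsmall, hexp] with t h1 h2 h3 h4
    rw [hγ0]
    simp only [Pi.zero_apply, Complex.zero_re]
    by_cases ht : t = 0
    · rw [ht, hγ0]; simp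
    · exact (hvert ζ _ hζ h3 ⟨j₁, h1 ht⟩ h2 a).trans h4
  refine hz₀.1.2 ⟨C, ?_⟩
  have hopen : Ψ '' Metric.ball (0, 0) ρ ∈ 𝓝 z₀ :=
    (hΨo _ (Metric.ball_subset_ball (by linarith)) Metric.isOpen_ball).mem_nhds
      ⟨(0, 0), Metric.mem_ball_self hρ0, hΨ0⟩
  filter_upwards [hopen]
  rintro _ ⟨q, hq, rfl⟩ h1
  exact hall q hq h1

end Removable

/-! ### Rank of holomorphic maps and the Morse–Sard theorem -/

section Sard

open Module

lemma analyticAt_matrix_det {E : Type*} [NormedAddCommGroup E] [NormedSpace ℂ E] {r : ℕ}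
    {M : E → Matrix (Fin r) (Fin r) ℂ} {z : E} (hM : ∀ i j, AnalyticAt ℂ (fun y ↦ M y i j) z) :
    AnalyticAt ℂ (fun y ↦ (M y).det) z := by
  simp only [Matrix.det_apply']
  refine Finset.analyticAt_fun_sum _ fun σ _ ↦ analyticAt_const.mul ?_
  exact Finset.analyticAt_fun_prod _ fun i _ ↦ hM _ _

variable {E F : Type*} [NormedAddCommGroup E] [NormedSpace ℂ E] [FiniteDimensional ℂ E]
  [NormedAddCommGroup F] [NormedSpace ℂ F] [FiniteDimensional ℂ F]

/-- Lower semicontinuity of the rank, witnessed by a minor. -/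
lemma exists_analytic_minor {U : Set E} (hU : IsOpen U) {f : E → F} (hf : AnalyticOnNhd ℂ f U)
    {z : E} :
    ∃ δ : E → ℂ, AnalyticOnNhd ℂ δ U ∧ δ z ≠ 0 ∧ ∀ x, δ x ≠ 0 →
      finrank ℂ (fderiv ℂ f z).range ≤ finrank ℂ (fderiv ℂ f x).range := by
  set R := (fderiv ℂ f z).range with hR
  obtain ⟨π, hπ⟩ := R.exists_isCompl.elim fun Q hQ ↦
    (⟨R.projectionOnto Q hQ, fun x ↦ Submodule.projectionOnto_apply_left hQ x⟩ :
      ∃ π : F →ₗ[ℂ] R, ∀ x : R, π x = x)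
  obtain ⟨B, hB⟩ := ((fderiv ℂ f z : E →ₗ[ℂ] F).rangeRestrict).exists_rightInverse_of_surjective
    (LinearMap.range_rangeRestrict _)
  let b := finBasis ℂ R
  -- `T z` is the identity, so its determinant is nonzero; wherever the determinant is nonzero, `π`
  -- maps the range of the differential onto `R`.
  set T : E → R →ₗ[ℂ] R := fun x ↦ π ∘ₗ (fderiv ℂ f x : E →ₗ[ℂ] F) ∘ₗ B with hT
  refine ⟨fun x ↦ (LinearMap.toMatrix b b (T x)).det, ?_, ?_, ?_⟩
  · intro x hx
    refine analyticAt_matrix_det fun i j ↦ ?_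
    have hfx : AnalyticAt ℂ (fderiv ℂ f) x := hf.fderiv_of_isOpen hU x hx
    have h1 : AnalyticAt ℂ (fun y ↦ fderiv ℂ f y (B (b j))) x :=
      ((ContinuousLinearMap.apply ℂ F (B (b j))).analyticAt _).comp hfx
    have h2 := ((LinearMap.toContinuousLinearMap ((b.coord i) ∘ₗ π)).analyticAt _).comp h1
    refine h2.congr (Eventually.of_forall fun y ↦ ?_)
    simp [LinearMap.toMatrix_apply, hT]
  · have h1 : T z = LinearMap.id := by
      ext x
      have := congrArg (fun L : R →ₗ[ℂ] R ↦ (L x : F)) hB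
      simp only [LinearMap.comp_apply, LinearMap.id_apply] at this
      have h2 : (fderiv ℂ f z) (B x) = (x : F) := this
      simp only [hT, LinearMap.comp_apply, ContinuousLinearMap.coe_coe, h2, hπ,
        LinearMap.id_apply]
    beta_reduce
    rw [h1]; simp
  · intro x hx
    beta_reduce at hx
    rw [LinearMap.det_toMatrix] at hx
    have h1 : LinearMap.range (T x) = ⊤ := LinearMap.range_eq_top.2
      (LinearMap.equivOfDetNeZero (T x) hx).surjective
    have h2 : LinearMap.range (T x) ≤ ((fderiv ℂ f x : E →ₗ[ℂ] F).range).map π := by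
      rintro _ ⟨v, rfl⟩
      exact ⟨_, ⟨B v, rfl⟩, rfl⟩
    rw [h1] at h2
    calc finrank ℂ R = finrank ℂ (⊤ : Submodule ℂ R) := (finrank_top ℂ R).symm
      _ ≤ finrank ℂ (((fderiv ℂ f x : E →ₗ[ℂ] F).range).map π) := Submodule.finrank_mono h2
      _ ≤ _ := Submodule.finrank_map_le _ _

/-- Near a point where the rank of a holomorphic map is locally maximal, the image has (real)
dimension at most twice the rank. -/
lemma exists_dimH_image_le_of_rank_max {f : E → F} {x : E} (hf : AnalyticAt ℂ f x)
    (hmax : ∀ᶠ y in 𝓝 x, finrank ℂ (fderiv ℂ f y).range ≤ finrank ℂ (fderiv ℂ f x).range) :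
    ∃ N ∈ 𝓝 x, dimH (f '' N) ≤ (2 * finrank ℂ (fderiv ℂ f x).range : ℕ) := by
  set R := (fderiv ℂ f x).range with hR
  obtain ⟨π₀, hπ₀⟩ := R.exists_isCompl.elim fun Q hQ ↦
    (⟨R.projectionOnto Q hQ, fun x ↦ Submodule.projectionOnto_apply_left hQ x⟩ :
      ∃ π : F →ₗ[ℂ] R, ∀ x : R, π x = x)
  set π : F →L[ℂ] R := LinearMap.toContinuousLinearMap π₀ with hπdef
  have hπ : ∀ x : R, π x = x := hπ₀
  -- This is the constant rank theorem. `h` is a submersion at `x`, and local maximality of the rank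
  -- makes `π` injective on the ranges of the differentials. So `f` is constant along the fibres of
  -- `h`, and its local image is parametrized by a ball in `R`.
  set h : E → R := fun y ↦ π (f y) with hh
  have hhan : AnalyticAt ℂ h x := (π.analyticAt _).comp hf
  have hdh : ∀ y, AnalyticAt ℂ f y → fderiv ℂ h y = π.comp (fderiv ℂ f y) := by
    intro y hy
    exact (π.hasFDerivAt.comp y hy.differentiableAt.hasFDerivAt).fderiv
  have hsurj : (fderiv ℂ h x).range = ⊤ := by
    rw [hdh x hf]
    refine LinearMap.range_eq_top.2 ?_
    rintro ⟨_, v, rfl⟩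
    exact ⟨v, hπ ⟨_, v, rfl⟩⟩
  obtain ⟨r, hr, Ψ, hΨ, hΨ0, hΨN, hhΨ, hΨo⟩ := exists_analytic_straightening hhan hsurj
    (hmax.and hf.eventually_analyticAt)
  set q₀ : R × (fderiv ℂ h x).ker := (h x, 0) with hq₀
  have hball : Metric.ball q₀ r = Metric.ball (h x) r ×ˢ Metric.ball 0 r :=
    (ball_prod_same _ _ _).symm
  refine ⟨Ψ '' Metric.ball q₀ r, (hΨo _ Subset.rfl Metric.isOpen_ball).mem_nhds
    ⟨q₀, Metric.mem_ball_self hr, hΨ0⟩, ?_⟩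
  have hfΨ : ∀ q ∈ Metric.ball q₀ r, AnalyticAt ℂ (fun q ↦ f (Ψ q)) q := fun q hq ↦
    AnalyticAt.comp (hΨN hq).2 (hΨ q hq)
  have hvert : ∀ q ∈ Metric.ball q₀ r, ∀ τ, fderiv ℂ (fun q ↦ f (Ψ q)) q (0, τ) = 0 := by
    intro q hq τ
    have hΨd := (hΨ q hq).differentiableAt.hasFDerivAt
    have hfd := (hΨN hq).2.differentiableAt.hasFDerivAt
    have h1 : fderiv ℂ (fun q ↦ f (Ψ q)) q = (fderiv ℂ f (Ψ q)).comp (fderiv ℂ Ψ q) :=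
      (hfd.comp q hΨd).fderiv
    have h2 : (π.comp (fderiv ℂ f (Ψ q))).comp (fderiv ℂ Ψ q) =
        ContinuousLinearMap.fst ℂ R (fderiv ℂ h x).ker := by
      have h3 : HasFDerivAt (fun q ↦ h (Ψ q)) ((π.comp (fderiv ℂ f (Ψ q))).comp (fderiv ℂ Ψ q)) q :=
        (π.hasFDerivAt.comp (Ψ q) hfd).comp q hΨd
      have h4 : (fun q ↦ h (Ψ q)) =ᶠ[𝓝 q] Prod.fst := by
        filter_upwards [Metric.isOpen_ball.mem_nhds hq] with y hy using hhΨ y hy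
      exact h3.unique (hasFDerivAt_fst.congr_of_eventuallyEq h4)
    set A := fderiv ℂ f (Ψ q) with hA
    -- `π` is injective on the range of `A`
    have hinj : Function.Injective (π₀.domRestrict A.range) := by
      have hsur : Function.Surjective (π₀.domRestrict A.range) := by
        intro u
        refine ⟨⟨A (fderiv ℂ Ψ q (u, 0)), _, rfl⟩, ?_⟩
        exact congrArg (fun L ↦ L (u, 0)) h2
      have hle : finrank ℂ A.range ≤ finrank ℂ R := (hΨN hq).1
      have hge := LinearMap.finrank_le_finrank_of_surjective hsur
      exact (LinearMap.injective_iff_surjective_of_finrank_eq_finrank (le_antisymm hle hge)).2 hsur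
    have h5 : π₀.domRestrict A.range ⟨A (fderiv ℂ Ψ q (0, τ)), _, rfl⟩ = 0 :=
      congrArg (fun L ↦ L (0, τ)) h2
    have h6 := hinj (h5.trans (map_zero _).symm)
    rw [h1]
    exact congrArg Subtype.val h6
  have hconst : ∀ q ∈ Metric.ball q₀ r, f (Ψ q) = f (Ψ (q.1, 0)) := by
    rintro ⟨u, t⟩ hq
    rw [hball] at hq
    have hd : ∀ s ∈ Metric.ball (0 : (fderiv ℂ h x).ker) r,
        HasFDerivAt (fun s ↦ f (Ψ (u, s))) (0 : (fderiv ℂ h x).ker →L[ℂ] F) s := by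
      intro s hs
      have hus : (u, s) ∈ Metric.ball q₀ r := by rw [hball]; exact ⟨hq.1, hs⟩
      have h1 := (hfΨ _ hus).differentiableAt.hasFDerivAt.comp s
        ((hasFDerivAt_const u s).prodMk (hasFDerivAt_id s))
      refine h1.congr_fderiv ?_
      ext τ
      exact hvert _ hus τ
    have hint := (convex_ball (0 : (fderiv ℂ h x).ker) r).is_const_of_fderivWithin_eq_zero
      (𝕜 := ℂ) (f := fun s ↦ f (Ψ (u, s)))
      (fun s hs ↦ (hd s hs).differentiableAt.differentiableWithinAt)
      (fun s hs ↦ by rw [fderivWithin_of_isOpen Metric.isOpen_ball hs, (hd s hs).fderiv])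
      hq.2 (Metric.mem_ball_self hr)
    exact hint
  have himg : f '' (Ψ '' Metric.ball q₀ r) ⊆ (fun u ↦ f (Ψ (u, 0))) '' Metric.ball (h x) r := by
    rintro _ ⟨_, ⟨q, hq, rfl⟩, rfl⟩
    refine ⟨q.1, ?_, (hconst q hq).symm⟩
    rw [hball] at hq
    exact hq.1
  have hsm : ContDiffOn ℝ 1 (fun u ↦ f (Ψ (u, 0))) (Metric.ball (h x) r) := by
    intro u hu
    have huq : (u, 0) ∈ Metric.ball q₀ r := by
      rw [hball]; exact ⟨hu, Metric.mem_ball_self hr⟩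
    have : AnalyticAt ℂ (fun u ↦ f (Ψ (u, 0))) u :=
      (hfΨ _ huq).comp_of_eq (f := fun u : R ↦ (u, (0 : (fderiv ℂ h x).ker)))
        (analyticAt_id.prod analyticAt_const) rfl
    have h2 : ContDiffAt ℂ 1 (fun u ↦ f (Ψ (u, 0))) u := this.contDiffAt
    exact (h2.restrict_scalars ℝ).contDiffWithinAt
  have hfr : finrank ℝ R = 2 * finrank ℂ R := by
    rw [← Module.finrank_mul_finrank ℝ ℂ R, Complex.finrank_real_complex]
  calc dimH (f '' (Ψ '' Metric.ball q₀ r))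
      ≤ dimH ((fun u ↦ f (Ψ (u, 0))) '' Metric.ball (h x) r) := dimH_mono himg
    _ ≤ dimH (Metric.ball (h x) r) := hsm.dimH_image_le (convex_ball _ _) Subset.rfl
    _ ≤ dimH (univ : Set R) := dimH_mono (subset_univ _)
    _ = (2 * finrank ℂ R : ℕ) := by rw [Real.dimH_univ_eq_finrank, hfr]

end Sard

section SardThm

open Module

universe u v

variable {F : Type v} [NormedAddCommGroup F] [NormedSpace ℂ F] [FiniteDimensional ℂ F]

/-- The Morse–Sard theorem for holomorphic maps: the image of a set on which the rank is at most `k`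
has (real) Hausdorff dimension at most `2 * k`. -/
theorem dimH_image_le_of_finrank_range_le (k n : ℕ) :
    ∀ (E : Type u) [NormedAddCommGroup E] [NormedSpace ℂ E] [FiniteDimensional ℂ E],
    finrank ℂ E = n → ∀ (U S : Set E) (f : E → F), IsOpen U → AnalyticOnNhd ℂ f U → S ⊆ U →
    (∀ z ∈ S, finrank ℂ (fderiv ℂ f z).range ≤ k) → dimH (f '' S) ≤ (2 * k : ℕ) := by
  induction n using Nat.strong_induction_on with
  | _ n ih =>
  intro E _ _ _ hn U S f hU hf hSU hrank
  have := FiniteDimensional.proper ℂ E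
  set good : E → Prop := fun z ↦ ∃ N ∈ 𝓝 z, dimH (f '' (S ∩ N)) ≤ (2 * k : ℕ) with hgood
  have hcover : ∀ T ⊆ S, (∀ z ∈ T, good z) → dimH (f '' T) ≤ (2 * k : ℕ) := by
    intro T hTS hT
    choose! N hN hNd using hT
    obtain ⟨t, htT, htc, hcov⟩ := TopologicalSpace.countable_cover_nhdsWithin
      (f := N) (s := T) fun x hx ↦ mem_nhdsWithin_of_mem_nhds (hN x hx)
    have h1 : f '' T ⊆ ⋃ x ∈ t, f '' (S ∩ N x) := by
      rintro _ ⟨y, hy, rfl⟩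
      obtain ⟨x, hx, hxy⟩ := mem_iUnion₂.1 (hcov hy)
      exact mem_iUnion₂.2 ⟨x, hx, y, ⟨hTS hy, hxy⟩, rfl⟩
    refine (dimH_mono h1).trans ?_
    rw [dimH_bUnion htc]
    exact iSup₂_le fun x hx ↦ hNd x (htT hx)
  by_contra hbad
  obtain ⟨z₁, hz₁S, hz₁⟩ : ∃ z ∈ S, ¬ good z := by
    by_contra! h
    exact hbad (hcover S Subset.rfl h)
  set Sb : Set E := {z ∈ S | ¬ good z} with hSb
  -- The good part of `S` is covered by countably many good neighbourhoods, so its image is harmless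
  -- and a bad point stays bad when `S` is replaced by `Sb`.
  have hSbad : ∀ z ∈ Sb, ∀ N ∈ 𝓝 z, ¬ dimH (f '' (Sb ∩ N)) ≤ (2 * k : ℕ) := by
    intro z hz N hN hle
    refine hz.2 ⟨N, hN, ?_⟩
    have h1 : f '' (S ∩ N) ⊆ f '' (Sb ∩ N) ∪ f '' {z ∈ S | good z} := by
      rintro _ ⟨y, hy, rfl⟩
      by_cases hg : good y
      · exact Or.inr ⟨y, ⟨hy.1, hg⟩, rfl⟩
      · exact Or.inl ⟨y, ⟨⟨hy.1, hg⟩, hy.2⟩, rfl⟩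
    refine (dimH_mono h1).trans ?_
    rw [dimH_union]
    exact max_le hle (hcover _ (fun z hz ↦ hz.1) fun z hz ↦ hz.2)
  obtain ⟨ρ, hρ, hρU⟩ := Metric.isOpen_iff.1 hU z₁ (hSU hz₁S)
  set B := Metric.ball z₁ ρ with hB
  -- Either `Sb` lies in a smooth hypersurface near one of its points, and the induction on
  -- dimension applies. Or no nonzero analytic function vanishes on `Sb ∩ B`; then a minor detecting
  -- the maximal rank on `B` is nonzero at some bad point, where the constant rank estimate applies.
  by_cases hcase : ∃ g : E → ℂ, AnalyticOnNhd ℂ g B ∧ (∀ z ∈ Sb ∩ B, g z = 0) ∧ ∃ z ∈ B, g z ≠ 0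
  · obtain ⟨g, hg, hgS, hgne⟩ := hcase
    obtain ⟨h, hh, hhS, z₀, hz₀, hdh⟩ := exists_analytic_fderiv_ne_zero
      (S := Sb ∩ B) Metric.isOpen_ball (convex_ball z₁ ρ).isPreconnected inter_subset_right
      ⟨z₁, ⟨hz₁S, hz₁⟩, Metric.mem_ball_self hρ⟩ hg hgS hgne
    have hsurj : (fderiv ℂ h z₀).range = ⊤ :=
      LinearMap.range_eq_top.2
        (LinearMap.surjective fun h0 ↦ hdh (by ext v; exact congrArg (· v) h0))
    obtain ⟨r, hr, Ψ, hΨ, hΨ0, hΨB, hhΨ, hΨo⟩ := exists_analytic_straightening (hh z₀ hz₀.2) hsurj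
      (Metric.isOpen_ball.mem_nhds hz₀.2)
    rw [hhS z₀ hz₀] at hΨ hΨ0 hΨB hhΨ hΨo
    have hin : ∀ w ∈ Metric.ball (0 : (fderiv ℂ h z₀).ker) r,
        ((0 : ℂ), w) ∈ Metric.ball ((0, 0) : ℂ × (fderiv ℂ h z₀).ker) r := by
      intro w hw
      rw [← ball_prod_same]
      exact ⟨Metric.mem_ball_self hr, hw⟩
    have hlt : finrank ℂ (fderiv ℂ h z₀).ker < n := by
      rw [← hn]
      refine Submodule.finrank_lt fun htop ↦ hdh ?_
      ext v
      exact LinearMap.mem_ker.1 (htop ▸ Submodule.mem_top : v ∈ (fderiv ℂ h z₀).ker)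
    have hline : ∀ w ∈ Metric.ball (0 : (fderiv ℂ h z₀).ker) r,
        AnalyticAt ℂ (fun w ↦ Ψ (0, w)) w := fun w hw ↦
      (hΨ _ (hin w hw)).comp_of_eq (f := fun w : (fderiv ℂ h z₀).ker ↦ ((0 : ℂ), w))
        (analyticAt_const.prod analyticAt_id) rfl
    have hsub := ih _ hlt (fderiv ℂ h z₀).ker rfl (Metric.ball 0 r)
      {w ∈ Metric.ball 0 r | Ψ (0, w) ∈ Sb} (fun w ↦ f (Ψ (0, w))) Metric.isOpen_ball
      (fun w hw ↦ (hf _ (hρU (hΨB (hin w hw)))).comp (f := fun w ↦ Ψ (0, w))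
        (hline w hw)) (fun w hw ↦ hw.1) ?_
    · refine hSbad z₀ hz₀.1 (Ψ '' Metric.ball (0, 0) r)
        ((hΨo _ Subset.rfl Metric.isOpen_ball).mem_nhds ⟨_, Metric.mem_ball_self hr, hΨ0⟩)
        (le_trans (dimH_mono ?_) hsub)
      rintro _ ⟨_, ⟨hyS, ⟨⟨ζ, w⟩, hq, rfl⟩⟩, rfl⟩
      have hζ : ζ = 0 := (hhΨ _ hq).symm.trans (hhS _ ⟨hyS, hΨB hq⟩)
      subst hζ
      refine ⟨w, ⟨?_, hyS⟩, rfl⟩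
      rw [← ball_prod_same] at hq
      exact hq.2
    · intro w hw
      have h1 : fderiv ℂ (fun w ↦ f (Ψ (0, w))) w =
          (fderiv ℂ f (Ψ (0, w))).comp (fderiv ℂ (fun w ↦ Ψ (0, w)) w) :=
        ((hf _ (hρU (hΨB (hin w hw.1)))).differentiableAt.hasFDerivAt.comp w
          (hline w hw.1).differentiableAt.hasFDerivAt).fderiv
      rw [h1]
      refine le_trans (Submodule.finrank_mono ?_) (hrank _ hw.2.1)
      exact LinearMap.range_comp_le_range _ _
  · push Not at hcase
    obtain ⟨x₀, hx₀B, hx₀max⟩ : ∃ x ∈ B, ∀ y ∈ B, finrank ℂ (fderiv ℂ f y).range ≤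
        finrank ℂ (fderiv ℂ f x).range := by
      set A : Set ℕ := (fun y ↦ finrank ℂ (fderiv ℂ f y).range) '' B
      have hne : A.Nonempty := ⟨_, z₁, Metric.mem_ball_self hρ, rfl⟩
      have hbd : BddAbove A := ⟨finrank ℂ F, by
        rintro _ ⟨y, _, rfl⟩; exact Submodule.finrank_le _⟩
      obtain ⟨x, hx, hxe⟩ := Nat.sSup_mem hne hbd
      exact ⟨x, hx, fun y hy ↦ (le_csSup hbd ⟨y, hy, rfl⟩).trans_eq hxe.symm⟩
    obtain ⟨δ, hδ, hδ0, hδr⟩ := exists_analytic_minor hU hf (z := x₀)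
    obtain ⟨x₁, hx₁, hδx₁⟩ : ∃ x ∈ Sb ∩ B, δ x ≠ 0 := by
      by_contra! h
      exact hδ0 (hcase δ (hδ.mono hρU) h x₀ hx₀B)
    obtain ⟨N, hN, hNd⟩ := exists_dimH_image_le_of_rank_max (hf x₁ (hρU hx₁.2)) (by
      filter_upwards [Metric.isOpen_ball.mem_nhds hx₁.2] with y hy
      exact (hx₀max y hy).trans (hδr x₁ hδx₁))
    refine hSbad x₁ hx₁.1 N hN ((dimH_mono (image_mono inter_subset_right)).trans (hNd.trans ?_))
    exact_mod_cast Nat.mul_le_mul_left 2 (hrank x₁ hx₁.1.1)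

end SardThm

/-! ### Second order jets in one complex variable -/

section Taylor

open Asymptotics

lemma isLittleO_taylor_two {E F : Type*} [NormedAddCommGroup E] [NormedSpace ℝ E]
    [NormedAddCommGroup F] [NormedSpace ℝ F] {f : E → F} {z : E} (hf : ContDiffAt ℝ 2 f z) :
    (fun w ↦ f (z + w) - f z - fderiv ℝ f z w - (1 / 2 : ℝ) • fderiv ℝ (fderiv ℝ f) z w w)
      =o[𝓝 0] fun w ↦ ‖w‖ ^ 2 := by
  have hsymm : ∀ v w, fderiv ℝ (fderiv ℝ f) z v w = fderiv ℝ (fderiv ℝ f) z w v := fun v w ↦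
    (hf.isSymmSndFDerivAt (by simp)).eq v w
  set B := fderiv ℝ (fderiv ℝ f) z with hB
  have hdf : DifferentiableAt ℝ (fderiv ℝ f) z :=
    (hf.fderiv_right (m := 1) (by norm_num)).differentiableAt one_ne_zero
  have hev : ∀ᶠ y in 𝓝 z, DifferentiableAt ℝ f y :=
    (hf.eventually (by simp)).mono fun y hy ↦ hy.differentiableAt (by simp)
  have h1 := hasFDerivAt_iff_isLittleO_nhds_zero.1 hdf.hasFDerivAt
  have hevw : ∀ᶠ w in 𝓝 (0 : E), DifferentiableAt ℝ f (z + w) := by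
    have : ContinuousAt (fun w : E ↦ z + w) 0 := by fun_prop
    exact this.eventually (by simpa using hev)
  rw [isLittleO_iff]
  intro ε hε
  obtain ⟨ρ, hρ, hρb⟩ := Metric.eventually_nhds_iff_ball.1 (hevw.and (h1.bound hε))
  filter_upwards [Metric.ball_mem_nhds (0 : E) hρ] with w hw
  -- The derivative of `r` at `y` is `o(‖y‖)` by differentiability of `fderiv ℝ f`, and the mean
  -- value inequality integrates this bound.
  set r : E → F := fun w ↦ f (z + w) - f z - fderiv ℝ f z w - (1 / 2 : ℝ) • B w w with hr
  have hder : ∀ y ∈ Metric.closedBall (0 : E) ‖w‖,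
      HasFDerivAt r (fderiv ℝ f (z + y) - fderiv ℝ f z - B y) y := by
    intro y hy
    have hyb : y ∈ Metric.ball (0 : E) ρ := by
      rw [mem_ball_zero_iff] at hw ⊢
      exact (mem_closedBall_zero_iff.1 hy).trans_lt hw
    have h2 : HasFDerivAt (fun w ↦ f (z + w)) (fderiv ℝ f (z + y)) y :=
      (hρb y hyb).1.hasFDerivAt.comp (f := fun w ↦ z + w) y
        ((hasFDerivAt_id y).const_add z)
    have h3 := (B.hasFDerivAt (x := y)).clm_apply (hasFDerivAt_id y)
    refine (((h2.sub_const (f z)).sub (fderiv ℝ f z).hasFDerivAt).sub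
      (h3.const_smul (1 / 2 : ℝ))).congr_fderiv ?_
    ext v
    simp only [sub_apply, smul_apply,
      add_apply, ContinuousLinearMap.comp_apply, ContinuousLinearMap.flip_apply,
      ContinuousLinearMap.id_apply, id]
    rw [hsymm v y, ← two_smul ℝ (B y v), smul_smul]
    norm_num
  have h4 := (convex_closedBall (0 : E) ‖w‖).norm_image_sub_le_of_norm_hasFDerivWithin_le
    (f := r) (C := ε * ‖w‖) (fun y hy ↦ (hder y hy).hasFDerivWithinAt) (fun y hy ↦ by
      have hyn := mem_closedBall_zero_iff.1 hy
      have hyb : y ∈ Metric.ball (0 : E) ρ := by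
        rw [mem_ball_zero_iff] at hw ⊢
        exact hyn.trans_lt hw
      exact ((hρb y hyb).2).trans (mul_le_mul_of_nonneg_left hyn hε.le))
    (Metric.mem_closedBall_self (norm_nonneg w)) (show w ∈ _ by simp)
  have h5 : r 0 = 0 := by simp [hr]
  rw [h5, sub_zero, sub_zero] at h4
  rw [norm_pow, norm_norm, pow_two, ← mul_assoc]
  exact h4

/-- The function `u` of one complex variable has the second order expansion
`u₀ + a ζ + b ζ̄ + c ζ² + d ζ̄² + D ζ ζ̄ + o(|ζ|²)`, for some `c` and `d`. -/
def HasJet (u : ℂ → ℂ) (u₀ a b D : ℂ) : Prop :=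
  ∃ c d : ℂ, (fun ζ ↦ u ζ - (u₀ + (a * ζ + b * conj ζ)
    + (c * ζ ^ 2 + d * conj ζ ^ 2 + D * (ζ * conj ζ)))) =o[𝓝 0] fun ζ ↦ ‖ζ‖ ^ 2

lemma HasJet.add {u v : ℂ → ℂ} {u₀ a b D v₀ a' b' D' : ℂ} (hu : HasJet u u₀ a b D)
    (hv : HasJet v v₀ a' b' D') :
    HasJet (fun ζ ↦ u ζ + v ζ) (u₀ + v₀) (a + a') (b + b') (D + D') := by
  obtain ⟨c, d, h⟩ := hu
  obtain ⟨c', d', h'⟩ := hv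
  refine ⟨c + c', d + d', (h.add h').congr_left fun ζ ↦ ?_⟩
  ring

lemma HasJet.sum {ι : Type*} (s : Finset ι) {u : ι → ℂ → ℂ} {u₀ a b D : ι → ℂ}
    (h : ∀ i ∈ s, HasJet (u i) (u₀ i) (a i) (b i) (D i)) :
    HasJet (fun ζ ↦ ∑ i ∈ s, u i ζ) (∑ i ∈ s, u₀ i) (∑ i ∈ s, a i) (∑ i ∈ s, b i)
      (∑ i ∈ s, D i) := by
  classical
  induction s using Finset.induction_on with
  | empty => exact ⟨0, 0, by simp⟩
  | insert i s hi ih =>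
    simp only [Finset.sum_insert hi]
    exact (h i (Finset.mem_insert_self _ _)).add
      (ih fun j hj ↦ h j (Finset.mem_insert_of_mem hj))

lemma isBigO_linear_part (a b : ℂ) :
    (fun ζ : ℂ ↦ a * ζ + b * conj ζ) =O[𝓝 0] fun ζ ↦ ‖ζ‖ := by
  refine IsBigO.of_bound (‖a‖ + ‖b‖) (Eventually.of_forall fun ζ ↦ ?_)
  refine (norm_add_le _ _).trans_eq ?_
  simp; ring

lemma isBigO_quadratic_part (c d D : ℂ) :
    (fun ζ : ℂ ↦ c * ζ ^ 2 + d * conj ζ ^ 2 + D * (ζ * conj ζ)) =O[𝓝 0] fun ζ ↦ ‖ζ‖ ^ 2 := by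
  refine IsBigO.of_bound (‖c‖ + ‖d‖ + ‖D‖) (Eventually.of_forall fun ζ ↦ ?_)
  refine (norm_add₃_le).trans_eq ?_
  simp; ring

lemma HasJet.mul {u v : ℂ → ℂ} {u₀ a b D v₀ a' b' D' : ℂ} (hu : HasJet u u₀ a b D)
    (hv : HasJet v v₀ a' b' D') :
    HasJet (fun ζ ↦ u ζ * v ζ) (u₀ * v₀) (u₀ * a' + a * v₀) (u₀ * b' + b * v₀)
      (u₀ * D' + D * v₀ + a * b' + b * a') := by
  obtain ⟨c, d, h⟩ := hu
  obtain ⟨c', d', h'⟩ := hv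
  refine ⟨u₀ * c' + c * v₀ + a * a', u₀ * d' + d * v₀ + b * b', ?_⟩
  set L : ℂ → ℂ := fun ζ ↦ a * ζ + b * conj ζ with hL
  set L' : ℂ → ℂ := fun ζ ↦ a' * ζ + b' * conj ζ with hL'
  set q : ℂ → ℂ := fun ζ ↦ c * ζ ^ 2 + d * conj ζ ^ 2 + D * (ζ * conj ζ) with hq
  set q' : ℂ → ℂ := fun ζ ↦ c' * ζ ^ 2 + d' * conj ζ ^ 2 + D' * (ζ * conj ζ) with hq'
  have hn : (fun ζ : ℂ ↦ ‖ζ‖) =o[𝓝 0] fun _ ↦ (1 : ℝ) := by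
    rw [isLittleO_one_iff]
    simpa using continuous_norm.tendsto (0 : ℂ)
  have hone : ∀ (t : ℂ → ℂ), ContinuousAt t 0 → t =O[𝓝 0] fun _ ↦ (1 : ℝ) := fun t ht ↦
    ht.isBigO_one ℝ
  have hL1 : L =o[𝓝 0] fun _ ↦ (1 : ℝ) := (isBigO_linear_part a b).trans_isLittleO hn
  have hL1' : L' =o[𝓝 0] fun _ ↦ (1 : ℝ) := (isBigO_linear_part a' b').trans_isLittleO hn
  have hq2 : q =O[𝓝 0] fun ζ ↦ ‖ζ‖ ^ 2 := isBigO_quadratic_part c d D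
  have hq2' : q' =O[𝓝 0] fun ζ ↦ ‖ζ‖ ^ 2 := isBigO_quadratic_part c' d' D'
  have hcu : (fun ζ ↦ u₀ + L ζ + q ζ) =O[𝓝 0] fun _ ↦ (1 : ℝ) := by
    apply hone
    have : Continuous (fun ζ ↦ u₀ + L ζ + q ζ) := by
      have := Complex.continuous_conj
      simp only [hL, hq]; fun_prop
    exact this.continuousAt
  have hcv : (fun ζ ↦ v₀ + L' ζ + q' ζ) =O[𝓝 0] fun _ ↦ (1 : ℝ) := by
    apply hone
    have : Continuous (fun ζ ↦ v₀ + L' ζ + q' ζ) := by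
      have := Complex.continuous_conj
      simp only [hL', hq']; fun_prop
    exact this.continuousAt
  have hsq : (fun ζ : ℂ ↦ ‖ζ‖ ^ 2) =O[𝓝 0] fun _ ↦ (1 : ℝ) := by
    have : ContinuousAt (fun ζ : ℂ ↦ ‖ζ‖ ^ 2) 0 := by fun_prop
    exact this.isBigO_one ℝ
  -- The errors are the products involving a remainder (`t1`, `t2`, `t3`) and the products of jet
  -- parts of total degree at least three (`t4`, `t5`, `t6`).
  have t1 := h.mul_isBigO hcv
  have t2 := hcu.mul_isLittleO h'
  have t3 := h.mul_isBigO (h'.isBigO.trans hsq)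
  have t4 := hL1.mul_isBigO hq2'
  have t5 := hq2.mul_isLittleO hL1'
  have hn2 : (fun ζ : ℂ ↦ ‖ζ‖ ^ 2) =o[𝓝 0] fun _ ↦ (1 : ℝ) := by
    rw [isLittleO_one_iff]
    have : ContinuousAt (fun ζ : ℂ ↦ ‖ζ‖ ^ 2) 0 := by fun_prop
    simpa [ContinuousAt] using this
  have t6 := hq2.mul_isLittleO (hq2'.trans_isLittleO hn2)
  simp only [mul_one, one_mul] at t1 t2 t3 t4 t5 t6
  refine (((((t1.add t2).add t3).add t4).add t5).add t6).congr_left fun ζ ↦ ?_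
  simp only [hL, hL', hq, hq']
  ring

lemma hasJet_affine (p q : ℂ) : HasJet (fun ζ ↦ p + ζ * q) p q 0 0 :=
  ⟨0, 0, by
    refine (isLittleO_zero _ _).congr_left fun ζ ↦ ?_
    ring⟩

lemma hasJet_conj_affine (p q : ℂ) :
    HasJet (fun ζ ↦ conj (p + ζ * q)) (conj p) 0 (conj q) 0 :=
  ⟨0, 0, by
    refine (isLittleO_zero _ _).congr_left fun ζ ↦ ?_
    simp only [map_add, map_mul]
    ring⟩

variable {n : ℕ}

/-- A real linear map on `ℂⁿ` in terms of its Wirtinger coefficients. -/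
lemma realLinear_apply_eq_sum (L : Cn n →L[ℝ] ℂ) (w : Cn n) :
    L w = ∑ i, (w i * ((1 / 2) * (L (EuclideanSpace.single i 1)
        - Complex.I * L (EuclideanSpace.single i Complex.I)))
      + conj (w i) * ((1 / 2) * (L (EuclideanSpace.single i 1)
        + Complex.I * L (EuclideanSpace.single i Complex.I)))) := by
  have h1 : w = ∑ i, ((w i).re • EuclideanSpace.single i (1 : ℂ) +
      (w i).im • EuclideanSpace.single i Complex.I) := by
    ext j
    simp only [WithLp.ofLp_sum, Finset.sum_apply, PiLp.add_apply, PiLp.smul_apply,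
      PiLp.single_apply, Complex.real_smul, mul_ite, mul_one, mul_zero]
    simp [Finset.sum_add_distrib, Complex.re_add_im]
  conv_lhs => rw [h1]
  rw [map_sum]
  refine Finset.sum_congr rfl fun i _ ↦ ?_
  rw [map_add, map_smul, map_smul, Complex.real_smul, Complex.real_smul]
  have h2 : conj (w i) = (w i).re - (w i).im * Complex.I := by
    apply Complex.ext <;> simp
  rw [h2]
  conv_rhs => rw [← Complex.re_add_im (w i)]
  simp only [Complex.add_re, Complex.ofReal_re, Complex.mul_re, Complex.I_re, mul_zero,
    Complex.ofReal_im, Complex.I_im, mul_one, sub_self, add_zero, Complex.add_im, Complex.mul_im,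
    zero_add]
  linear_combination (((w i).im : ℂ) * L (EuclideanSpace.single i Complex.I)) * Complex.I_mul_I

lemma hasJet_of_contDiffAt {u : Cn n → ℂ} {z : Cn n} (hu : ContDiffAt ℝ 2 u z) (V : Cn n) :
    HasJet (fun ζ ↦ u (z + ζ • V)) (u z) (∑ i, V i * dz i u z) (∑ j, conj (V j) * dzbar j u z)
      (∑ i, ∑ j, V i * conj (V j) * dz i (dzbar j u) z) := by
  set B := fderiv ℝ (fderiv ℝ u) z with hB
  have hsymm : ∀ v w, B v w = B w v := fun v w ↦ (hu.isSymmSndFDerivAt (by simp)).eq v w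
  have hdu : HasFDerivAt (fderiv ℝ u) B z :=
    ((hu.fderiv_right (m := 1) (by norm_num)).differentiableAt one_ne_zero).hasFDerivAt
  have happ : ∀ v : Cn n, HasFDerivAt (fun y ↦ fderiv ℝ u y v) (B.flip v) z := fun v ↦ by
    have := hdu.clm_apply (hasFDerivAt_const v z)
    refine this.congr_fderiv ?_
    ext w; simp
  have hN : ∀ j, fderiv ℝ (dzbar j u) z = (1 / 2 : ℂ) • (B.flip (EuclideanSpace.single j 1)
      + Complex.I • B.flip (EuclideanSpace.single j Complex.I)) := fun j ↦
    (((happ _).add ((happ _).const_mul Complex.I)).const_mul (1 / 2 : ℂ)).fderiv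
  have hM : ∀ j, fderiv ℝ (dz j u) z = (1 / 2 : ℂ) • (B.flip (EuclideanSpace.single j 1)
      - Complex.I • B.flip (EuclideanSpace.single j Complex.I)) := fun j ↦
    (((happ _).sub ((happ _).const_mul Complex.I)).const_mul (1 / 2 : ℂ)).fderiv
  -- Each mixed term appears in `B w w` in both orders of differentiation. Since the orders agree,
  -- the factor `1 / 2` of Taylor's formula cancels.
  have hmix : ∀ i j, dzbar i (dz j u) z = dz j (dzbar i u) z := by
    intro i j
    rw [dzbar, dz, hN, hM]
    simp only [smul_apply, sub_apply,
      add_apply, ContinuousLinearMap.flip_apply, smul_eq_mul]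
    rw [hsymm (EuclideanSpace.single i 1) (EuclideanSpace.single j 1),
      hsymm (EuclideanSpace.single i 1) (EuclideanSpace.single j Complex.I),
      hsymm (EuclideanSpace.single i Complex.I) (EuclideanSpace.single j 1),
      hsymm (EuclideanSpace.single i Complex.I) (EuclideanSpace.single j Complex.I)]
    ring
  have hBw : ∀ w : Cn n, B w w = ∑ j, ∑ i, (w j * w i * dz i (dz j u) z
      + w j * conj (w i) * dz j (dzbar i u) z + conj (w j) * w i * dz i (dzbar j u) z
      + conj (w j) * conj (w i) * dzbar i (dzbar j u) z) := by
    intro w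
    rw [realLinear_apply_eq_sum (B w) w]
    refine Finset.sum_congr rfl fun j _ ↦ ?_
    have h1 : (1 / 2 : ℂ) * (B w (EuclideanSpace.single j 1)
        - Complex.I * B w (EuclideanSpace.single j Complex.I)) = fderiv ℝ (dz j u) z w := by
      rw [hM]; simp
    have h2 : (1 / 2 : ℂ) * (B w (EuclideanSpace.single j 1)
        + Complex.I * B w (EuclideanSpace.single j Complex.I)) = fderiv ℝ (dzbar j u) z w := by
      rw [hN]; simp; ring
    rw [h1, h2, realLinear_apply_eq_sum (fderiv ℝ (dz j u) z) w,
      realLinear_apply_eq_sum (fderiv ℝ (dzbar j u) z) w, Finset.mul_sum, Finset.mul_sum,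
      ← Finset.sum_add_distrib]
    refine Finset.sum_congr rfl fun i _ ↦ ?_
    have h3 : (1 / 2 : ℂ) * (fderiv ℝ (dz j u) z (EuclideanSpace.single i 1)
      - Complex.I * fderiv ℝ (dz j u) z (EuclideanSpace.single i Complex.I)) =
        dz i (dz j u) z := rfl
    have h4 : (1 / 2 : ℂ) * (fderiv ℝ (dz j u) z (EuclideanSpace.single i 1)
      + Complex.I * fderiv ℝ (dz j u) z (EuclideanSpace.single i Complex.I)) =
        dzbar i (dz j u) z := rfl
    have h5 : (1 / 2 : ℂ) * (fderiv ℝ (dzbar j u) z (EuclideanSpace.single i 1)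
      - Complex.I * fderiv ℝ (dzbar j u) z (EuclideanSpace.single i Complex.I)) =
        dz i (dzbar j u) z := rfl
    have h6 : (1 / 2 : ℂ) * (fderiv ℝ (dzbar j u) z (EuclideanSpace.single i 1)
      + Complex.I * fderiv ℝ (dzbar j u) z (EuclideanSpace.single i Complex.I)) =
        dzbar i (dzbar j u) z := rfl
    rw [h3, h4, h5, h6, hmix]
    ring
  have hlin : ∀ w : Cn n, fderiv ℝ u z w = ∑ i, (w i * dz i u z + conj (w i) * dzbar i u z) :=
    fun w ↦ realLinear_apply_eq_sum _ w
  refine ⟨(1 / 2) * ∑ j, ∑ i, V j * V i * dz i (dz j u) z,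
    (1 / 2) * ∑ j, ∑ i, conj (V j) * conj (V i) * dzbar i (dzbar j u) z, ?_⟩
  have hT := isLittleO_taylor_two hu
  rw [← hB] at hT
  have hlim : Tendsto (fun ζ : ℂ ↦ ζ • V) (𝓝 0) (𝓝 0) := by
    have : ContinuousAt (fun ζ : ℂ ↦ ζ • V) 0 := by fun_prop
    simpa [ContinuousAt] using this
  have hT2 := hT.comp_tendsto hlim
  have hbig : ((fun w : Cn n ↦ ‖w‖ ^ 2) ∘ fun ζ : ℂ ↦ ζ • V) =O[𝓝 0] fun ζ : ℂ ↦ ‖ζ‖ ^ 2 := by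
    refine IsBigO.of_bound (‖V‖ ^ 2) (Eventually.of_forall fun ζ ↦ ?_)
    simp only [Function.comp, norm_smul, mul_pow, norm_mul, norm_pow, norm_norm]
    rw [mul_comm]
  refine (hT2.trans_isBigO hbig).congr_left fun ζ ↦ ?_
  simp only [Function.comp, hlin, hBw, PiLp.smul_apply, smul_eq_mul, map_mul, Complex.real_smul]
  have e1 : ∑ i, (ζ * V i * dz i u z + conj ζ * conj (V i) * dzbar i u z) =
      (∑ i, V i * dz i u z) * ζ + (∑ j, conj (V j) * dzbar j u z) * conj ζ := by
    rw [Finset.sum_mul, Finset.sum_mul, ← Finset.sum_add_distrib]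
    exact Finset.sum_congr rfl fun i _ ↦ by ring
  have e2 : ∑ j, ∑ i, (ζ * V j * (ζ * V i) * dz i (dz j u) z
      + ζ * V j * (conj ζ * conj (V i)) * dz j (dzbar i u) z
      + conj ζ * conj (V j) * (ζ * V i) * dz i (dzbar j u) z
      + conj ζ * conj (V j) * (conj ζ * conj (V i)) * dzbar i (dzbar j u) z) =
      (∑ j, ∑ i, V j * V i * dz i (dz j u) z) * ζ ^ 2
      + (∑ j, ∑ i, V j * conj (V i) * dz j (dzbar i u) z) * (ζ * conj ζ)
      + (∑ j, ∑ i, V i * conj (V j) * dz i (dzbar j u) z) * (ζ * conj ζ)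
      + (∑ j, ∑ i, conj (V j) * conj (V i) * dzbar i (dzbar j u) z) * conj ζ ^ 2 := by
    simp only [Finset.sum_mul, ← Finset.sum_add_distrib]
    exact Finset.sum_congr rfl fun i _ ↦ Finset.sum_congr rfl fun j _ ↦ by ring
  have e3 : ∑ j, ∑ i, V i * conj (V j) * dz i (dzbar j u) z =
      ∑ i, ∑ j, V i * conj (V j) * dz i (dzbar j u) z := Finset.sum_comm
  rw [e1, e2, e3]
  push_cast
  ring

end Taylor

/-! ### Chern curvature as a mixed second derivative -/

section Curvature

variable {n : ℕ}

lemma HasJet.congr_mixed {u : ℂ → ℂ} {u₀ a b D D' : ℂ} (h : HasJet u u₀ a b D) (hD : D = D') :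
    HasJet u u₀ a b D' := hD ▸ h

lemma sum_comm_four {ι : Type*} [Fintype ι] (f : ι → ι → ι → ι → ℂ) :
    ∑ i, ∑ j, ∑ k, ∑ l, f i j k l = ∑ k, ∑ l, ∑ i, ∑ j, f i j k l :=
  calc _ = ∑ i, ∑ k, ∑ j, ∑ l, f i j k l := Finset.sum_congr rfl fun _ _ ↦ Finset.sum_comm
    _ = ∑ k, ∑ i, ∑ j, ∑ l, f i j k l := Finset.sum_comm
    _ = ∑ k, ∑ i, ∑ l, ∑ j, f i j k l :=
        Finset.sum_congr rfl fun _ _ ↦ Finset.sum_congr rfl fun _ _ ↦ Finset.sum_comm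
    _ = _ := Finset.sum_congr rfl fun _ _ ↦ Finset.sum_comm

lemma sum_swap_one_three {ι : Type*} [Fintype ι] (f : ι → ι → ι → ι → ℂ) :
    ∑ i, ∑ j, ∑ k, ∑ l, f i j k l = ∑ k, ∑ j, ∑ i, ∑ l, f i j k l :=
  calc _ = ∑ j, ∑ i, ∑ k, ∑ l, f i j k l := Finset.sum_comm
    _ = ∑ j, ∑ k, ∑ i, ∑ l, f i j k l := Finset.sum_congr rfl fun _ _ ↦ Finset.sum_comm
    _ = _ := Finset.sum_comm

/-- With `b` the derivative of a field parallel to first order, the cross term of the jet becomes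
the part of the curvature that is quadratic in first derivatives of the metric. -/
lemma sum_contract {ι : Type*} [Fintype ι] (G P Q : ι → ι → ℂ) (ξ b : ι → ℂ)
    (hb : ∀ a, b a = -∑ m, G m a * ∑ k, P k m * ξ k) :
    ∑ k, ∑ l, Q k l * b k * conj (ξ l) =
      -∑ k, ∑ l, (∑ a, ∑ m, G m a * P k m * Q a l) * ξ k * conj (ξ l) := by
  have h1 : ∀ a l, Q a l * b a * conj (ξ l) =
      -∑ k, ∑ m, G m a * P k m * Q a l * ξ k * conj (ξ l) := by
    intro a l
    rw [hb, Finset.sum_comm]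
    simp only [Finset.mul_sum, mul_neg, neg_mul, Finset.sum_mul]
    exact congrArg Neg.neg
      (Finset.sum_congr rfl fun m _ ↦ Finset.sum_congr rfl fun k _ ↦ by ring)
  simp only [h1, Finset.sum_neg_distrib, Finset.sum_mul]
  exact congrArg Neg.neg
    (sum_swap_one_three fun a l k m ↦ G m a * P k m * Q a l * ξ k * conj (ξ l))

/-- Along a complex line, extend a tangent vector `ξ` to the holomorphic (affine) vector field which
is parallel to first order for the Chern connection of the metric `c`. The mixed second
derivative of its squared length is minus the curvature. -/
lemma exists_hasJet_normSq (c : Fin n → Fin n → Cn n → ℂ) {z : Cn n} (V ξ : Cn n)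
    (hc : ∀ k l, ContDiffAt ℝ 2 (c k l) z)
    (hdet : IsUnit (Matrix.of fun k l ↦ c k l z).det) :
    ∃ (b : Cn n) (α β : ℂ), HasJet
      (fun ζ ↦ ∑ k, ∑ l, c k l (z + ζ • V) * (ξ k + ζ * b k) * conj (ξ l + ζ * b l))
      (∑ k, ∑ l, c k l z * ξ k * conj (ξ l)) α β
      (-∑ i, ∑ j, ∑ k, ∑ l, (- dz i (dzbar j (c k l)) z
        + ∑ a, ∑ b, (Matrix.of fun k l ↦ c k l z)⁻¹ b a
          * dz i (c k b) z * dzbar j (c a l) z) * V i * conj (V j) * ξ k * conj (ξ l)) := by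
  set H := Matrix.of fun k l ↦ c k l z with hH
  set P : Fin n → Fin n → ℂ := fun k l ↦ ∑ i, V i * dz i (c k l) z with hP
  set Q : Fin n → Fin n → ℂ := fun k l ↦ ∑ j, conj (V j) * dzbar j (c k l) z with hQ
  set D : Fin n → Fin n → ℂ := fun k l ↦ ∑ i, ∑ j, V i * conj (V j) * dz i (dzbar j (c k l)) z
    with hD
  -- `P` is the derivative of the metric in the direction `V`. `b` is the solution of `∑ k, c k l z
  -- * b k = -∑ k, P k l * ξ k`: the covariant derivative along `V` of the affine field vanishes at
  -- `z`.
  set b : Cn n := WithLp.toLp 2 fun a ↦ -∑ m, H⁻¹ m a * ∑ k, P k m * ξ k with hb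
  have hpar : ∀ l, ∑ k, c k l z * b k = -∑ k, P k l * ξ k := by
    intro l
    have h1 : ∀ m, ∑ k, H⁻¹ m k * H k l = if m = l then 1 else 0 := by
      intro m
      have := congrFun (congrFun (Matrix.nonsing_inv_mul H hdet) m) l
      rwa [Matrix.mul_apply, Matrix.one_apply] at this
    calc ∑ k, c k l z * b k = -∑ k, ∑ m, (H⁻¹ m k * H k l) * ∑ r, P r m * ξ r := by
          rw [← Finset.sum_neg_distrib]
          refine Finset.sum_congr rfl fun k _ ↦ ?_
          simp only [hb, hH, Matrix.of_apply, mul_neg, Finset.mul_sum]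
          congr 1
          exact Finset.sum_congr rfl fun m _ ↦ Finset.sum_congr rfl fun r _ ↦ by ring
      _ = -∑ m, (∑ k, H⁻¹ m k * H k l) * ∑ r, P r m * ξ r := by
          rw [Finset.sum_comm]
          simp only [Finset.sum_mul]
      _ = -∑ k, P k l * ξ k := by simp [h1]
  have hjet : ∀ k l, HasJet (fun ζ ↦ c k l (z + ζ • V) * (ξ k + ζ * b k) * conj (ξ l + ζ * b l))
      (c k l z * ξ k * conj (ξ l)) _ _ _ := fun k l ↦
    ((hasJet_of_contDiffAt (hc k l) V).mul (hasJet_affine (ξ k) (b k))).mul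
      (hasJet_conj_affine (ξ l) (b l))
  have hsum := HasJet.sum Finset.univ fun k _ ↦ HasJet.sum Finset.univ fun l _ ↦ hjet k l
  refine ⟨b, _, _, hsum.congr_mixed ?_⟩
  have e1 : ∑ k, ∑ l, c k l z * b k * conj (b l) = -∑ k, ∑ l, P k l * ξ k * conj (b l) := by
    rw [Finset.sum_comm, Finset.sum_comm (f := fun k l ↦ P k l * ξ k * conj (b l)),
      ← Finset.sum_neg_distrib]
    refine Finset.sum_congr rfl fun l _ ↦ ?_
    rw [← Finset.sum_mul, ← Finset.sum_mul, hpar, neg_mul]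
  have e2 : ∑ i, ∑ j, ∑ k, ∑ l, (- dz i (dzbar j (c k l)) z
        + ∑ a, ∑ b, H⁻¹ b a * dz i (c k b) z * dzbar j (c a l) z)
          * V i * conj (V j) * ξ k * conj (ξ l) =
      ∑ k, ∑ l, (-D k l + ∑ a, ∑ m, H⁻¹ m a * P k m * Q a l) * ξ k * conj (ξ l) := by
    have h1 : ∀ k l, -D k l + ∑ a, ∑ m, H⁻¹ m a * P k m * Q a l =
        ∑ i, ∑ j, (- dz i (dzbar j (c k l)) z
          + ∑ a, ∑ m, H⁻¹ m a * dz i (c k m) z * dzbar j (c a l) z) * V i * conj (V j) := by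
      intro k l
      have h2 : ∑ a, ∑ m, H⁻¹ m a * P k m * Q a l = ∑ i, ∑ j, ∑ a, ∑ m,
          H⁻¹ m a * dz i (c k m) z * dzbar j (c a l) z * V i * conj (V j) := by
        have h3 : ∀ a m, H⁻¹ m a * P k m * Q a l = ∑ i, ∑ j,
            H⁻¹ m a * dz i (c k m) z * dzbar j (c a l) z * V i * conj (V j) := by
          intro a m
          simp only [hP, hQ, Finset.mul_sum, Finset.sum_mul]
          rw [Finset.sum_comm]
          exact Finset.sum_congr rfl fun i _ ↦ Finset.sum_congr rfl fun j _ ↦ by ring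
        simp only [h3]
        exact sum_comm_four fun a m i j ↦
          H⁻¹ m a * dz i (c k m) z * dzbar j (c a l) z * V i * conj (V j)
      rw [h2, hD]
      simp only [← Finset.sum_neg_distrib, ← Finset.sum_add_distrib]
      refine Finset.sum_congr rfl fun i _ ↦ Finset.sum_congr rfl fun j _ ↦ ?_
      simp only [add_mul, Finset.sum_mul]
      ring
    simp only [h1, Finset.sum_mul]
    exact sum_comm_four fun i j k l ↦ (- dz i (dzbar j (c k l)) z
      + ∑ a, ∑ b, H⁻¹ b a * dz i (c k b) z * dzbar j (c a l) z)
        * V i * conj (V j) * ξ k * conj (ξ l)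
  have e3 : ∑ k, ∑ l, Q k l * b k * conj (ξ l) =
      -∑ k, ∑ l, (∑ a, ∑ m, H⁻¹ m a * P k m * Q a l) * ξ k * conj (ξ l) :=
    sum_contract (fun m a ↦ H⁻¹ m a) P Q (fun k ↦ ξ k) b fun a ↦ rfl
  rw [e2]
  have e4 : ∑ k, ∑ l, (-D k l + ∑ a, ∑ m, H⁻¹ m a * P k m * Q a l) * ξ k * conj (ξ l) =
      -∑ k, ∑ l, D k l * ξ k * conj (ξ l) - ∑ k, ∑ l, Q k l * b k * conj (ξ l) := by
    rw [e3, sub_neg_eq_add]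
    simp only [add_mul, neg_mul, Finset.sum_add_distrib, Finset.sum_neg_distrib]
  rw [e4]
  -- The terms containing `conj (b l)` cancel because the field is parallel. What remains, the `D`
  -- term and the `Q` term, is minus the curvature.
  have e5 : ∑ k, ∑ l, (c k l z * ξ k * 0 + (c k l z * 0 + D k l * ξ k + P k l * 0 + Q k l * b k)
      * conj (ξ l) + (c k l z * b k + P k l * ξ k) * conj (b l) + (c k l z * 0 + Q k l * ξ k) * 0) =
      ∑ k, ∑ l, D k l * ξ k * conj (ξ l) + ∑ k, ∑ l, Q k l * b k * conj (ξ l) +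
      (∑ k, ∑ l, c k l z * b k * conj (b l) + ∑ k, ∑ l, P k l * ξ k * conj (b l)) := by
    simp only [← Finset.sum_add_distrib]
    exact Finset.sum_congr rfl fun k _ ↦ Finset.sum_congr rfl fun l _ ↦ by ring
  refine e5.trans ?_
  rw [e1]
  ring

end Curvature

/-! ### Hermitian forms in coordinates -/

section Form

variable {n : ℕ}

/-- The sesquilinear form on `ℂⁿ` with coefficients `c k l z`. -/
noncomputable def coeffForm (c : Fin n → Fin n → Cn n → ℂ) (z u v : Cn n) : ℂ :=
  ∑ k, ∑ l, c k l z * u k * conj (v l)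

/-- The Chern curvature `R(V, V̄, W, W̄)` of the Hermitian metric with coefficients `c k l`. -/
noncomputable def coeffCurvature (c : Fin n → Fin n → Cn n → ℂ) (z V W : Cn n) : ℂ :=
  ∑ i, ∑ j, ∑ k, ∑ l, (- dz i (dzbar j (c k l)) z
    + ∑ a, ∑ b, (Matrix.of fun k l ↦ c k l z)⁻¹ b a
      * dz i (c k b) z * dzbar j (c a l) z) * V i * conj (V j) * W k * conj (W l)

variable {c : Fin n → Fin n → Cn n → ℂ} {z : Cn n}

lemma coeffForm_add_left (u v w : Cn n) :
    coeffForm c z (u + v) w = coeffForm c z u w + coeffForm c z v w := by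
  simp only [coeffForm, PiLp.add_apply, mul_add, add_mul, Finset.sum_add_distrib]

lemma coeffForm_add_right (u v w : Cn n) :
    coeffForm c z u (v + w) = coeffForm c z u v + coeffForm c z u w := by
  simp only [coeffForm, PiLp.add_apply, mul_add, map_add, Finset.sum_add_distrib]

lemma coeffForm_smul_left (t : ℂ) (u w : Cn n) :
    coeffForm c z (t • u) w = t * coeffForm c z u w := by
  simp only [coeffForm, PiLp.smul_apply, smul_eq_mul, Finset.mul_sum]
  exact Finset.sum_congr rfl fun _ _ ↦ Finset.sum_congr rfl fun _ _ ↦ by ring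

lemma coeffForm_smul_right (t : ℂ) (u w : Cn n) :
    coeffForm c z u (t • w) = conj t * coeffForm c z u w := by
  simp only [coeffForm, PiLp.smul_apply, smul_eq_mul, Finset.mul_sum, map_mul]
  exact Finset.sum_congr rfl fun _ _ ↦ Finset.sum_congr rfl fun _ _ ↦ by ring

lemma conj_coeffForm (hc : ∀ k l, conj (c k l z) = c l k z) (u v : Cn n) :
    conj (coeffForm c z u v) = coeffForm c z v u := by
  simp only [coeffForm, map_sum, map_mul, hc, Complex.conj_conj]
  rw [Finset.sum_comm]
  exact Finset.sum_congr rfl fun _ _ ↦ Finset.sum_congr rfl fun _ _ ↦ by ring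

lemma coeffForm_self_im (hc : ∀ k l, conj (c k l z) = c l k z) (u : Cn n) :
    (coeffForm c z u u).im = 0 :=
  Complex.conj_eq_iff_im.1 (conj_coeffForm hc u u)

lemma coeffForm_smul_self_re (t : ℂ) (u : Cn n) :
    (coeffForm c z (t • u) (t • u)).re = ‖t‖ ^ 2 * (coeffForm c z u u).re := by
  rw [coeffForm_smul_left, coeffForm_smul_right, ← mul_assoc, Complex.mul_conj,
    Complex.re_ofReal_mul, Complex.normSq_eq_norm_sq]

lemma coeffForm_eq_zero_of_forall_le (hc : ∀ k l, conj (c k l z) = c l k z) {u w : Cn n}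
    (hw : 0 ≤ (coeffForm c z w w).re)
    (h : ∀ t : ℂ, (coeffForm c z u u).re ≤ (coeffForm c z (u + t • w) (u + t • w)).re) :
    coeffForm c z w u = 0 := by
  set a := coeffForm c z w u with ha
  set H := (coeffForm c z w w).re with hH
  have hs : 0 < 1 / (H + 1) := by positivity
  -- A step of size `1 / (H + 1)` in the descent direction changes the square by at most `-s * ‖a‖ ^
  -- 2`. The `+ 1` keeps the denominator positive even when `H = 0`.
  have h1 := h (-((1 / (H + 1) : ℝ) : ℂ) * conj a)
  have h2 : coeffForm c z u w = conj a := (conj_coeffForm hc w u).symm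
  simp only [coeffForm_add_left, coeffForm_add_right, coeffForm_smul_left, coeffForm_smul_right,
    ← ha, h2] at h1
  set s := 1 / (H + 1) with hsdef
  have h3 : s * H ≤ 1 := by
    rw [hsdef, one_div, inv_mul_le_iff₀ (by positivity)]; linarith
  have h4 : (-(s : ℂ) * conj a * a).re = -s * Complex.normSq a := by
    rw [mul_assoc, mul_comm (conj a), Complex.mul_conj]
    simp
  have h5 : (conj (-(s : ℂ) * conj a) * conj a).re = -s * Complex.normSq a := by
    simp only [map_mul, map_neg, Complex.conj_ofReal, Complex.conj_conj]
    rw [mul_assoc, Complex.mul_conj]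
    simp
  have h6 : (conj (-(s : ℂ) * conj a) * (-(s : ℂ) * conj a * coeffForm c z w w)).re =
      s ^ 2 * Complex.normSq a * H := by
    have : conj (-(s : ℂ) * conj a) * (-(s : ℂ) * conj a * coeffForm c z w w) =
        ((s ^ 2 * Complex.normSq a : ℝ) : ℂ) * coeffForm c z w w := by
      push_cast
      rw [← Complex.mul_conj a]
      simp only [map_mul, map_neg, Complex.conj_ofReal, Complex.conj_conj]
      ring
    rw [this, Complex.re_ofReal_mul]
  simp only [Complex.add_re, h4, h5, mul_add, h6] at h1
  have hN := Complex.normSq_nonneg a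
  have h7 : Complex.normSq a * s ≤ 0 := by
    have h8 : s * (Complex.normSq a * s) * H ≤ Complex.normSq a * s := by
      have := mul_le_mul_of_nonneg_right h3 (mul_nonneg hN hs.le)
      nlinarith
    nlinarith
  have h8 : Complex.normSq a = 0 := by
    by_contra hne
    have : 0 < Complex.normSq a * s := mul_pos (lt_of_le_of_ne hN (Ne.symm hne)) hs
    linarith
  exact Complex.normSq_eq_zero.1 h8

lemma isUnit_det_of_pos (hpos : ∀ u : Cn n, u ≠ 0 → 0 < (coeffForm c z u u).re) :
    IsUnit (Matrix.of fun k l ↦ c k l z).det := by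
  rw [isUnit_iff_ne_zero]
  intro h0
  obtain ⟨v, hv, hmul⟩ := Matrix.exists_mulVec_eq_zero_iff.2 h0
  -- The form is conjugate linear in its second slot, so it is the conjugate of a kernel vector that
  -- is isotropic.
  have hconj : (WithLp.toLp 2 fun l ↦ conj (v l) : Cn n) ≠ 0 := by
    intro h
    apply hv
    funext l
    have := congrArg (fun w : Cn n ↦ conj (w l)) h
    simpa using this
  have h1 := hpos _ hconj
  have h2 : coeffForm c z (WithLp.toLp 2 fun l ↦ conj (v l)) (WithLp.toLp 2 fun l ↦ conj (v l))
      = 0 := by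
    rw [coeffForm]
    refine Finset.sum_eq_zero fun k _ ↦ ?_
    have := congrFun hmul k
    simp only [Matrix.mulVec, dotProduct, Matrix.of_apply, Pi.zero_apply] at this
    calc _ = conj (v k) * ∑ l, c k l z * v l := by
          rw [Finset.mul_sum]
          refine Finset.sum_congr rfl fun l _ ↦ ?_
          simp only [Complex.conj_conj]
          ring
      _ = 0 := by rw [this, mul_zero]
  simp [h2] at h1

/-- The function `u * exp (-(u * H))` has its only maximum at `u = 1 / H`. In the application `u` is
the squared scale of one vector of a maximizing tuple and `H` its squared length. -/
lemma eq_one_of_forall_mul_exp_le {H : ℝ} (hH : 0 < H)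
    (h : ∀ u : ℝ, 0 < u → u * Real.exp (-(u * H)) ≤ Real.exp (-H)) : H = 1 := by
  by_contra hne
  have h1 := h H⁻¹ (inv_pos.2 hH)
  rw [inv_mul_cancel₀ hH.ne', inv_mul_le_iff₀ hH] at h1
  have h2 := Real.add_one_lt_exp (sub_ne_zero.2 hne)
  have h3 : Real.exp (-1) * Real.exp (H - 1) = Real.exp (-H) * Real.exp (H - 1) ^ 2 := by
    rw [← Real.exp_nat_mul, ← Real.exp_add, ← Real.exp_add]
    congr 1
    push_cast
    ring
  have h4 : Real.exp (H - 1) = Real.exp (-1) * Real.exp H := by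
    rw [← Real.exp_add]; congr 1; ring
  have h5 : Real.exp (-H) * Real.exp H = 1 := by rw [← Real.exp_add]; simp
  have h6 := Real.exp_pos H
  rw [h4] at h2
  nlinarith [mul_le_mul_of_nonneg_right h1 h6.le]

end Form

section Curvature

variable {n : ℕ} {c : Fin n → Fin n → Cn n → ℂ} {z : Cn n}

lemma dz_contDiffAt {f : Cn n → ℂ} (hf : ContDiffAt ℝ ∞ f z) (i : Fin n) :
    ContDiffAt ℝ ∞ (dz i f) z ∧ ContDiffAt ℝ ∞ (dzbar i f) z := by
  have h1 : ContDiffAt ℝ ∞ (fderiv ℝ f) z := hf.fderiv_right (by simp)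
  have h2 : ∀ v : Cn n, ContDiffAt ℝ ∞ (fun y ↦ fderiv ℝ f y v) z := fun v ↦
    h1.clm_apply contDiffAt_const
  exact ⟨contDiffAt_const.mul ((h2 _).sub (contDiffAt_const.mul (h2 _))),
    contDiffAt_const.mul ((h2 _).add (contDiffAt_const.mul (h2 _)))⟩

lemma continuousAt_matrix_inv {ι α : Type*} [Fintype ι] [DecidableEq ι] [TopologicalSpace α]
    {A : α → Matrix ι ι ℂ} {x : α} (hA : ContinuousAt A x) (h : IsUnit (A x).det) (i j : ι) :
    ContinuousAt (fun y ↦ (A y)⁻¹ i j) x := by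
  have h1 : ContinuousAt (fun y ↦ Ring.inverse (A y).det) x := by
    have h0 : ContinuousAt (fun y ↦ (A y).det) x :=
      (continuous_id.matrix_det.continuousAt (x := A x)).comp hA
    simp only [Ring.inverse_eq_inv']
    exact h0.inv₀ h.ne_zero
  have h2 : ContinuousAt (fun y ↦ (A y).adjugate i j) x := by
    have h3 : Continuous fun B : Matrix ι ι ℂ ↦ B.adjugate i j :=
      (continuous_id.matrix_adjugate).matrix_elem i j
    exact h3.continuousAt.comp hA
  simp only [Matrix.inv_def, Matrix.smul_apply, smul_eq_mul]
  exact h1.mul h2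

lemma continuousAt_coeffCurvature (hc : ∀ k l, ContDiffAt ℝ ∞ (c k l) z)
    (hdet : IsUnit (Matrix.of fun k l ↦ c k l z).det) (V W : Cn n) :
    ContinuousAt (fun q : Cn n × Cn n ↦ coeffCurvature c q.1 V q.2) (z, W) := by
  have hfst : ContinuousAt (Prod.fst : Cn n × Cn n → Cn n) (z, W) := continuousAt_fst
  have hW : ∀ k, ContinuousAt (fun q : Cn n × Cn n ↦ q.2 k) (z, W) := fun k ↦ by fun_prop
  have hA : ContinuousAt (fun y ↦ Matrix.of fun k l ↦ c k l y) z :=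
    continuousAt_pi.2 fun k ↦ continuousAt_pi.2 fun l ↦ (hc k l).continuousAt
  have key : ∀ {f : Cn n → ℂ}, ContinuousAt f z →
      ContinuousAt (fun q : Cn n × Cn n ↦ f q.1) (z, W) := fun hf ↦
    ContinuousAt.comp (f := (Prod.fst : Cn n × Cn n → Cn n)) (x := (z, W)) hf hfst
  unfold coeffCurvature
  refine tendsto_finsetSum _ fun i _ ↦ tendsto_finsetSum _ fun j _ ↦ tendsto_finsetSum _ fun k _ ↦
    tendsto_finsetSum _ fun l _ ↦ ?_
  have h1 : ContinuousAt (fun y ↦ - dz i (dzbar j (c k l)) y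
    + ∑ a, ∑ b, (Matrix.of fun k l ↦ c k l y)⁻¹ b a
      * dz i (c k b) y * dzbar j (c a l) y) z := by
    refine (dz_contDiffAt (dz_contDiffAt (hc k l) j).2 i).1.continuousAt.neg.add ?_
    refine tendsto_finsetSum _ fun a _ ↦ tendsto_finsetSum _ fun b _ ↦ ?_
    exact ((continuousAt_matrix_inv hA hdet b a).mul
      (dz_contDiffAt (hc k b) i).1.continuousAt).mul (dz_contDiffAt (hc a l) j).2.continuousAt
  exact ((((key h1).mul continuousAt_const).mul continuousAt_const).mul (hW k)).mul
    (Complex.continuous_conj.continuousAt.comp (hW l))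

/-- Real parts of second order jets are, up to a harmonic quadratic polynomial, determined by
the mixed coefficient. -/
lemma HasJet.exists_re_le {u : ℂ → ℂ} {u₀ a b D : ℂ} (h : HasJet u u₀ a b D) {η : ℝ}
    (hη : 0 < η) : ∃ K : ℂ → ℂ, AnalyticAt ℂ K 0 ∧ K 0 = 0 ∧
      ∀ᶠ ζ : ℂ in 𝓝 0, (u ζ).re ≤ u₀.re + (K ζ).re + (D.re + η) * ‖ζ‖ ^ 2 := by
  obtain ⟨c, d, h⟩ := h
  refine ⟨fun ζ ↦ (a + conj b) * ζ + (c + conj d) * ζ ^ 2, by fun_prop, by simp, ?_⟩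
  filter_upwards [h.def hη] with ζ hζ
  have h1 := (Complex.re_le_norm _).trans hζ
  rw [Real.norm_of_nonneg (by positivity)] at h1
  have h2 : (conj b * ζ).re = (b * conj ζ).re := by
    rw [← Complex.conj_re (b * conj ζ)]; simp
  have h3 : (conj d * ζ ^ 2).re = (d * conj ζ ^ 2).re := by
    rw [← Complex.conj_re (d * conj ζ ^ 2)]; simp
  have h4 : (D * (ζ * conj ζ)).re = D.re * ‖ζ‖ ^ 2 := by
    rw [Complex.mul_conj, Complex.re_mul_ofReal, Complex.normSq_eq_norm_sq]
  simp only [Complex.sub_re, Complex.add_re, h4, add_mul] at h1 ⊢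
  rw [h2, h3]
  linarith

end Curvature

/-! ### The extremal problem for `p`-tuples of tangent vectors -/

section Extremal

variable {n p : ℕ}

/-- The sum of the squared lengths of the vectors `ξ i` at `z`. -/
noncomputable def energy (c : Fin n → Fin n → Cn n → ℂ) (z : Cn n) (ξ : Fin p → Cn n) : ℝ :=
  ∑ i, (coeffForm c z (ξ i) (ξ i)).re

/-- The quotient of `m z ξ` by `exp (energy c z ξ)` has supremum `M > 0` off `Z`, and `z₀` is a
point near which this supremum is approached. -/
structure IsExtremalAt (Ω Z : Set (Cn n)) (c : Fin n → Fin n → Cn n → ℂ)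
    (m : Cn n → (Fin p → Cn n) → ℝ) (M : ℝ) (z₀ : Cn n) : Prop where
  isOpen : IsOpen Ω
  mem : z₀ ∈ Ω
  smooth : ∀ k l, ContDiffOn ℝ ∞ (c k l) Ω
  herm : ∀ z ∈ Ω, ∀ k l, conj (c k l z) = c l k z
  pos : ∀ z ∈ Ω, ∀ u : Cn n, u ≠ 0 → 0 < (coeffForm c z u u).re
  analytic : ∃ U : Set (Cn n), IsOpen U ∧ z₀ ∈ U ∧ U ⊆ Ω ∧ ∃ (k : ℕ) (g : Fin k → Cn n → ℂ),
      (∀ j, AnalyticOnNhd ℂ (g j) U) ∧ Z ∩ U = {y ∈ U | ∀ j, g j y = 0}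
  nonneg : ∀ z ξ, 0 ≤ m z ξ
  homog : ∀ z ξ (A : Matrix (Fin p) (Fin p) ℂ),
    m z (fun i ↦ ∑ j, A i j • ξ j) = ‖A.det‖ ^ 2 * m z ξ
  logPSH : IsLogPSH (fun q : Cn n × (Fin p → Cn n) ↦ m q.1 q.2) ((Ω \ Z) ×ˢ univ)
  usc : ∀ z ∈ Ω \ Z, ∀ ξ, UpperSemicontinuousAt (fun q : Cn n × (Fin p → Cn n) ↦ m q.1 q.2) (z, ξ)
  M_pos : 0 < M
  le : ∀ z ∈ Ω \ Z, ∀ ξ, m z ξ ≤ M * Real.exp (energy c z ξ)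
  sup : ∀ N ∈ 𝓝 z₀, ∀ M' < M, ∃ z ∈ N ∩ (Ω \ Z), ∃ ξ, M' * Real.exp (energy c z ξ) < m z ξ

/-- The penalized functional. -/
noncomputable def penalized (c : Fin n → Fin n → Cn n → ℂ) (m : Cn n → (Fin p → Cn n) → ℝ)
    (G : Cn n → ℝ) (z₀ : Cn n) (ε δ : ℝ) (z : Cn n) (ξ : Fin p → Cn n) : ℝ :=
  m z ξ * Real.exp (-energy c z ξ - ε * ‖z - z₀‖ ^ 2) * G z ^ δ

variable {Ω Z : Set (Cn n)} {c : Fin n → Fin n → Cn n → ℂ} {m : Cn n → (Fin p → Cn n) → ℝ}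
  {M : ℝ} {z₀ : Cn n}

lemma energy_smul (t : ℂ) (z : Cn n) (ξ : Fin p → Cn n) :
    energy c z (fun i ↦ t • ξ i) = ‖t‖ ^ 2 * energy c z ξ := by
  simp only [energy, coeffForm_smul_self_re, Finset.mul_sum]

lemma continuousOn_coeffForm {D : Set (Cn n)} (hc : ∀ k l, ContinuousOn (c k l) D) :
    ContinuousOn (fun q : Cn n × Cn n ↦ coeffForm c q.1 q.2 q.2) (D ×ˢ univ) := by
  unfold coeffForm
  refine continuousOn_finsetSum _ fun k _ ↦ continuousOn_finsetSum _ fun l _ ↦ ?_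
  have h1 : ContinuousOn (fun q : Cn n × Cn n ↦ c k l q.1) (D ×ˢ univ) :=
    (hc k l).comp continuousOn_fst fun q hq ↦ hq.1
  exact (h1.mul (by fun_prop)).mul (Complex.continuous_conj.comp_continuousOn (by fun_prop))

lemma continuousOn_energy {D : Set (Cn n)} (hc : ∀ k l, ContinuousOn (c k l) D) :
    ContinuousOn (fun q : Cn n × (Fin p → Cn n) ↦ energy c q.1 q.2) (D ×ˢ univ) := by
  unfold energy
  refine continuousOn_finsetSum _ fun i _ ↦ Complex.continuous_re.comp_continuousOn ?_
  exact (continuousOn_coeffForm hc).comp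
    (f := fun q : Cn n × (Fin p → Cn n) ↦ (q.1, q.2 i)) (by fun_prop) fun q hq ↦ ⟨hq.1, mem_univ _⟩

lemma exists_mul_norm_sq_le_coeffForm {K : Set (Cn n)} (hK : IsCompact K)
    (hc : ∀ k l, ContinuousOn (c k l) K)
    (hpos : ∀ z ∈ K, ∀ u : Cn n, u ≠ 0 → 0 < (coeffForm c z u u).re) :
    ∃ a > 0, ∀ z ∈ K, ∀ u : Cn n, a * ‖u‖ ^ 2 ≤ (coeffForm c z u u).re := by
  obtain ⟨a, ha, h⟩ := (hK.prod (isCompact_sphere (0 : Cn n) 1)).exists_forall_le'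
    (f := fun q : Cn n × Cn n ↦ (coeffForm c q.1 q.2 q.2).re) (a := 0)
    (Complex.continuous_re.comp_continuousOn
      ((continuousOn_coeffForm hc).mono (prod_mono_right (subset_univ _))))
    (fun q hq ↦ hpos q.1 hq.1 q.2
      (ne_zero_of_mem_unit_sphere (⟨q.2, hq.2⟩ : Metric.sphere (0 : Cn n) 1)))
  refine ⟨a, ha, fun z hz u ↦ ?_⟩
  by_cases hu : u = 0
  · simp [hu, coeffForm]
  have hn : ‖u‖ ≠ 0 := norm_ne_zero_iff.2 hu
  have h1 := h (z, ((‖u‖⁻¹ : ℝ) : ℂ) • u) ⟨hz, by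
    simp [norm_smul, hn]⟩
  simp only [coeffForm_smul_self_re] at h1
  rw [Complex.norm_real, norm_inv, norm_norm, inv_pow, inv_mul_eq_div,
    le_div_iff₀ (by positivity)] at h1
  exact h1

/-- `T ^ p * exp (-T)` is largest at `T = p`. As `m` is homogeneous of degree `2 * p`, maximization
can thus be confined to tuples of energy `p`, which form a bounded set. -/
lemma div_pow_mul_exp_le {T : ℝ} (hT : 0 < T) {p : ℕ} (hp : 1 ≤ p) :
    Real.exp (-T) ≤ ((p : ℝ) / T) ^ p * Real.exp (-p) := by
  have hp' : (0 : ℝ) < p := by exact_mod_cast hp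
  have h1 : T / p ≤ Real.exp (T / p - 1) := by linarith [Real.add_one_le_exp (T / p - 1)]
  have h2 : (T / p) ^ p ≤ Real.exp (T - p) := by
    calc (T / p) ^ p ≤ Real.exp (T / p - 1) ^ p := by gcongr
      _ = Real.exp (T - p) := by
        rw [← Real.exp_nat_mul]; congr 1; field_simp
  have h3 : Real.exp (-p) = Real.exp (-T) * Real.exp (T - p) := by
    rw [← Real.exp_add]; congr 1; ring
  rw [h3, ← mul_assoc, mul_comm (_ ^ p), mul_assoc]
  refine le_mul_of_one_le_right (Real.exp_pos _).le ?_
  rw [← inv_div T (p : ℝ), inv_pow, ← div_eq_inv_mul, le_div_iff₀ (by positivity), one_mul]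
  exact h2

lemma apply_smul_of_apply_matrix {m : (Fin p → Cn n) → ℝ}
    (hm : ∀ ξ (A : Matrix (Fin p) (Fin p) ℂ), m (fun i ↦ ∑ j, A i j • ξ j) = ‖A.det‖ ^ 2 * m ξ)
    (t : ℂ) (ξ : Fin p → Cn n) : m (fun i ↦ t • ξ i) = ‖t‖ ^ (2 * p) * m ξ := by
  have := hm ξ (Matrix.diagonal fun _ ↦ t)
  simp only [Matrix.det_diagonal, Finset.prod_const, Finset.card_univ, Fintype.card_fin,
    norm_pow] at this
  rw [mul_comm 2 p, pow_mul, ← this]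
  congr 1
  funext i
  rw [Finset.sum_eq_single i (fun j _ hj ↦ by simp [Matrix.diagonal_apply_ne _ (Ne.symm hj)])
    (by simp), Matrix.diagonal_apply_eq]

/-- Homogeneity gives `m ξ ≤ C * ‖ξ‖ ^ (2 * p)`, coercivity bounds `‖ξ‖ ^ 2` by `energy / a`, and
the exponential series absorbs the power at the cost of `p!`. -/
lemma le_mul_exp_energy {m : (Fin p → Cn n) → ℝ} {z : Cn n}
    (hm : ∀ ξ (A : Matrix (Fin p) (Fin p) ℂ), m (fun i ↦ ∑ j, A i j • ξ j) = ‖A.det‖ ^ 2 * m ξ)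
    {C : ℝ} (hC0 : 0 ≤ C) (hC : ∀ ξ, ‖ξ‖ ≤ 1 → m ξ ≤ C) {a : ℝ} (ha : 0 < a)
    (hac : ∀ u : Cn n, a * ‖u‖ ^ 2 ≤ (coeffForm c z u u).re) (ξ : Fin p → Cn n) :
    m ξ ≤ C * (p.factorial / a ^ p) * Real.exp (energy c z ξ) := by
  have hE0 : ∀ i, 0 ≤ (coeffForm c z (ξ i) (ξ i)).re := fun i ↦
    le_trans (by positivity) (hac (ξ i))
  have hE : 0 ≤ energy c z ξ := Finset.sum_nonneg fun i _ ↦ hE0 i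
  have h1 : ‖ξ‖ ≤ √(energy c z ξ / a) := by
    rw [pi_norm_le_iff_of_nonneg (Real.sqrt_nonneg _)]
    intro i
    refine Real.le_sqrt_of_sq_le ?_
    rw [le_div_iff₀ ha, mul_comm]
    exact (hac (ξ i)).trans (Finset.single_le_sum
      (f := fun i ↦ (coeffForm c z (ξ i) (ξ i)).re) (fun i _ ↦ hE0 i) (Finset.mem_univ i))
  have h2 : ‖ξ‖ ^ (2 * p) ≤ (energy c z ξ / a) ^ p := by
    rw [pow_mul]
    refine pow_le_pow_left₀ (by positivity) ?_ p
    calc ‖ξ‖ ^ 2 ≤ √(energy c z ξ / a) ^ 2 := pow_le_pow_left₀ (norm_nonneg _) h1 2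
      _ = _ := Real.sq_sqrt (by positivity)
  have h3 : ξ = fun i ↦ (‖ξ‖ : ℂ) • ((‖ξ‖ : ℂ)⁻¹ • ξ) i := by
    by_cases h : ξ = 0
    · funext i; simp [h]
    · have : (‖ξ‖ : ℂ) ≠ 0 := by simpa using h
      funext i
      rw [Pi.smul_apply, smul_inv_smul₀ this]
  have h4 : ‖(‖ξ‖ : ℂ)⁻¹ • ξ‖ ≤ 1 := by
    rw [norm_smul, norm_inv, Complex.norm_real, norm_norm]
    exact inv_mul_le_one
  have h5 := apply_smul_of_apply_matrix hm (‖ξ‖ : ℂ) ((‖ξ‖ : ℂ)⁻¹ • ξ)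
  rw [← h3, Complex.norm_real, norm_norm] at h5
  have h6 := Real.pow_div_factorial_le_exp _ hE p
  rw [div_le_iff₀ (by positivity)] at h6
  calc m ξ ≤ ‖ξ‖ ^ (2 * p) * C := by
        rw [h5]; exact mul_le_mul_of_nonneg_left (hC _ h4) (by positivity)
    _ ≤ (energy c z ξ / a) ^ p * C := by gcongr
    _ = C / a ^ p * energy c z ξ ^ p := by rw [div_pow]; ring
    _ ≤ C / a ^ p * (Real.exp (energy c z ξ) * p.factorial) := by gcongr
    _ = _ := by ring

namespace IsExtremalAt

lemma smul_eq (H : IsExtremalAt Ω Z c m M z₀) (t : ℂ) (z : Cn n) (ξ : Fin p → Cn n) :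
    m z (fun i ↦ t • ξ i) = ‖t‖ ^ (2 * p) * m z ξ :=
  apply_smul_of_apply_matrix (H.homog z) t ξ

lemma update_add_eq (H : IsExtremalAt Ω Z c m M z₀) {i j : Fin p} (hij : i ≠ j) (t : ℂ)
    (z : Cn n) (ξ : Fin p → Cn n) : m z (Function.update ξ i (ξ i + t • ξ j)) = m z ξ := by
  have := H.homog z ξ (Matrix.transvection i j t)
  rw [Matrix.det_transvection_of_ne i j hij] at this
  simp only [norm_one, one_pow, one_mul] at this
  rw [← this]
  congr 1
  funext k
  simp only [Matrix.transvection, Matrix.add_apply, add_smul, Finset.sum_add_distrib,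
    Matrix.one_apply, Matrix.single_apply]
  by_cases hk : k = i
  · subst hk
    simp [ite_smul]
  · simp [Function.update_of_ne hk, ite_smul, Ne.symm hk]

lemma update_smul_eq (H : IsExtremalAt Ω Z c m M z₀) (i : Fin p) (t : ℂ)
    (z : Cn n) (ξ : Fin p → Cn n) :
    m z (Function.update ξ i (t • ξ i)) = ‖t‖ ^ 2 * m z ξ := by
  have := H.homog z ξ (Matrix.diagonal (Function.update 1 i t))
  rw [Matrix.det_diagonal, Finset.prod_update_of_mem (Finset.mem_univ i)] at this
  simp only [Pi.one_apply, Finset.prod_const_one, mul_one] at this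
  rw [← this]
  congr 1
  funext k
  rw [Finset.sum_eq_single k (fun j _ hj ↦ by simp [Matrix.diagonal_apply_ne _ (Ne.symm hj)])
    (by simp), Matrix.diagonal_apply_eq]
  by_cases hk : k = i
  · subst hk; simp
  · simp [Function.update_of_ne hk]

lemma eq_zero_of_apply_eq_zero (H : IsExtremalAt Ω Z c m M z₀) {z : Cn n} {ξ : Fin p → Cn n}
    {i : Fin p} (h : ξ i = 0) : m z ξ = 0 := by
  have := H.update_smul_eq i 0 z ξ
  rw [zero_smul, ← h, Function.update_eq_self] at this
  simpa using this

lemma exists_le_of_energy_eq (H : IsExtremalAt Ω Z c m M z₀) (hp : 1 ≤ p) {z : Cn n}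
    {ξ : Fin p → Cn n} (hξ : 0 < energy c z ξ) :
    ∃ ξ' : Fin p → Cn n, energy c z ξ' = p ∧
      m z ξ * Real.exp (-energy c z ξ) ≤ m z ξ' * Real.exp (-energy c z ξ') := by
  set T := energy c z ξ with hT
  have hs : 0 ≤ (p : ℝ) / T := by positivity
  have hn : ‖((Real.sqrt (p / T) : ℝ) : ℂ)‖ ^ 2 = p / T := by
    rw [Complex.norm_real, Real.norm_of_nonneg (Real.sqrt_nonneg _), Real.sq_sqrt hs]
  have he : energy c z (fun i ↦ ((Real.sqrt (p / T) : ℝ) : ℂ) • ξ i) = p := by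
    rw [energy_smul, hn, ← hT]; field_simp
  refine ⟨_, he, ?_⟩
  rw [he, H.smul_eq, pow_mul, hn, mul_comm (_ ^ p) (m z ξ), mul_assoc]
  exact mul_le_mul_of_nonneg_left (div_pow_mul_exp_le hξ hp) (H.nonneg _ _)

/-- The supremum `M` may be approached only along points tending to `Z`, where `m` is uncontrolled.
The factor `G ^ δ` forces the maximizer off `Z`, and the Gaussian factor keeps it in the interior of
the ball. -/
lemma exists_penalized_max (H : IsExtremalAt Ω Z c m M z₀) (hp : 1 ≤ p) {U : Set (Cn n)}
    (hUΩ : U ⊆ Ω) {k : ℕ} {g : Fin k → Cn n → ℂ} (hg : ∀ j, AnalyticOnNhd ℂ (g j) U)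
    (hZU : Z ∩ U = {y ∈ U | ∀ j, g j y = 0}) {ρ ε : ℝ} (hρ : 0 < ρ) (hε : 0 < ε)
    (hρU : Metric.closedBall z₀ ρ ⊆ U) :
    ∃ δ > 0, ∃ z ∈ Metric.ball z₀ ρ, ∃ ξ : Fin p → Cn n,
      0 < penalized c m (fun z ↦ ∑ j, ‖g j z‖ ^ 2) z₀ ε δ z ξ ∧
      ∀ z' ∈ Metric.closedBall z₀ ρ, ∀ ξ', penalized c m (fun z ↦ ∑ j, ‖g j z‖ ^ 2) z₀ ε δ z' ξ' ≤
        penalized c m (fun z ↦ ∑ j, ‖g j z‖ ^ 2) z₀ ε δ z ξ := by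
  set G : Cn n → ℝ := fun z ↦ ∑ j, ‖g j z‖ ^ 2 with hG
  have hG0 : ∀ z, 0 ≤ G z := fun z ↦ by positivity
  have hGZ : ∀ z ∈ U, G z ≠ 0 → z ∉ Z := by
    intro z hz hGz hzZ
    apply hGz
    have : z ∈ Z ∩ U := ⟨hzZ, hz⟩
    rw [hZU] at this
    simp [hG, this.2]
  have hGZ' : ∀ z ∈ U, z ∉ Z → 0 < G z := by
    intro z hz hzZ
    refine lt_of_le_of_ne (hG0 z) fun h ↦ hzZ ?_
    have h1 := (Finset.sum_eq_zero_iff_of_nonneg fun j _ ↦ by positivity).1 h.symm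
    have : z ∈ Z ∩ U := by
      rw [hZU]
      exact ⟨hz, fun j ↦ by simpa using h1 j (Finset.mem_univ j)⟩
    exact this.1
  set B := Metric.closedBall z₀ ρ with hB
  have hBc : IsCompact B := isCompact_closedBall _ _
  have hGc : ContinuousOn G B := by
    refine continuousOn_finsetSum _ fun j _ ↦ ContinuousOn.pow (ContinuousOn.norm ?_) 2
    exact (hg j).continuousOn.mono hρU
  have hcc : ∀ k l, ContinuousOn (c k l) B := fun k l ↦
    (H.smooth k l).continuousOn.mono (hρU.trans hUΩ)
  obtain ⟨C, hC⟩ := (hBc.image_of_continuousOn hGc).bddAbove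
  have hCG : ∀ z ∈ B, G z ≤ C := fun z hz ↦ hC (mem_image_of_mem _ hz)
  -- Exponents in units of `ε * ρ ^ 2`: `z₁` loses `1 / 2` against `M` and at most `1 / 4` more to
  -- the Gaussian, since it lies within `ρ / 2`. That total of `3 / 4` beats the loss `1` on the
  -- bounding sphere, and `δ` is chosen small enough to preserve this comparison.
  obtain ⟨z₁, ⟨hz₁, hz₁Ω⟩, ξ₁, hξ₁⟩ := H.sup (Metric.ball z₀ (ρ / 2))
    (Metric.ball_mem_nhds _ (by positivity)) (M * Real.exp (-(ε * ρ ^ 2 / 2)))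
    (mul_lt_of_lt_one_right H.M_pos (Real.exp_lt_one_iff.2 (by
      have : 0 < ε * ρ ^ 2 / 2 := by positivity
      linarith)))
  have hz₁B : z₁ ∈ B := Metric.ball_subset_closedBall
    (Metric.ball_subset_ball (by linarith) hz₁)
  have hG1 : 0 < G z₁ := hGZ' _ (hρU hz₁B) hz₁Ω.2
  have hCpos : 0 < C := hG1.trans_le (hCG _ hz₁B)
  obtain ⟨δ, hδlt, hδ⟩ : ∃ δ : ℝ, M * Real.exp (-(ε * ρ ^ 2)) * C ^ δ <
      M * Real.exp (-(3 * (ε * ρ ^ 2) / 4)) * G z₁ ^ δ ∧ 0 < δ := by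
    have h1 : ContinuousAt (fun δ : ℝ ↦ M * Real.exp (-(ε * ρ ^ 2)) * C ^ δ) 0 :=
      continuousAt_const.mul (Real.continuousAt_const_rpow hCpos.ne')
    have h2 : ContinuousAt (fun δ : ℝ ↦ M * Real.exp (-(3 * (ε * ρ ^ 2) / 4)) * G z₁ ^ δ) 0 :=
      continuousAt_const.mul (Real.continuousAt_const_rpow hG1.ne')
    have h3 := h1.eventually_lt h2 (by
      simp only [Real.rpow_zero, mul_one]
      refine mul_lt_mul_of_pos_left (Real.exp_lt_exp.2 ?_) H.M_pos
      have : 0 < ε * ρ ^ 2 := by positivity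
      linarith)
    have h4 : ∀ᶠ δ : ℝ in 𝓝[>] 0, _ := h3.filter_mono nhdsWithin_le_nhds
    exact (h4.and self_mem_nhdsWithin).exists
  have hpen1 : M * Real.exp (-(3 * (ε * ρ ^ 2) / 4)) * G z₁ ^ δ ≤
      penalized c m G z₀ ε δ z₁ ξ₁ := by
    refine mul_le_mul_of_nonneg_right ?_ (Real.rpow_nonneg (hG0 _) _)
    have h1 : ‖z₁ - z₀‖ ≤ ρ / 2 := (mem_ball_iff_norm.1 hz₁).le
    have h2 : ε * ‖z₁ - z₀‖ ^ 2 ≤ ε * (ρ / 2) ^ 2 := by gcongr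
    calc M * Real.exp (-(3 * (ε * ρ ^ 2) / 4)) = M * Real.exp (-(ε * ρ ^ 2 / 2)) *
          Real.exp (energy c z₁ ξ₁) * Real.exp (-energy c z₁ ξ₁ - ε * (ρ / 2) ^ 2) := by
          rw [mul_assoc, mul_assoc, ← Real.exp_add, ← Real.exp_add]
          congr 2; ring
      _ ≤ m z₁ ξ₁ * Real.exp (-energy c z₁ ξ₁ - ε * ‖z₁ - z₀‖ ^ 2) := by
          refine mul_le_mul hξ₁.le (Real.exp_le_exp.2 (by linarith)) (Real.exp_pos _).le
            (H.nonneg _ _)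
  have hpos1 : 0 < penalized c m G z₀ ε δ z₁ ξ₁ := by
    refine lt_of_lt_of_le ?_ hpen1
    have := H.M_pos
    positivity
  obtain ⟨a, ha, hale⟩ := exists_mul_norm_sq_le_coeffForm hBc hcc
    (fun z hz ↦ H.pos z (hUΩ (hρU hz)))
  set R : ℝ := p / a + 1 with hR
  have hRpos : 0 < R := by positivity
  have hbound : ∀ z ∈ B, ∀ ξ : Fin p → Cn n, energy c z ξ = p → ξ ∈ Metric.closedBall 0 R := by
    intro z hz ξ hξ
    rw [mem_closedBall_zero_iff, pi_norm_le_iff_of_nonneg hRpos.le]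
    intro i
    have h1 : (coeffForm c z (ξ i) (ξ i)).re ≤ p := by
      rw [← hξ]
      refine Finset.single_le_sum (f := fun i ↦ (coeffForm c z (ξ i) (ξ i)).re)
        (fun j _ ↦ ?_) (Finset.mem_univ i)
      exact le_trans (by positivity) (hale z hz (ξ j))
    have h2 : ‖ξ i‖ ^ 2 ≤ p / a := by
      rw [le_div_iff₀ ha, mul_comm]
      exact (hale z hz (ξ i)).trans h1
    have h3 : (0 : ℝ) ≤ p / a := by positivity
    refine abs_le_of_sq_le_sq' (?_ : ‖ξ i‖ ^ 2 ≤ R ^ 2) hRpos.le |>.2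
    nlinarith
  set K : Set (Cn n × (Fin p → Cn n)) := B ×ˢ Metric.closedBall 0 R with hK
  have hKc : IsCompact K := hBc.prod (isCompact_closedBall _ _)
  have husc : UpperSemicontinuousOn (fun q : Cn n × (Fin p → Cn n) ↦
      penalized c m G z₀ ε δ q.1 q.2) K := by
    have hen : ContinuousOn (fun q : Cn n × (Fin p → Cn n) ↦
        Real.exp (-energy c q.1 q.2 - ε * ‖q.1 - z₀‖ ^ 2)) K := by
      refine Real.continuous_exp.comp_continuousOn (ContinuousOn.sub ?_ (by fun_prop))
      exact ((continuousOn_energy hcc).mono (prod_mono_right (subset_univ _))).neg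
    refine upperSemicontinuousOn_mul_rpow (G := fun q : Cn n × (Fin p → Cn n) ↦ G q.1)
      (m := fun q : Cn n × (Fin p → Cn n) ↦
        m q.1 q.2 * Real.exp (-energy c q.1 q.2 - ε * ‖q.1 - z₀‖ ^ 2))
      (fun q _ ↦ hG0 _) (hGc.comp continuousOn_fst fun q hq ↦ hq.1) ?_ ?_ hδ
    · intro q hq hGq
      refine upperSemicontinuousWithinAt_mul ?_ (hen q hq) fun _ _ ↦ (Real.exp_pos _).le
      exact (H.usc q.1 ⟨hUΩ (hρU hq.1), hGZ _ (hρU hq.1) hGq⟩ q.2).upperSemicontinuousWithinAt _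
    · intro q hq _
      refine ⟨M, ?_⟩
      filter_upwards [self_mem_nhdsWithin] with y hy hGy
      have h1 := H.le y.1 ⟨hUΩ (hρU hy.1), hGZ _ (hρU hy.1) hGy⟩ y.2
      have h2 : 0 ≤ ε * ‖y.1 - z₀‖ ^ 2 := by positivity
      calc _ ≤ M * Real.exp (energy c y.1 y.2) * Real.exp (-energy c y.1 y.2) := by
            refine mul_le_mul h1 (Real.exp_le_exp.2 (by linarith)) (Real.exp_pos _).le ?_
            have := H.M_pos
            positivity
        _ = M := by rw [mul_assoc, ← Real.exp_add]; simp
  have h0K : (z₀, (0 : Fin p → Cn n)) ∈ K := ⟨by simp [hB, hρ.le], by simp [hRpos.le]⟩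
  obtain ⟨q, hqK, hqmax⟩ := husc.exists_isMaxOn ⟨_, h0K⟩ hKc
  have hpen0 : ∀ z ξ, 0 ≤ penalized c m G z₀ ε δ z ξ := fun z ξ ↦
    mul_nonneg (mul_nonneg (H.nonneg _ _) (Real.exp_pos _).le) (Real.rpow_nonneg (hG0 _) _)
  have hglob : ∀ z' ∈ B, ∀ ξ', penalized c m G z₀ ε δ z' ξ' ≤
      penalized c m G z₀ ε δ q.1 q.2 := by
    intro z' hz' ξ'
    -- A tuple containing a zero vector has `m = 0`; any other has positive energy and can be
    -- rescaled to energy `p`, hence into the compact set `K`.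
    by_cases hξ' : ∃ i, ξ' i = 0
    · obtain ⟨i, hi⟩ := hξ'
      rw [penalized, H.eq_zero_of_apply_eq_zero hi, zero_mul, zero_mul]
      exact hpen0 _ _
    push Not at hξ'
    have hpos : 0 < energy c z' ξ' :=
      Finset.sum_pos (fun i _ ↦ H.pos z' (hUΩ (hρU hz')) _ (hξ' i)) ⟨⟨0, hp⟩, Finset.mem_univ _⟩
    obtain ⟨ξ'', h1, h2⟩ := H.exists_le_of_energy_eq hp hpos
    have h3 := hqmax (show (z', ξ'') ∈ K from ⟨hz', hbound z' hz' ξ'' h1⟩)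
    refine le_trans ?_ h3
    simp only [penalized, sub_eq_add_neg, Real.exp_add, ← mul_assoc]
    gcongr
  refine ⟨δ, hδ, q.1, ?_, q.2, hpos1.trans_le (hglob _ hz₁B _), hglob⟩
  by_contra hball
  have hdist : ‖q.1 - z₀‖ = ρ := by
    refine le_antisymm (mem_closedBall_iff_norm.1 hqK.1) ?_
    rw [mem_ball_iff_norm] at hball
    exact not_lt.1 hball
  have hGq : G q.1 ≠ 0 := by
    intro h0
    have := hpos1.trans_le (hglob _ hz₁B _)
    simp [penalized, h0, Real.zero_rpow hδ.ne'] at this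
  have h1 := H.le q.1 ⟨hUΩ (hρU hqK.1), hGZ _ (hρU hqK.1) hGq⟩ q.2
  have h2 : penalized c m G z₀ ε δ q.1 q.2 ≤ M * Real.exp (-(ε * ρ ^ 2)) * C ^ δ := by
    have hM := H.M_pos
    refine mul_le_mul ?_ (Real.rpow_le_rpow (hG0 _) (hCG _ hqK.1) hδ.le)
      (Real.rpow_nonneg (hG0 _) _) (by positivity)
    calc _ ≤ M * Real.exp (energy c q.1 q.2) *
          Real.exp (-energy c q.1 q.2 - ε * ‖q.1 - z₀‖ ^ 2) := by gcongr
      _ = _ := by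
        rw [mul_assoc, ← Real.exp_add, hdist]
        congr 2; ring
  linarith [hglob _ hz₁B ξ₁]

end IsExtremalAt

end Extremal

section Extremal

variable {n p : ℕ} {Ω Z : Set (Cn n)} {c : Fin n → Fin n → Cn n → ℂ}
  {m : Cn n → (Fin p → Cn n) → ℝ} {M : ℝ} {z₀ : Cn n}

lemma energy_update_add (z : Cn n) (ξ : Fin p → Cn n) (i : Fin p) (w : Cn n) :
    energy c z (Function.update ξ i w) + (coeffForm c z (ξ i) (ξ i)).re =
      energy c z ξ + (coeffForm c z w w).re := by
  rw [energy, energy, ← Finset.add_sum_erase _ _ (Finset.mem_univ i),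
    ← Finset.add_sum_erase (a := i) _ (fun i ↦ (coeffForm c z (ξ i) (ξ i)).re) (Finset.mem_univ i),
    Function.update_self, Finset.sum_congr rfl fun j hj ↦ by
      rw [Function.update_of_ne (Finset.ne_of_mem_erase hj)]]
  ring

lemma exp_neg_mul_exp_neg_le {x y s t : ℝ} (h : x * Real.exp (-s) ≤ y * Real.exp (-t)) :
    x ≤ y * Real.exp (s - t) := by
  have h1 := mul_le_mul_of_nonneg_right h (Real.exp_pos s).le
  rw [mul_assoc, mul_assoc, ← Real.exp_add, ← Real.exp_add] at h1
  simpa [neg_add_eq_sub] using h1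

namespace IsExtremalAt

/-- Only `ξ` varies here. Scaling one vector determines its length. Adding a multiple of `ξ i` to `ξ
j` does not change `m`, so `ξ j` has minimal length modulo `ξ i` and is orthogonal to it. -/
lemma unitary_of_penalized_max (H : IsExtremalAt Ω Z c m M z₀) {G : Cn n → ℝ} {ε δ : ℝ}
    {z : Cn n} (hz : z ∈ Ω) {ξ : Fin p → Cn n} (hG : 0 ≤ G z)
    (hpos : 0 < penalized c m G z₀ ε δ z ξ)
    (hmax : ∀ ξ', penalized c m G z₀ ε δ z ξ' ≤ penalized c m G z₀ ε δ z ξ) (i j : Fin p) :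
    coeffForm c z (ξ i) (ξ j) = if i = j then 1 else 0 := by
  have hGδ : 0 < G z ^ δ := by
    refine lt_of_le_of_ne (Real.rpow_nonneg hG _) fun h ↦ ?_
    rw [penalized, ← h, mul_zero] at hpos
    exact lt_irrefl _ hpos
  have hm : 0 < m z ξ := by
    refine lt_of_le_of_ne (H.nonneg _ _) fun h ↦ ?_
    rw [penalized, ← h, zero_mul, zero_mul] at hpos
    exact lt_irrefl _ hpos
  have hmax' : ∀ ξ', m z ξ' ≤ m z ξ * Real.exp (energy c z ξ' - energy c z ξ) := by
    intro ξ'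
    have h1 := le_of_mul_le_mul_right (hmax ξ') hGδ
    refine exp_neg_mul_exp_neg_le ?_
    simp only [sub_eq_add_neg, Real.exp_add, ← mul_assoc] at h1
    exact le_of_mul_le_mul_right h1 (Real.exp_pos _)
  have hQ : ∀ i, 0 < (coeffForm c z (ξ i) (ξ i)).re := fun i ↦ H.pos z hz _ fun h ↦
    hm.ne' (H.eq_zero_of_apply_eq_zero h)
  by_cases hij : i = j
  · subst hij
    rw [if_pos rfl]
    refine Complex.ext ?_ (coeffForm_self_im (H.herm z hz) _)
    refine eq_one_of_forall_mul_exp_le (hQ i) fun u hu ↦ ?_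
    have hn : ‖((Real.sqrt u : ℝ) : ℂ)‖ ^ 2 = u := by
      rw [Complex.norm_real, Real.norm_of_nonneg (Real.sqrt_nonneg _), Real.sq_sqrt hu.le]
    have h1 := hmax' (Function.update ξ i (((Real.sqrt u : ℝ) : ℂ) • ξ i))
    have h2 := energy_update_add (c := c) z ξ i (((Real.sqrt u : ℝ) : ℂ) • ξ i)
    rw [H.update_smul_eq, hn, mul_comm] at h1
    rw [coeffForm_smul_self_re, hn] at h2
    have h3 := le_of_mul_le_mul_left h1 hm
    calc u * Real.exp (-(u * (coeffForm c z (ξ i) (ξ i)).re)) ≤ _ :=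
          mul_le_mul_of_nonneg_right h3 (Real.exp_pos _).le
      _ = _ := by rw [← Real.exp_add]; congr 1; linarith
  · rw [if_neg hij]
    refine coeffForm_eq_zero_of_forall_le (H.herm z hz) (hQ i).le fun t ↦ ?_
    have h1 := hmax' (Function.update ξ j (ξ j + t • ξ i))
    rw [H.update_add_eq (Ne.symm hij)] at h1
    have h2 := energy_update_add (c := c) z ξ j (ξ j + t • ξ i)
    have h3 : (1 : ℝ) ≤ _ := le_of_mul_le_mul_left ((mul_one (m z ξ)).trans_le h1) hm
    have h4 := Real.one_le_exp_iff.1 h3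
    linarith

/-- A larger curvature sum would make the energy of the parallel extension strictly superharmonic to
second order, beyond what the Gaussian penalty compensates. Maximality would then bound `m` along
the disc by a test function excluded by `logPSH`. -/
lemma curvature_le_of_penalized_max (H : IsExtremalAt Ω Z c m M z₀) {U : Set (Cn n)}
    (hUΩ : U ⊆ Ω) {k : ℕ} {g : Fin k → Cn n → ℂ}
    (hg : ∀ j, AnalyticOnNhd ℂ (g j) U)
    (hZU : Z ∩ U = {y ∈ U | ∀ j, g j y = 0}) {ε δ : ℝ} (hδ : 0 < δ) {z : Cn n} (hzU : z ∈ U)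
    {ξ : Fin p → Cn n}
    (hpos : 0 < penalized c m (fun z ↦ ∑ j, ‖g j z‖ ^ 2) z₀ ε δ z ξ)
    (hmax : ∀ᶠ z' in 𝓝 z, ∀ ξ', penalized c m (fun z ↦ ∑ j, ‖g j z‖ ^ 2) z₀ ε δ z' ξ' ≤
      penalized c m (fun z ↦ ∑ j, ‖g j z‖ ^ 2) z₀ ε δ z ξ) (V : Cn n) :
    ∑ i, (coeffCurvature c z V (ξ i)).re ≤ ε * ‖V‖ ^ 2 := by
  by_contra! hlt
  set r := ∑ i, (coeffCurvature c z V (ξ i)).re - ε * ‖V‖ ^ 2 with hr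
  have hrpos : 0 < r := sub_pos.2 hlt
  have hzΩ := hUΩ hzU
  have hG0 : 0 < ∑ j, ‖g j z‖ ^ 2 := by
    refine lt_of_le_of_ne (by positivity) fun h ↦ ?_
    rw [penalized, ← h, Real.zero_rpow hδ.ne', mul_zero] at hpos
    exact lt_irrefl _ hpos
  have hm : 0 < m z ξ := by
    refine lt_of_le_of_ne (H.nonneg _ _) fun h ↦ ?_
    rw [penalized, ← h, zero_mul, zero_mul] at hpos
    exact lt_irrefl _ hpos
  have hzZ : z ∉ Z := by
    intro hzZ
    have h1 : z ∈ Z ∩ U := ⟨hzZ, hzU⟩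
    rw [hZU] at h1
    simp [h1.2] at hG0
  have hsm : ∀ k l, ContDiffAt ℝ 2 (c k l) z := fun k l ↦
    ((H.smooth k l).contDiffAt (H.isOpen.mem_nhds hzΩ)).of_le ENat.LEInfty.out
  choose b α β hjet using fun i ↦
    exists_hasJet_normSq c V (ξ i) hsm (isUnit_det_of_pos (H.pos z hzΩ))
  -- The excess is `r`; `p` jet errors of this size cost at most `r / 2` together, which leaves `r /
  -- 2` as the strict margin.
  have hη : 0 < r / (2 * (p + 1)) := by positivity
  choose K hK hK0 hKle using fun i ↦ (hjet i).exists_re_le hη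
  have hline : AnalyticAt ℂ (fun ζ : ℂ ↦ z + ζ • V) 0 := by fun_prop
  obtain ⟨L, hL, hL0, hLle⟩ := exists_analytic_le_sum_norm_sq_rpow
    (g := fun j (ζ : ℂ) ↦ g j (z + ζ • V))
    (fun j ↦ AnalyticAt.comp (f := fun ζ : ℂ ↦ z + ζ • V)
      (by simpa using hg j z hzU) hline) (by simpa using hG0) hδ
  set γ : ℂ → Cn n × (Fin p → Cn n) := fun ζ ↦ (z + ζ • V, fun i ↦ ξ i + ζ • b i) with hγ
  have hγ0 : γ 0 = (z, ξ) := by simp [hγ]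
  -- `κ` collects the harmonic parts of the energy and of the Gaussian exponent, less that of the
  -- lower support `L` of `G ^ δ`.
  set κ : ℂ → ℂ := fun ζ ↦ ∑ i, K i ζ + (2 * ε : ℝ) * (ζ * inner ℂ (z - z₀) V) - L ζ with hκ
  have hκan : AnalyticAt ℂ κ 0 :=
    ((Finset.analyticAt_fun_sum _ fun i _ ↦ hK i).add (by fun_prop)).sub hL
  refine H.logPSH γ (hline.prod (AnalyticAt.pi fun i ↦ by fun_prop))
    (by rw [hγ0]; exact ⟨⟨hzΩ, hzZ⟩, mem_univ _⟩) (by rw [hγ0]; exact hm) κ hκan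
    (by simp [hκ, hK0, hL0]) (r / 2) (by positivity) ?_
  have hmax' : ∀ᶠ ζ : ℂ in 𝓝 0, ∀ ξ', penalized c m (fun z ↦ ∑ j, ‖g j z‖ ^ 2) z₀ ε δ
      (z + ζ • V) ξ' ≤ penalized c m (fun z ↦ ∑ j, ‖g j z‖ ^ 2) z₀ ε δ z ξ := by
    refine hline.continuousAt.eventually (p := fun z' ↦ ∀ ξ', penalized c m
      (fun z ↦ ∑ j, ‖g j z‖ ^ 2) z₀ ε δ z' ξ' ≤ _) ?_
    simpa using hmax
  filter_upwards [hLle, hmax', eventually_all.2 hKle] with ζ h1 h2 h3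
  rw [hγ0]
  have h4 := h2 (fun i ↦ ξ i + ζ • b i)
  simp only [zero_smul, add_zero] at h1
  set G0 := (∑ j, ‖g j z‖ ^ 2) ^ δ with hG0def
  have hG0pos : 0 < G0 := Real.rpow_pos_of_pos hG0 _
  set E0 := energy c z ξ with hE0
  set E1 := energy c (z + ζ • V) (fun i ↦ ξ i + ζ • b i) with hE1
  set m1 := m (z + ζ • V) (fun i ↦ ξ i + ζ • b i) with hm1
  have h5 : m1 * Real.exp (-(E1 + ε * ‖z + ζ • V - z₀‖ ^ 2 - (L ζ).re)) ≤
      m z ξ * Real.exp (-(E0 + ε * ‖z - z₀‖ ^ 2)) := by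
    refine le_of_mul_le_mul_right ?_ hG0pos
    calc _ = m1 * Real.exp (-E1 - ε * ‖z + ζ • V - z₀‖ ^ 2) * (G0 * Real.exp (L ζ).re) := by
          rw [show -(E1 + ε * ‖z + ζ • V - z₀‖ ^ 2 - (L ζ).re) =
            (-E1 - ε * ‖z + ζ • V - z₀‖ ^ 2) + (L ζ).re by ring, Real.exp_add]
          ring
      _ ≤ _ := mul_le_mul_of_nonneg_left h1 (mul_nonneg (H.nonneg _ _) (Real.exp_pos _).le)
      _ ≤ _ := h4
      _ = _ := by
          rw [penalized]
          congr 3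
          ring
  have h6 := exp_neg_mul_exp_neg_le h5
  refine h6.trans (mul_le_mul_of_nonneg_left (Real.exp_le_exp.2 ?_) hm.le)
  have h7 : ‖z + ζ • V - z₀‖ ^ 2 = ‖z - z₀‖ ^ 2 + 2 * (ζ * inner ℂ (z - z₀) V).re +
      ‖ζ‖ ^ 2 * ‖V‖ ^ 2 := by
    rw [add_sub_right_comm, norm_add_sq (𝕜 := ℂ), inner_smul_right, norm_smul, mul_pow]
    rfl
  have h8 : E1 ≤ E0 + ∑ i, (K i ζ).re +
      (-∑ i, (coeffCurvature c z V (ξ i)).re + r / 2) * ‖ζ‖ ^ 2 := by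
    have h9 : E1 ≤ ∑ i, ((coeffForm c z (ξ i) (ξ i)).re + (K i ζ).re +
        ((-coeffCurvature c z V (ξ i)).re + r / (2 * (p + 1))) * ‖ζ‖ ^ 2) := by
      refine Finset.sum_le_sum fun i _ ↦ ?_
      have := h3 i
      simpa only [coeffForm, coeffCurvature, PiLp.add_apply, PiLp.smul_apply, smul_eq_mul]
        using this
    refine h9.trans ?_
    simp only [Finset.sum_add_distrib, ← Finset.sum_mul, Complex.neg_re, Finset.sum_neg_distrib,
      Finset.sum_const, Finset.card_univ, Fintype.card_fin, nsmul_eq_mul]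
    rw [hE0, energy]
    have h10 : p * (r / (2 * (p + 1))) ≤ r / 2 := by
      rw [mul_div_assoc', div_le_div_iff₀ (by positivity) (by positivity)]
      nlinarith
    gcongr
  have h11 : (κ ζ).re = ∑ i, (K i ζ).re + 2 * ε * (ζ * inner ℂ (z - z₀) V).re - (L ζ).re := by
    simp only [hκ, Complex.sub_re, Complex.add_re, Complex.re_sum, Complex.re_ofReal_mul]
  rw [h11, h7]
  rw [hr] at h8 ⊢
  nlinarith [h8]

/-- At an extremal point there are `p` orthonormal vectors whose curvature sum is non-positive in
every direction. -/
theorem exists_unitary_curvature_le (H : IsExtremalAt Ω Z c m M z₀) (hp : 1 ≤ p) :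
    ∃ ξ : Fin p → Cn n, (∀ i j, coeffForm c z₀ (ξ i) (ξ j) = if i = j then 1 else 0) ∧
      ∀ V, ∑ i, (coeffCurvature c z₀ V (ξ i)).re ≤ 0 := by
  obtain ⟨U, hU, hzU, hUΩ, k, g, hg, hZU⟩ := H.analytic
  obtain ⟨ρ, hρ, hρU⟩ := Metric.nhds_basis_closedBall.mem_iff.1 (hU.mem_nhds hzU)
  -- Radius and penalty shrink together: the maximizers tend to `z₀`, the curvature error tends to
  -- zero, and unitarity keeps the tuples in a compact set.
  have hstep : ∀ N : ℕ, ∃ z ∈ Metric.ball z₀ (ρ / (N + 1)), ∃ ξ : Fin p → Cn n,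
      (∀ i j, coeffForm c z (ξ i) (ξ j) = if i = j then 1 else 0) ∧
      ∀ V, ∑ i, (coeffCurvature c z V (ξ i)).re ≤ 1 / (N + 1) * ‖V‖ ^ 2 := by
    intro N
    have hρN : ρ / (N + 1) ≤ ρ := div_le_self hρ.le (by linarith [Nat.cast_nonneg (α := ℝ) N])
    obtain ⟨δ, hδ, z, hz, ξ, hpos, hmax⟩ := H.exists_penalized_max hp hUΩ hg hZU
      (ρ := ρ / (N + 1)) (ε := 1 / (N + 1)) (by positivity) (by positivity)
      ((Metric.closedBall_subset_closedBall hρN).trans hρU)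
    have hzU' : z ∈ U := hρU (Metric.closedBall_subset_closedBall hρN
      (Metric.ball_subset_closedBall hz))
    refine ⟨z, hz, ξ, H.unitary_of_penalized_max (hUΩ hzU') (by positivity) hpos
      (hmax z (Metric.ball_subset_closedBall hz)), ?_⟩
    refine H.curvature_le_of_penalized_max hUΩ hg hZU hδ hzU' hpos ?_
    filter_upwards [Metric.isOpen_ball.mem_nhds hz] with z' hz'
    exact hmax z' (Metric.ball_subset_closedBall hz')
  choose z hz ξ hunit hcurv using hstep
  have hzlim : Tendsto z atTop (𝓝 z₀) := by
    rw [tendsto_iff_norm_sub_tendsto_zero]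
    refine squeeze_zero (fun _ ↦ norm_nonneg _) (fun N ↦ (mem_ball_iff_norm.1 (hz N)).le) ?_
    have := (tendsto_one_div_add_atTop_nhds_zero_nat (𝕜 := ℝ)).const_mul ρ
    simpa [div_eq_mul_inv] using this
  have hzB : ∀ N, z N ∈ Metric.closedBall z₀ ρ := fun N ↦ by
    have hρN : ρ / (N + 1) ≤ ρ := div_le_self hρ.le (by linarith [Nat.cast_nonneg (α := ℝ) N])
    exact Metric.closedBall_subset_closedBall hρN (Metric.ball_subset_closedBall (hz N))
  obtain ⟨a, ha, hale⟩ := exists_mul_norm_sq_le_coeffForm (isCompact_closedBall z₀ ρ)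
    (fun k l ↦ (H.smooth k l).continuousOn.mono (hρU.trans hUΩ))
    (fun z hz ↦ H.pos z (hUΩ (hρU hz)))
  have hξB : ∀ N, ξ N ∈ Metric.closedBall (0 : Fin p → Cn n) (1 / a + 1) := by
    intro N
    have ha' : 0 < 1 / a := by positivity
    rw [mem_closedBall_zero_iff, pi_norm_le_iff_of_nonneg (by positivity)]
    intro i
    have h1 := hale _ (hzB N) (ξ N i)
    rw [hunit, if_pos rfl, Complex.one_re, mul_comm, ← le_div_iff₀ ha] at h1
    refine abs_le_of_sq_le_sq' (h1.trans ?_) (by positivity) |>.2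
    nlinarith
  obtain ⟨ξ₀, -, φ, hφ, hlim⟩ := (isCompact_closedBall (0 : Fin p → Cn n) _).tendsto_subseq hξB
  have hzφ : Tendsto (z ∘ φ) atTop (𝓝 z₀) := hzlim.comp hφ.tendsto_atTop
  have hsm : ∀ k l, ContDiffAt ℝ ∞ (c k l) z₀ := fun k l ↦
    (H.smooth k l).contDiffAt (H.isOpen.mem_nhds H.mem)
  have hξφ : ∀ i, Tendsto (fun N ↦ ξ (φ N) i) atTop (𝓝 (ξ₀ i)) := fun i ↦
    ((continuous_apply i).tendsto ξ₀).comp hlim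
  have hcoord : ∀ i k, Tendsto (fun N ↦ ξ (φ N) i k) atTop (𝓝 (ξ₀ i k)) := fun i k ↦ by
    have : Continuous fun u : Cn n ↦ u k := by fun_prop
    exact (this.tendsto _).comp (hξφ i)
  refine ⟨ξ₀, fun i j ↦ ?_, fun V ↦ ?_⟩
  · have hck : ∀ k l, Tendsto (fun N ↦ c k l (z (φ N))) atTop (𝓝 (c k l z₀)) := fun k l ↦
      (hsm k l).continuousAt.tendsto.comp hzφ
    have hconj : ∀ l, Tendsto (fun N ↦ (conj (ξ (φ N) j l) : ℂ)) atTop (𝓝 (conj (ξ₀ j l))) :=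
      fun l ↦ (Complex.continuous_conj.tendsto (ξ₀ j l)).comp (hcoord j l)
    have h1 : Tendsto (fun N ↦ coeffForm c (z (φ N)) (ξ (φ N) i) (ξ (φ N) j)) atTop
        (𝓝 (coeffForm c z₀ (ξ₀ i) (ξ₀ j))) := by
      unfold coeffForm
      exact tendsto_finsetSum _ fun k _ ↦ tendsto_finsetSum _ fun l _ ↦
        ((hck k l).mul (hcoord i k)).mul (hconj l)
    have h2 : (fun N ↦ coeffForm c (z (φ N)) (ξ (φ N) i) (ξ (φ N) j)) =
        fun _ ↦ if i = j then 1 else 0 := funext fun N ↦ hunit (φ N) i j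
    rw [h2] at h1
    exact (tendsto_nhds_unique tendsto_const_nhds h1).symm
  · have h1 : Tendsto (fun N ↦ ∑ i, (coeffCurvature c (z (φ N)) V (ξ (φ N) i)).re) atTop
        (𝓝 (∑ i, (coeffCurvature c z₀ V (ξ₀ i)).re)) := by
      refine tendsto_finsetSum _ fun i _ ↦ ?_
      have h2 : Tendsto (fun N ↦ (z (φ N), ξ (φ N) i)) atTop (𝓝 (z₀, ξ₀ i)) :=
        Tendsto.prodMk_nhds hzφ (hξφ i)
      have h3 := (continuousAt_coeffCurvature hsm (isUnit_det_of_pos (H.pos z₀ H.mem)) V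
        (ξ₀ i)).tendsto.comp h2
      exact (Complex.continuous_re.tendsto _).comp h3
    have h2 : Tendsto (fun N ↦ 1 / ((φ N : ℝ) + 1) * ‖V‖ ^ 2) atTop (𝓝 0) := by
      have := ((tendsto_one_div_add_atTop_nhds_zero_nat (𝕜 := ℝ)).comp
        hφ.tendsto_atTop).mul_const (‖V‖ ^ 2)
      simpa using this
    exact le_of_tendsto_of_tendsto' h1 h2 fun N ↦ hcurv (φ N) V

end IsExtremalAt

end Extremal

/-! ### Determinants and computations in charts -/

section Det

variable {p : ℕ}

/-- The determinant of `p` vectors in `ℂᵖ`. -/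
noncomputable def stdDet (v : Fin p → Cn p) : ℂ := (Matrix.of fun i j ↦ v i j).det

lemma stdDet_map (A : Cn p →L[ℂ] Cn p) (v : Fin p → Cn p) :
    stdDet (fun i ↦ A (v i)) = A.det * stdDet v := by
  have key : ∀ w : Fin p → Cn p,
      stdDet w = (EuclideanSpace.basisFun (Fin p) ℂ).toBasis.det w := by
    intro w
    rw [Module.Basis.det_apply, stdDet, ← Matrix.det_transpose]
    congr 1
  rw [key, key]
  exact Module.Basis.det_comp _ (A : Cn p →ₗ[ℂ] Cn p) v

lemma stdDet_sum (A : Matrix (Fin p) (Fin p) ℂ) (v : Fin p → Cn p) :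
    stdDet (fun i ↦ ∑ j, A i j • v j) = A.det * stdDet v := by
  rw [stdDet, stdDet, ← Matrix.det_mul]
  congr 1
  ext i j
  simp [Matrix.mul_apply]

lemma stdDet_single : stdDet (fun i : Fin p ↦ (EuclideanSpace.single i (1 : ℂ) : Cn p)) = 1 := by
  rw [stdDet, ← Matrix.det_one (n := Fin p)]
  congr 1
  ext i j
  simp [Matrix.one_apply, eq_comm]

lemma analyticAt_stdDet {E : Type*} [NormedAddCommGroup E] [NormedSpace ℂ E]
    {v : Fin p → E → Cn p} {z : E} (hv : ∀ i, AnalyticAt ℂ (v i) z) :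
    AnalyticAt ℂ (fun y ↦ stdDet fun i ↦ v i y) z := by
  refine analyticAt_matrix_det fun i j ↦ ?_
  exact ((EuclideanSpace.proj j : Cn p →L[ℂ] ℂ).analyticAt _).comp (hv i)

end Det

section Coordinates

variable {n p : ℕ} {X : Type*} [TopologicalSpace X] [ChartedSpace (Cn n) X]
  {Y : Type*} [TopologicalSpace Y] [ChartedSpace (Cn p) Y]

lemma ContMDiffOn.analyticOnNhd_comp_symm {E : Type*} [NormedAddCommGroup E] [NormedSpace ℂ E]
    [IsManifold 𝓘(ℂ, Cn n) ω X] {g : X → E} {U : Set X} (hU : IsOpen U)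
    (hg : ContMDiffOn 𝓘(ℂ, Cn n) 𝓘(ℂ, E) ω g U) {e : OpenPartialHomeomorph X (Cn n)}
    (he : e ∈ atlas (Cn n) X) :
    AnalyticOnNhd ℂ (g ∘ e.symm) (e.target ∩ e.symm ⁻¹' U) := by
  have h1 := contMDiffOn_symm_of_mem_maximalAtlas
    (IsManifold.subset_maximalAtlas (I := 𝓘(ℂ, Cn n)) (n := ω) he)
  have h2 : ContMDiffOn 𝓘(ℂ, Cn n) 𝓘(ℂ, E) ω (g ∘ e.symm) (e.target ∩ e.symm ⁻¹' U) :=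
    hg.comp (h1.mono inter_subset_left) inter_subset_right
  exact (e.isOpen_inter_preimage_symm hU).analyticOn_iff_analyticOnNhd.1
    (contMDiffOn_iff_contDiffOn.1 h2).analyticOn

lemma AnalyticOnNhd.contMDiffOn_comp {E : Type*} [NormedAddCommGroup E] [NormedSpace ℂ E]
    [IsManifold 𝓘(ℂ, Cn n) ω X] {g : Cn n → E} {V : Set (Cn n)} (hV : IsOpen V)
    (hg : AnalyticOnNhd ℂ g V) {e : OpenPartialHomeomorph X (Cn n)} (he : e ∈ atlas (Cn n) X) :
    ContMDiffOn 𝓘(ℂ, Cn n) 𝓘(ℂ, E) ω (g ∘ e) (e.source ∩ e ⁻¹' V) := by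
  have h1 := contMDiffOn_of_mem_maximalAtlas
    (IsManifold.subset_maximalAtlas (I := 𝓘(ℂ, Cn n)) (n := ω) he)
  exact (contMDiffOn_iff_contDiffOn.2 (hg.contDiffOn hV.uniqueDiffOn)).comp
    (h1.mono inter_subset_left) inter_subset_right

lemma IsAnalyticSubset.isClosed {A : Set X} (hA : IsAnalyticSubset 𝓘(ℂ, Cn n) A) :
    IsClosed A := by
  rw [← isOpen_compl_iff, isOpen_iff_mem_nhds]
  intro x hx
  obtain ⟨U, hU, hxU, k, F, hF, hAU⟩ := hA x
  have h1 : ∃ i, F i x ≠ 0 := by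
    by_contra! h
    have : x ∈ A ∩ U := by rw [hAU]; exact ⟨hxU, h⟩
    exact hx this.1
  obtain ⟨i, hi⟩ := h1
  filter_upwards [((hF i).continuousOn.continuousAt (hU.mem_nhds hxU)).eventually_ne hi,
    hU.mem_nhds hxU] with y hy hyU hyA
  have : y ∈ A ∩ U := ⟨hyA, hyU⟩
  rw [hAU] at this
  exact hy (this.2 i)

lemma IsAnalyticSubset.exists_analytic_in_chart [IsManifold 𝓘(ℂ, Cn n) ω X] {A : Set X}
    (hA : IsAnalyticSubset 𝓘(ℂ, Cn n) A) {e : OpenPartialHomeomorph X (Cn n)}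
    (he : e ∈ atlas (Cn n) X) {z : Cn n} (hz : z ∈ e.target) :
    ∃ U : Set (Cn n), IsOpen U ∧ z ∈ U ∧ U ⊆ e.target ∧ ∃ (k : ℕ) (g : Fin k → Cn n → ℂ),
      (∀ j, AnalyticOnNhd ℂ (g j) U) ∧ e.symm ⁻¹' A ∩ U = {y ∈ U | ∀ j, g j y = 0} := by
  obtain ⟨U, hU, hzU, k, F, hF, hAU⟩ := hA (e.symm z)
  refine ⟨e.target ∩ e.symm ⁻¹' U, e.isOpen_inter_preimage_symm hU, ⟨hz, hzU⟩,
    inter_subset_left, k, fun j ↦ F j ∘ e.symm,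
    fun j ↦ ContMDiffOn.analyticOnNhd_comp_symm hU (hF j) he, ?_⟩
  ext y
  have h1 : e.symm y ∈ A ∩ U ↔ e.symm y ∈ U ∧ ∀ i, F i (e.symm y) = 0 := by rw [hAU]; rfl
  simp only [mem_inter_iff, mem_preimage, mem_ofPred_eq, Function.comp] at h1 ⊢
  tauto

lemma HasCodimAtLeastTwo.not_subset_in_chart [IsManifold 𝓘(ℂ, Cn n) ω X] {A : Set X}
    (hA : HasCodimAtLeastTwo 𝓘(ℂ, Cn n) A) {e : OpenPartialHomeomorph X (Cn n)}
    (he : e ∈ atlas (Cn n) X) {V : Set (Cn n)} (hVe : V ⊆ e.target) (hV : IsOpen V)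
    {g : Cn n → ℂ} (hg : AnalyticOnNhd ℂ g V) (hne : ∃ y ∈ V, g y = 0) :
    ¬ {y ∈ V | g y = 0} ⊆ e.symm ⁻¹' A := by
  intro hsub
  obtain ⟨y, hyV, hy⟩ := hne
  refine hA (e.source ∩ e ⁻¹' V) (g ∘ e) (e.isOpen_inter_preimage hV)
    (AnalyticOnNhd.contMDiffOn_comp hV hg he) ⟨e.symm y, ⟨e.map_target (hVe hyV), ?_⟩, ?_⟩ ?_
  · rwa [mem_preimage, e.right_inv (hVe hyV)]
  · rwa [Function.comp, e.right_inv (hVe hyV)]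
  · rintro x ⟨⟨hx, hxV⟩, hgx⟩
    have := hsub ⟨hxV, hgx⟩
    rwa [mem_preimage, e.left_inv hx] at this

variable (n p) in
/-- The derivative of a map of complex manifolds, as a map between the model spaces. -/
noncomputable def derivAt (f : X → Y) (x : X) : Cn n →L[ℂ] Cn p :=
  mfderiv 𝓘(ℂ, Cn n) 𝓘(ℂ, Cn p) f x

lemma derivAt_symm_comp_derivAt [IsManifold 𝓘(ℂ, Cn n) ω X]
    {e : OpenPartialHomeomorph X (Cn n)} (he : e ∈ atlas (Cn n) X) {z : Cn n} (hz : z ∈ e.target)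
    (u : Cn n) : derivAt n n e.symm z (derivAt n n e (e.symm z) u) = u := by
  have h1 := (mdifferentiable_of_mem_atlas (I := 𝓘(ℂ, Cn n)) he).symm_comp_deriv (e.map_target hz)
  rw [e.right_inv hz] at h1
  exact DFunLike.congr_fun h1 u

lemma derivAt_comp_derivAt_symm [IsManifold 𝓘(ℂ, Cn n) ω X]
    {e : OpenPartialHomeomorph X (Cn n)} (he : e ∈ atlas (Cn n) X) {z : Cn n} (hz : z ∈ e.target)
    (u : Cn n) : derivAt n n e (e.symm z) (derivAt n n e.symm z u) = u :=
  DFunLike.congr_fun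
    ((mdifferentiable_of_mem_atlas (I := 𝓘(ℂ, Cn n)) he).comp_symm_deriv hz) u

/-- The tangent space at `y` is identified with the model space through the preferred chart at `y`,
which is why `achart (Cn p) y` appears. -/
lemma derivAt_chart_eq_coordChange [IsManifold 𝓘(ℂ, Cn p) ω Y] (w : atlas (Cn p) Y) {y : Y}
    (hy : y ∈ w.1.source) :
    derivAt p p (w.1 : Y → Cn p) y =
      (tangentBundleCore 𝓘(ℂ, Cn p) Y).coordChange (achart (Cn p) y) w y := by
  rw [tangentBundleCore_coordChange, derivAt,
    ((mdifferentiable_of_mem_atlas (I := 𝓘(ℂ, Cn p)) w.2).mdifferentiableAt hy).mfderiv]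
  rfl

lemma fderiv_in_charts [IsManifold 𝓘(ℂ, Cn n) ω X] [IsManifold 𝓘(ℂ, Cn p) ω Y]
    {f : X → Y} {e : OpenPartialHomeomorph X (Cn n)} (he : e ∈ atlas (Cn n) X)
    {w : OpenPartialHomeomorph Y (Cn p)} (hw : w ∈ atlas (Cn p) Y) {z : Cn n} (hz : z ∈ e.target)
    (hf : MDifferentiableAt 𝓘(ℂ, Cn n) 𝓘(ℂ, Cn p) f (e.symm z))
    (hfw : f (e.symm z) ∈ w.source) (u : Cn n) :
    fderiv ℂ (fun z ↦ w (f (e.symm z))) z u =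
      derivAt p p w (f (e.symm z)) (derivAt n p f (e.symm z) (derivAt n n e.symm z u)) := by
  have h1 : MDifferentiableAt 𝓘(ℂ, Cn n) 𝓘(ℂ, Cn n) e.symm z :=
    (mdifferentiable_of_mem_atlas (I := 𝓘(ℂ, Cn n)) he).symm.mdifferentiableAt hz
  have h2 : MDifferentiableAt 𝓘(ℂ, Cn p) 𝓘(ℂ, Cn p) w (f (e.symm z)) :=
    (mdifferentiable_of_mem_atlas (I := 𝓘(ℂ, Cn p)) hw).mdifferentiableAt hfw
  have h3 := mfderiv_comp (I := 𝓘(ℂ, Cn n)) (I' := 𝓘(ℂ, Cn n)) (I'' := 𝓘(ℂ, Cn p)) z hf h1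
  have h4 := mfderiv_comp (I := 𝓘(ℂ, Cn n)) (I' := 𝓘(ℂ, Cn p)) (I'' := 𝓘(ℂ, Cn p)) z
    (f := f ∘ e.symm) h2 (hf.comp z h1)
  rw [h3, mfderiv_eq_fderiv] at h4
  exact DFunLike.congr_fun h4 u

lemma analyticOnNhd_in_charts [IsManifold 𝓘(ℂ, Cn n) ω X] [IsManifold 𝓘(ℂ, Cn p) ω Y]
    {f : X → Y} {U : Set X} (hU : IsOpen U) (hf : ContMDiffOn 𝓘(ℂ, Cn n) 𝓘(ℂ, Cn p) ω f U)
    {e : OpenPartialHomeomorph X (Cn n)} (he : e ∈ atlas (Cn n) X)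
    {w : OpenPartialHomeomorph Y (Cn p)} (hw : w ∈ atlas (Cn p) Y) :
    AnalyticOnNhd ℂ (fun z ↦ w (f (e.symm z)))
      (e.target ∩ e.symm ⁻¹' (U ∩ f ⁻¹' w.source)) := by
  have h1 := contMDiffOn_of_mem_maximalAtlas
    (IsManifold.subset_maximalAtlas (I := 𝓘(ℂ, Cn p)) (n := ω) hw)
  exact ContMDiffOn.analyticOnNhd_comp_symm (hf.continuousOn.isOpen_inter_preimage hU w.open_source)
    (h1.comp (hf.mono inter_subset_left) inter_subset_right) he

end Coordinates

lemma expWeight_eq_mul_of_eq_add_log {α : Type*} {u v : α → EReal} {y : α} {d : ℂ} (hd : d ≠ 0)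
    (h : u y = v y + ((Real.log (‖d‖ ^ 2) : ℝ) : EReal)) :
    expWeight u y = expWeight v y * ‖d‖ ^ 2 := by
  have h1 : 0 < ‖d‖ ^ 2 := by positivity
  rw [expWeight, h, EReal.exp_add, ENNReal.toReal_mul, EReal.exp_coe, Real.exp_log h1,
    ENNReal.toReal_ofReal h1.le, expWeight]

lemma IsLogPSH.of_locally {E : Type*} [NormedAddCommGroup E] [NormedSpace ℂ E] {m : E → ℝ}
    {Ω : Set E} (h : ∀ z ∈ Ω, ∃ (N : Set E) (m' : E → ℝ), IsOpen N ∧ z ∈ N ∧ IsLogPSH m' N ∧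
      EqOn m m' N) : IsLogPSH m Ω := by
  intro γ hγ h0 hpos K hK hK0 c hc hle
  obtain ⟨N, m', hN, hzN, hm', heq⟩ := h _ h0
  refine hm' γ hγ hzN (by rwa [← heq hzN]) K hK hK0 c hc ?_
  filter_upwards [hle, hγ.continuousAt.eventually_mem (hN.mem_nhds hzN)] with ζ h1 h2
  rwa [← heq h2, ← heq hzN]

/-- The vectors `ξ` of the unit ball become the index of the family. Off `Z`, joint semicontinuity
and compactness of the ball give a bound uniform in `ξ`, and the codimension-two theorem extends it
across `Z`. -/
lemma exists_local_bound_prod {E E' : Type*} [NormedAddCommGroup E] [NormedSpace ℂ E]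
    [FiniteDimensional ℂ E] [NormedAddCommGroup E'] [NormedSpace ℂ E'] [FiniteDimensional ℂ E']
    {μ : E → E' → ℝ} {Ω Z : Set E}
    (hZ : ∀ z ∈ Ω, ∃ U : Set E, IsOpen U ∧ z ∈ U ∧ U ⊆ Ω ∧ ∃ (k : ℕ) (g : Fin k → E → ℂ),
      (∀ j, AnalyticOnNhd ℂ (g j) U) ∧ Z ∩ U = {y ∈ U | ∀ j, g j y = 0})
    (hcodim : ∀ V ⊆ Ω, IsOpen V → ∀ g : E → ℂ, AnalyticOnNhd ℂ g V → (∃ y ∈ V, g y = 0) →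
      ¬ {y ∈ V | g y = 0} ⊆ Z)
    (hμ0 : ∀ z ξ, 0 ≤ μ z ξ)
    (hpsh : IsLogPSH (fun q : E × E' ↦ μ q.1 q.2) ((Ω \ Z) ×ˢ univ))
    (husc : ∀ z ∈ Ω \ Z, ∀ ξ, UpperSemicontinuousAt (fun q : E × E' ↦ μ q.1 q.2) (z, ξ)) :
    ∀ z ∈ Ω, ∃ C : ℝ, ∀ᶠ y in 𝓝 z, y ∉ Z → ∀ ξ, ‖ξ‖ ≤ 1 → μ y ξ ≤ C := by
  have := FiniteDimensional.proper ℂ E'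
  have hsl : ∀ a : E', IsLogPSH (fun z ↦ μ z a) (Ω \ Z) := by
    intro a
    have h1 : AnalyticOnNhd ℂ (fun z : E ↦ (z, a)) (Ω \ Z) :=
      fun z _ ↦ analyticAt_id.prod analyticAt_const
    exact hpsh.comp h1 fun z hz ↦ ⟨hz, mem_univ _⟩
  have husl : ∀ a : E', ∀ z ∈ Ω \ Z, UpperSemicontinuousAt (fun z ↦ μ z a) z := by
    intro a z hz y hy
    have h1 : Tendsto (fun z : E ↦ (z, a)) (𝓝 z) (𝓝 (z, a)) :=
      (continuous_id.prodMk continuous_const).tendsto z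
    have h2 : ∀ᶠ q : E × E' in 𝓝 (z, a), μ q.1 q.2 < y := husc z hz a y hy
    exact h1.eventually h2
  have hoff : ∀ z ∈ Ω \ Z, ∃ C : ℝ, ∀ᶠ y in 𝓝 z, ∀ ξ ∈ Metric.closedBall (0 : E') 1,
      μ y ξ < C := by
    intro z hz
    have h1 : UpperSemicontinuousOn (μ z) (Metric.closedBall 0 1) := by
      intro ξ _ y hy
      have h2 : Tendsto (fun ξ : E' ↦ (z, ξ)) (𝓝 ξ) (𝓝 (z, ξ)) :=
        (continuous_const.prodMk continuous_id).tendsto ξ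
      have h3 : ∀ᶠ q : E × E' in 𝓝 (z, ξ), μ q.1 q.2 < y := husc z hz ξ y hy
      exact (h2.eventually h3).filter_mono nhdsWithin_le_nhds
    obtain ⟨C, hC⟩ := h1.bddAbove_of_isCompact (isCompact_closedBall _ _)
    refine ⟨C + 1, ?_⟩
    refine (isCompact_closedBall _ _).eventually_forall_of_forall_eventually fun ξ hξ ↦ ?_
    refine husc z hz ξ _ ?_
    have := hC (mem_image_of_mem _ hξ)
    exact this.trans_lt (lt_add_one C)
  intro z hz
  obtain ⟨C, hC⟩ := exists_local_bound_of_codim_two (ι := Metric.closedBall (0 : E') 1)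
    (m := fun a z ↦ μ z a) hZ hcodim (fun a z ↦ hμ0 z a) (fun a ↦ hsl a)
    (fun a z hz ↦ husl a z hz)
    (fun z hz ↦ by
      obtain ⟨C, hC⟩ := hoff z hz
      exact ⟨C, hC.mono fun y hy _ a ↦ (hy a a.2).le⟩) z hz
  refine ⟨C, ?_⟩
  filter_upwards [hC] with y hy hyZ ξ hξ
  exact hy hyZ ⟨ξ, mem_closedBall_zero_iff.2 hξ⟩

/-! ### The weight pulled back to the tangent bundle of `X` -/

section Weight

variable {n p : ℕ} {X : Type*} [TopologicalSpace X] [ChartedSpace (Cn n) X]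
  {Y : Type*} [TopologicalSpace Y] [ChartedSpace (Cn p) Y]

/-- The squared length, with respect to the metric on the anticanonical bundle with weight `-φ`, of
the image under `f` of the `p`-vector `ξ 1 ∧ ⋯ ∧ ξ p`. -/
noncomputable def jacWeight (φ : atlas (Cn p) Y → Y → EReal) (f : X → Y) (x : X)
    (ξ : Fin p → Cn n) : ℝ :=
  ‖stdDet fun i ↦ derivAt n p f x (ξ i)‖ ^ 2 * expWeight (φ (achart (Cn p) (f x))) (f x)

/-- `jacWeight` in the coordinates given by the chart `e`. -/
noncomputable def localJacWeight (φ : atlas (Cn p) Y → Y → EReal) (f : X → Y)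
    (e : OpenPartialHomeomorph X (Cn n)) (z : Cn n) (ξ : Fin p → Cn n) : ℝ :=
  jacWeight φ f (e.symm z) fun i ↦ derivAt n n e.symm z (ξ i)

variable {φ : atlas (Cn p) Y → Y → EReal} {f : X → Y}

lemma jacWeight_nonneg (x : X) (ξ : Fin p → Cn n) : 0 ≤ jacWeight φ f x ξ :=
  mul_nonneg (sq_nonneg _) (expWeight_nonneg _ _)

lemma localJacWeight_sum (e : OpenPartialHomeomorph X (Cn n)) (z : Cn n) (ξ : Fin p → Cn n)
    (A : Matrix (Fin p) (Fin p) ℂ) :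
    localJacWeight φ f e z (fun i ↦ ∑ j, A i j • ξ j) =
      ‖A.det‖ ^ 2 * localJacWeight φ f e z ξ := by
  simp only [localJacWeight, jacWeight, map_sum, map_smul, stdDet_sum, norm_mul, mul_pow, mul_assoc]

variable {Z : Set X}

/-- The open set on which `f` is given by a map between open subsets of `ℂⁿ` and `ℂᵖ`. -/
lemma isOpen_chart_domain (hZ : IsClosed Z) (hf : ContMDiffOn 𝓘(ℂ, Cn n) 𝓘(ℂ, Cn p) ω f Zᶜ)
    (e : OpenPartialHomeomorph X (Cn n)) (w : OpenPartialHomeomorph Y (Cn p)) :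
    IsOpen (e.target ∩ e.symm ⁻¹' (Zᶜ ∩ f ⁻¹' w.source)) :=
  e.isOpen_inter_preimage_symm (hf.continuousOn.isOpen_inter_preimage hZ.isOpen_compl w.open_source)

variable [IsManifold 𝓘(ℂ, Cn p) ω Y]

/-- `φ` is the family of weights of a singular Hermitian metric with semi-positive curvature
on the canonical bundle. -/
structure IsCanonicalWeight (φ : atlas (Cn p) Y → Y → EReal) : Prop where
  psh : ∀ w, IsPSHOnManifold p (φ w) ((canonicalBundle p Y).baseSet w)
  exists_ne_bot : ∀ w, ∀ V ⊆ (canonicalBundle p Y).baseSet w, IsOpen V → V.Nonempty →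
    ∃ y ∈ V, φ w y ≠ ⊥
  eq_add_log : ∀ w w', ∀ y ∈ (canonicalBundle p Y).baseSet w ∩ (canonicalBundle p Y).baseSet w',
    φ w' y = φ w y + ((Real.log (‖(canonicalBundle p Y).coordChange w w' y 1‖ ^ 2) : ℝ) : EReal)

/-- The transition rule for weights compensates the Jacobian of the chart change, so `jacWeight`,
written in the preferred chart at `f x`, may be computed in any fixed chart of `Y`. -/
lemma IsCanonicalWeight.expWeight_achart (hφ : IsCanonicalWeight φ) (w : atlas (Cn p) Y) {y : Y}
    (hy : y ∈ w.1.source) :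
    expWeight (φ (achart (Cn p) y)) y = ‖(derivAt p p (w.1 : Y → Cn p) y).det‖ ^ 2 *
      expWeight (φ w) y := by
  set T := tangentBundleCore 𝓘(ℂ, Cn p) Y with hT
  set a := achart (Cn p) y with ha
  have hya : y ∈ a.1.source := mem_chart_source _ y
  have h1 : (T.coordChange a w y).det * (T.coordChange w a y).det = 1 := by
    have h2 : (T.coordChange a w y).comp (T.coordChange w a y) = ContinuousLinearMap.id ℂ _ := by
      ext1 v
      rw [ContinuousLinearMap.comp_apply, T.coordChange_comp w a w y ⟨⟨hy, hya⟩, hy⟩,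
        T.coordChange_self w y hy]
      rfl
    have h3 := congrArg (fun A : Cn p →L[ℂ] Cn p ↦ A.det) h2
    simpa [ContinuousLinearMap.det] using h3
  have hd : (T.coordChange w a y).det ≠ 0 := right_ne_zero_of_mul_eq_one h1
  have h4 := hφ.eq_add_log a w y ⟨hya, hy⟩
  have h5 : (canonicalBundle p Y).coordChange a w y 1 = (T.coordChange w a y).det := by
    simp [canonicalBundle, hT]
  rw [h5] at h4
  rw [expWeight_eq_mul_of_eq_add_log hd h4, derivAt_chart_eq_coordChange w hy, ← hT, ← ha,
    mul_left_comm, ← mul_pow, ← norm_mul, h1]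
  simp

variable [IsManifold 𝓘(ℂ, Cn n) ω X]

lemma IsCanonicalWeight.localJacWeight_eq (hφ : IsCanonicalWeight φ)
    {e : OpenPartialHomeomorph X (Cn n)} (he : e ∈ atlas (Cn n) X) (w : atlas (Cn p) Y) {z : Cn n}
    (hz : z ∈ e.target) (hf : MDifferentiableAt 𝓘(ℂ, Cn n) 𝓘(ℂ, Cn p) f (e.symm z))
    (hfw : f (e.symm z) ∈ w.1.source) (ξ : Fin p → Cn n) :
    localJacWeight φ f e z ξ =
      expWeight (φ w ∘ w.1.symm) (w.1 (f (e.symm z))) *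
        ‖stdDet fun i ↦ fderiv ℂ (fun z ↦ w.1 (f (e.symm z))) z (ξ i)‖ ^ 2 := by
  have h1 : expWeight (φ w ∘ w.1.symm) (w.1 (f (e.symm z))) = expWeight (φ w) (f (e.symm z)) := by
    rw [expWeight, Function.comp, w.1.left_inv hfw, expWeight]
  simp only [fderiv_in_charts he w.2 hz hf hfw]
  rw [h1, stdDet_map, localJacWeight, jacWeight, hφ.expWeight_achart w hfw, norm_mul, mul_pow]
  ring

/-- `F` is `f` in coordinates and `κ` the determinant of its differential on the tuple.
Log-plurisubharmonicity and semicontinuity of the pulled-back weight both follow from this product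
formula; the preferred charts at `f x` in its definition vary with `x`. -/
lemma IsCanonicalWeight.exists_local_repr (hφ : IsCanonicalWeight φ) (hZ : IsClosed Z)
    (hf : ContMDiffOn 𝓘(ℂ, Cn n) 𝓘(ℂ, Cn p) ω f Zᶜ)
    {e : OpenPartialHomeomorph X (Cn n)} (he : e ∈ atlas (Cn n) X) (w : atlas (Cn p) Y) :
    ∃ (F : Cn n → Cn p) (κ : Cn n × (Fin p → Cn n) → ℂ),
      AnalyticOnNhd ℂ F (e.target ∩ e.symm ⁻¹' (Zᶜ ∩ f ⁻¹' w.1.source)) ∧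
      AnalyticOnNhd ℂ κ ((e.target ∩ e.symm ⁻¹' (Zᶜ ∩ f ⁻¹' w.1.source)) ×ˢ univ) ∧
      (∀ z ∈ e.target ∩ e.symm ⁻¹' (Zᶜ ∩ f ⁻¹' w.1.source),
        F z ∈ w.1.target ∩ w.1.symm ⁻¹' w.1.source) ∧
      (∀ z ∈ e.target ∩ e.symm ⁻¹' (Zᶜ ∩ f ⁻¹' w.1.source), ∀ ξ, localJacWeight φ f e z ξ =
        expWeight (φ w ∘ w.1.symm) (F z) * ‖κ (z, ξ)‖ ^ 2) := by
  have hF := analyticOnNhd_in_charts hZ.isOpen_compl hf he w.2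
  refine ⟨fun z ↦ w.1 (f (e.symm z)),
    fun q ↦ stdDet fun i ↦ fderiv ℂ (fun z ↦ w.1 (f (e.symm z))) q.1 (q.2 i), hF, ?_, ?_, ?_⟩
  · intro q hq
    refine analyticAt_stdDet fun i ↦ ?_
    have h1 : AnalyticAt ℂ (fun q : Cn n × (Fin p → Cn n) ↦
        fderiv ℂ (fun z ↦ w.1 (f (e.symm z))) q.1) q :=
      AnalyticAt.comp (f := (Prod.fst : Cn n × (Fin p → Cn n) → Cn n)) (hF.fderiv q.1 hq.1)
        analyticAt_fst
    have h2 : AnalyticAt ℂ (fun q : Cn n × (Fin p → Cn n) ↦ q.2 i) q :=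
      (((ContinuousLinearMap.proj i : (Fin p → Cn n) →L[ℂ] Cn n).comp
        (ContinuousLinearMap.snd ℂ (Cn n) (Fin p → Cn n))).analyticAt q)
    exact ((ContinuousLinearMap.id ℂ (Cn n →L[ℂ] Cn p)).analyticAt_bilinear _).comp (h1.prod h2)
  · rintro z ⟨hz, -, hzw⟩
    have hzw' : f (e.symm z) ∈ w.1.source := hzw
    exact ⟨w.1.map_source hzw', by rwa [mem_preimage, w.1.left_inv hzw']⟩
  · rintro z ⟨hz, hzZ, hzw⟩ ξ
    have hdiff : MDifferentiableAt 𝓘(ℂ, Cn n) 𝓘(ℂ, Cn p) f (e.symm z) :=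
      (hf.contMDiffAt (hZ.isOpen_compl.mem_nhds hzZ)).mdifferentiableAt (by simp)
    exact hφ.localJacWeight_eq he w hz hdiff hzw ξ

lemma IsCanonicalWeight.isLogPSH (hφ : IsCanonicalWeight φ) (hZ : IsClosed Z)
    (hf : ContMDiffOn 𝓘(ℂ, Cn n) 𝓘(ℂ, Cn p) ω f Zᶜ)
    {e : OpenPartialHomeomorph X (Cn n)} (he : e ∈ atlas (Cn n) X) :
    IsLogPSH (fun q : Cn n × (Fin p → Cn n) ↦ localJacWeight φ f e q.1 q.2)
      ((e.target \ e.symm ⁻¹' Z) ×ˢ univ) := by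
  refine IsLogPSH.of_locally fun q hq ↦ ?_
  set w := achart (Cn p) (f (e.symm q.1)) with hw
  obtain ⟨F, κ, hF, hκ, hFw, heq⟩ := hφ.exists_local_repr hZ hf he w
  refine ⟨_, fun q ↦ expWeight (φ w ∘ w.1.symm) (F q.1) * ‖κ q‖ ^ 2,
    (isOpen_chart_domain hZ hf e w.1).prod isOpen_univ,
    ⟨⟨hq.1.1, hq.1.2, mem_chart_source _ _⟩, mem_univ _⟩, ?_, fun q hq ↦ heq q.1 hq.1 q.2⟩
  have h1 := (hφ.psh w w.1 w.2).isLogPSH (w.1.isOpen_inter_preimage_symm w.1.open_source)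
  have h2 : AnalyticOnNhd ℂ (fun q : Cn n × (Fin p → Cn n) ↦ F q.1)
      ((e.target ∩ e.symm ⁻¹' (Zᶜ ∩ f ⁻¹' w.1.source)) ×ˢ univ) := fun q hq ↦
    AnalyticAt.comp (f := (Prod.fst : Cn n × (Fin p → Cn n) → Cn n)) (hF q.1 hq.1) analyticAt_fst
  exact (h1.comp h2 fun q hq ↦ hFw q.1 hq.1).mul_norm_sq (fun _ ↦ expWeight_nonneg _ _) hκ

lemma IsCanonicalWeight.upperSemicontinuousAt (hφ : IsCanonicalWeight φ) (hZ : IsClosed Z)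
    (hf : ContMDiffOn 𝓘(ℂ, Cn n) 𝓘(ℂ, Cn p) ω f Zᶜ)
    {e : OpenPartialHomeomorph X (Cn n)} (he : e ∈ atlas (Cn n) X) {z : Cn n}
    (hz : z ∈ e.target \ e.symm ⁻¹' Z) (ξ : Fin p → Cn n) :
    UpperSemicontinuousAt (fun q : Cn n × (Fin p → Cn n) ↦ localJacWeight φ f e q.1 q.2)
      (z, ξ) := by
  set w := achart (Cn p) (f (e.symm z)) with hw
  obtain ⟨F, κ, hF, hκ, hFw, heq⟩ := hφ.exists_local_repr hZ hf he w
  set N := (e.target ∩ e.symm ⁻¹' (Zᶜ ∩ f ⁻¹' w.1.source)) ×ˢ (univ : Set (Fin p → Cn n))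
  have hN : IsOpen N := (isOpen_chart_domain hZ hf e w.1).prod isOpen_univ
  have hzN : (z, ξ) ∈ N := ⟨⟨hz.1, hz.2, mem_chart_source _ _⟩, mem_univ _⟩
  have hpsh := hφ.psh w w.1 w.2
  have h1 : UpperSemicontinuousWithinAt
      (fun q : Cn n × (Fin p → Cn n) ↦ expWeight (φ w ∘ w.1.symm) (F q.1)) N (z, ξ) := by
    intro y hy
    have h2 := expWeight_upperSemicontinuousWithinAt (hFw z hzN.1) hpsh.lt_top
      (hpsh.usc _ (hFw z hzN.1)) y hy
    have h3 : Tendsto (fun q : Cn n × (Fin p → Cn n) ↦ F q.1) (𝓝[N] (z, ξ))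
        (𝓝[w.1.target ∩ w.1.symm ⁻¹' w.1.source] (F z)) := by
      refine tendsto_nhdsWithin_iff.2 ⟨?_, ?_⟩
      · exact (((hF z hzN.1).continuousAt.tendsto.comp
          (continuous_fst.tendsto (z, ξ))).mono_left nhdsWithin_le_nhds)
      · filter_upwards [self_mem_nhdsWithin] with q hq
        exact hFw q.1 hq.1
    exact h3.eventually h2
  have h2 := upperSemicontinuousWithinAt_mul h1
    ((hκ (z, ξ) hzN).continuousAt.norm.pow 2).continuousWithinAt fun _ _ ↦ sq_nonneg _
  intro y hy
  have hy' : localJacWeight φ f e z ξ < y := hy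
  rw [heq z hzN.1] at hy'
  have h3 : ∀ᶠ q in 𝓝[N] (z, ξ), expWeight (φ w ∘ w.1.symm) (F q.1) * ‖κ q‖ ^ 2 < y := h2 y hy'
  rw [hN.nhdsWithin_eq hzN] at h3
  filter_upwards [h3, hN.mem_nhds hzN] with q hq hqN
  have h4 := heq q.1 hqN.1 q.2
  exact h4.trans_lt hq

/-- `localJacWeight` is locally bounded, also near the indeterminacy set. -/
lemma IsCanonicalWeight.exists_local_bound (hφ : IsCanonicalWeight φ)
    (hZa : IsAnalyticSubset 𝓘(ℂ, Cn n) Z) (hZc : HasCodimAtLeastTwo 𝓘(ℂ, Cn n) Z)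
    (hf : ContMDiffOn 𝓘(ℂ, Cn n) 𝓘(ℂ, Cn p) ω f Zᶜ)
    {e : OpenPartialHomeomorph X (Cn n)} (he : e ∈ atlas (Cn n) X) {z : Cn n}
    (hz : z ∈ e.target) :
    ∃ C : ℝ, ∀ᶠ y in 𝓝 z, y ∉ e.symm ⁻¹' Z → ∀ ξ : Fin p → Cn n, ‖ξ‖ ≤ 1 →
      localJacWeight φ f e y ξ ≤ C := by
  have hZ := hZa.isClosed
  exact exists_local_bound_prod (μ := localJacWeight φ f e)
    (fun z hz ↦ hZa.exists_analytic_in_chart he hz)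
    (fun V hV hVo g hg hne ↦ hZc.not_subset_in_chart he hV hVo hg hne)
    (fun _ _ ↦ jacWeight_nonneg _ _) (hφ.isLogPSH hZ hf he)
    (fun z hz ξ ↦ hφ.upperSemicontinuousAt hZ hf he hz ξ) z hz

end Weight

/-- If the supremum were approached near no point, each point would have a neighbourhood with a
strictly smaller bound, and a finite subcover would contradict its definition. -/
lemma exists_sup_of_locally_bounded {X S : Type*} [TopologicalSpace X] [CompactSpace X]
    (π : S → X) (g : S → ℝ) (hb : ∀ x, ∃ C : ℝ, ∀ᶠ y in 𝓝 x, ∀ s, π s = y → g s ≤ C)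
    (hpos : ∃ s, 0 < g s) :
    ∃ M > 0, (∀ s, g s ≤ M) ∧ ∃ x, ∀ N ∈ 𝓝 x, ∀ M' < M, ∃ s, π s ∈ N ∧ M' < g s := by
  have hbdd : ∃ C : ℝ, ∀ s, π s ∈ univ → g s ≤ C := by
    refine isCompact_univ.induction_on (p := fun T ↦ ∃ C : ℝ, ∀ s, π s ∈ T → g s ≤ C)
      ⟨0, by simp⟩ (fun T T' h ⟨C, hC⟩ ↦ ⟨C, fun s hs ↦ hC s (h hs)⟩) ?_ ?_
    · rintro T T' ⟨C, hC⟩ ⟨C', hC'⟩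
      refine ⟨max C C', fun s hs ↦ ?_⟩
      rcases hs with hs | hs
      · exact (hC s hs).trans (le_max_left _ _)
      · exact (hC' s hs).trans (le_max_right _ _)
    · intro x _
      obtain ⟨C, hC⟩ := hb x
      exact ⟨_, nhdsWithin_le_nhds hC, C, fun s hs ↦ hs s rfl⟩
  obtain ⟨C, hC⟩ := hbdd
  obtain ⟨s₀, hs₀⟩ := hpos
  have hne : (range g).Nonempty := ⟨_, s₀, rfl⟩
  have hlub : IsLUB (range g) (sSup (range g)) :=
    isLUB_csSup hne ⟨C, by rintro _ ⟨s, rfl⟩; exact hC s (mem_univ _)⟩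
  set M := sSup (range g) with hM
  refine ⟨M, hs₀.trans_le (hlub.1 ⟨s₀, rfl⟩), fun s ↦ hlub.1 ⟨s, rfl⟩, ?_⟩
  by_contra! H
  obtain ⟨M', hM', hle⟩ : ∃ M' < M, ∀ s, π s ∈ univ → g s ≤ M' := by
    refine isCompact_univ.induction_on (p := fun T ↦ ∃ M' < M, ∀ s, π s ∈ T → g s ≤ M')
      ⟨M - 1, by linarith, by simp⟩
      (fun T T' h ⟨C, hCM, hC⟩ ↦ ⟨C, hCM, fun s hs ↦ hC s (h hs)⟩) ?_ ?_
    · rintro T T' ⟨C, hCM, hC⟩ ⟨C', hCM', hC'⟩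
      refine ⟨max C C', max_lt hCM hCM', fun s hs ↦ ?_⟩
      rcases hs with hs | hs
      · exact (hC s hs).trans (le_max_left _ _)
      · exact (hC' s hs).trans (le_max_right _ _)
    · intro x _
      obtain ⟨N, hN, M', hM', h⟩ := H x
      exact ⟨N, nhdsWithin_le_nhds hN, M', hM', h⟩
  refine hM'.not_ge (hlub.2 ?_)
  rintro _ ⟨s, rfl⟩
  exact hle s (mem_univ _)

/-! ### Generic submersivity and positivity of the supremum -/

section Positivity

variable {n p : ℕ} {X : Type*} [TopologicalSpace X] [ChartedSpace (Cn n) X]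
  [IsManifold 𝓘(ℂ, Cn n) ω X]
  {Y : Type*} [TopologicalSpace Y] [ChartedSpace (Cn p) Y] [IsManifold 𝓘(ℂ, Cn p) ω Y]
  {φ : atlas (Cn p) Y → Y → EReal} {f : X → Y} {Z : Set X}

lemma dimH_eq_of_isOpen {W : Set (Cn p)} (hW : IsOpen W) (hne : W.Nonempty) :
    dimH W = (2 * p : ℕ) := by
  rw [Real.dimH_of_nonempty_interior (by rwa [hW.interior_eq]), finrank_real_of_complex,
    finrank_euclideanSpace_fin]

/-- Sard's theorem: a map whose image contains a non-empty open set is somewhere submersive. -/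
lemma exists_fderiv_range_eq_top [CompactSpace X] (hp : 1 ≤ p) (hZ : IsClosed Z)
    (hf : ContMDiffOn 𝓘(ℂ, Cn n) 𝓘(ℂ, Cn p) ω f Zᶜ) {V : Set Y} (hV : IsOpen V)
    (hne : V.Nonempty) (hVf : V ⊆ f '' Zᶜ) :
    ∃ e ∈ atlas (Cn n) X, ∃ w ∈ atlas (Cn p) Y,
      ∃ z ∈ e.target ∩ e.symm ⁻¹' (Zᶜ ∩ f ⁻¹' w.source),
      (fderiv ℂ (fun z ↦ w (f (e.symm z))) z).range = ⊤ := by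
  by_contra! H
  obtain ⟨y₀, hy₀⟩ := hne
  set w := chartAt (Cn p) y₀ with hw
  have hwa : w ∈ atlas (Cn p) Y := chart_mem_atlas _ _
  obtain ⟨t, ht⟩ := isCompact_univ.elim_finite_subcover (fun x : X ↦ (chartAt (Cn n) x).source)
    (fun x ↦ (chartAt (Cn n) x).open_source) fun x _ ↦
      mem_iUnion.2 ⟨x, mem_chart_source (Cn n) x⟩
  set S : X → Set (Cn n) := fun x ↦ (chartAt (Cn n) x).target ∩
    (chartAt (Cn n) x).symm ⁻¹' (Zᶜ ∩ f ⁻¹' w.source) with hS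
  set F : X → Cn n → Cn p := fun x z ↦ w (f ((chartAt (Cn n) x).symm z)) with hF
  -- Without a submersive point all ranks are at most `p - 1`, so finitely many sets of real
  -- dimension at most `2 * (p - 1)` would cover a nonempty open subset of `ℂᵖ`. The truncated
  -- subtraction is harmless as `1 ≤ p`.
  have hdim : ∀ x, dimH (F x '' S x) ≤ (2 * (p - 1) : ℕ) := by
    intro x
    refine dimH_image_le_of_finrank_range_le (p - 1) n (Cn n) finrank_euclideanSpace_fin (S x) (S x)
      (F x) (isOpen_chart_domain hZ hf _ w) (analyticOnNhd_in_charts hZ.isOpen_compl hf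
        (chart_mem_atlas _ _) hwa) subset_rfl fun z hz ↦ ?_
    have h1 := H _ (chart_mem_atlas (Cn n) x) w hwa z hz
    have h2 := Submodule.finrank_lt h1
    rw [finrank_euclideanSpace_fin] at h2
    exact Nat.le_sub_one_of_lt h2
  have hsub : w '' (w.source ∩ V) ⊆ ⋃ x ∈ (t : Set X), F x '' S x := by
    rintro _ ⟨y, ⟨hyw, hyV⟩, rfl⟩
    obtain ⟨x, hxZ, rfl⟩ := hVf hyV
    obtain ⟨x', hx't, hx'⟩ := mem_iUnion₂.1 (ht (mem_univ x))
    refine mem_iUnion₂.2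
      ⟨x', hx't, chartAt (Cn n) x' x, ⟨(chartAt (Cn n) x').map_source hx', ?_⟩, ?_⟩
    · rw [mem_preimage, (chartAt (Cn n) x').left_inv hx']
      exact ⟨hxZ, hyw⟩
    · simp only [hF, (chartAt (Cn n) x').left_inv hx']
  have h1 : dimH (w '' (w.source ∩ V)) = (2 * p : ℕ) :=
    dimH_eq_of_isOpen (w.isOpen_image_source_inter hV)
      ⟨w y₀, y₀, ⟨mem_chart_source _ _, hy₀⟩, rfl⟩
  have h2 := dimH_mono hsub
  rw [dimH_bUnion t.countable_toSet, h1] at h2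
  have h3 : ((2 * p : ℕ) : ENNReal) ≤ (2 * (p - 1) : ℕ) := h2.trans (iSup₂_le fun x _ ↦ hdim x)
  have h4 : 2 * p ≤ 2 * (p - 1) := by exact_mod_cast h3
  omega

/-- At the submersive point itself the weight may be `-∞`. But the map is open there, so images of
nearby points with nonzero Jacobian fill an open set, and `φ` is finite somewhere on it. -/
lemma IsCanonicalWeight.exists_pos [CompactSpace X] (hφ : IsCanonicalWeight φ) (hp : 1 ≤ p)
    (hZ : IsClosed Z) (hf : ContMDiffOn 𝓘(ℂ, Cn n) 𝓘(ℂ, Cn p) ω f Zᶜ) {V : Set Y} (hV : IsOpen V)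
    (hne : V.Nonempty) (hVf : V ⊆ f '' Zᶜ) :
    ∃ x ∉ Z, ∃ ξ : Fin p → Cn n, 0 < jacWeight φ f x ξ := by
  obtain ⟨e, he, w, hw, z, hz, htop⟩ := exists_fderiv_range_eq_top hp hZ hf hV hne hVf
  set D := e.target ∩ e.symm ⁻¹' (Zᶜ ∩ f ⁻¹' w.source) with hD
  set F : Cn n → Cn p := fun z ↦ w (f (e.symm z)) with hF
  have hFan : AnalyticOnNhd ℂ F D := analyticOnNhd_in_charts hZ.isOpen_compl hf he hw
  have hsurj : ∀ i : Fin p, ∃ ξ, fderiv ℂ F z ξ = EuclideanSpace.single i (1 : ℂ) := fun i ↦ by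
    have : (EuclideanSpace.single i (1 : ℂ) : Cn p) ∈ (fderiv ℂ F z).range := by
      rw [htop]; trivial
    exact this
  choose ξ hξ using hsurj
  have hdet : ∀ᶠ z' in 𝓝 z, stdDet (fun i ↦ fderiv ℂ F z' (ξ i)) ≠ 0 := by
    refine ContinuousAt.eventually_ne ?_ ?_
    · refine (analyticAt_stdDet (v := fun i z' ↦ fderiv ℂ F z' (ξ i)) fun i ↦ ?_).continuousAt
      exact ((ContinuousLinearMap.apply ℂ (Cn p) (ξ i)).analyticAt _).comp (hFan.fderiv z hz)
    · simp only [hξ, stdDet_single]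
      exact one_ne_zero
  have hN := inter_mem hdet ((isOpen_chart_domain hZ hf e w).mem_nhds hz)
  have himg := (hFan z hz).hasStrictFDerivAt.map_nhds_eq_of_surj htop
  have hFz : F '' ({z' | stdDet (fun i ↦ fderiv ℂ F z' (ξ i)) ≠ 0} ∩ D) ∈ 𝓝 (F z) :=
    himg ▸ image_mem_map hN
  obtain ⟨W, hWsub, hW, hzW⟩ := mem_nhds_iff.1 hFz
  obtain ⟨y, ⟨hyw, hyW⟩, hy⟩ := hφ.exists_ne_bot ⟨w, hw⟩ (w.source ∩ w ⁻¹' W) inter_subset_left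
    (w.isOpen_inter_preimage hW) ⟨f (e.symm z), hz.2.2, hzW⟩
  obtain ⟨z', ⟨hdet', hz'⟩, hFz'⟩ := hWsub hyW
  have hfy : f (e.symm z') = y := w.injOn hz'.2.2 hyw hFz'
  refine ⟨e.symm z', hz'.2.1, fun i ↦ derivAt n n e.symm z' (ξ i), ?_⟩
  have h1 : MDifferentiableAt 𝓘(ℂ, Cn n) 𝓘(ℂ, Cn p) f (e.symm z') :=
    (hf.contMDiffAt (hZ.isOpen_compl.mem_nhds hz'.2.1)).mdifferentiableAt (by simp)
  have h2 := hφ.localJacWeight_eq he ⟨w, hw⟩ hz'.1 h1 hz'.2.2 ξ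
  have hFtar : F z' ∈ w.target ∩ w.symm ⁻¹' w.source :=
    ⟨w.map_source hz'.2.2, by rw [mem_preimage, w.left_inv hz'.2.2]; exact hz'.2.2⟩
  have h3 : 0 < expWeight (φ ⟨w, hw⟩ ∘ w.symm) (F z') := by
    rw [expWeight_pos_iff ((hφ.psh ⟨w, hw⟩ w hw).lt_top _ hFtar), Function.comp,
      w.left_inv hz'.2.2, hfy]
    exact hy
  have h4 : 0 < ‖stdDet fun i ↦ fderiv ℂ F z' (ξ i)‖ := norm_pos_iff.2 hdet'
  exact (mul_pos h3 (pow_pos h4 2)).trans_eq h2.symm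

end Positivity

/-! ### The metric in chart coordinates -/

section Hermitian

variable {n p : ℕ} {X : Type*} [TopologicalSpace X] [ChartedSpace (Cn n) X]

/-- The Hermitian form at `x`, on the model space. -/
def HermitianMetric.formAt (h : HermitianMetric n X) (x : X) : Cn n →ₗ[ℂ] Cn n →ₗ⋆[ℂ] ℂ :=
  h.form x

/-- The sum of the squared lengths of the tangent vectors `ξ i` at `x`. -/
noncomputable def HermitianMetric.energyAt (h : HermitianMetric n X) (x : X)
    (ξ : Fin p → Cn n) : ℝ :=
  ∑ i, (h.formAt x (ξ i) (ξ i)).re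

variable (h : HermitianMetric n X)

lemma coeffForm_localCoeff (e : OpenPartialHomeomorph X (Cn n)) (z u v : Cn n) :
    coeffForm (localCoeff h.form e) z u v =
      h.formAt (e.symm z) (derivAt n n e.symm z u) (derivAt n n e.symm z v) := by
  have key : ∀ u : Cn n, u = ∑ k, u k • (EuclideanSpace.single k (1 : ℂ) : Cn n) := by
    intro u
    have := (EuclideanSpace.basisFun (Fin n) ℂ).sum_repr u
    simpa using this.symm
  conv_rhs => rw [key u, key v]
  simp only [map_sum, map_smul, map_smulₛₗ, LinearMap.sum_apply, LinearMap.smul_apply, smul_eq_mul]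
  rw [coeffForm, Finset.sum_comm]
  refine Finset.sum_congr rfl fun l _ ↦ ?_
  simp only [Finset.mul_sum]
  refine Finset.sum_congr rfl fun k _ ↦ ?_
  have : localCoeff h.form e k l z = h.formAt (e.symm z)
    (derivAt n n e.symm z (EuclideanSpace.single k (1 : ℂ)))
    (derivAt n n e.symm z (EuclideanSpace.single l (1 : ℂ))) := rfl
  rw [this]
  ring

lemma energy_localCoeff (e : OpenPartialHomeomorph X (Cn n)) (z : Cn n) (ξ : Fin p → Cn n) :
    energy (localCoeff h.form e) z ξ =
      h.energyAt (e.symm z) fun i ↦ derivAt n n e.symm z (ξ i) := by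
  simp only [energy, HermitianMetric.energyAt, coeffForm_localCoeff]

lemma conj_localCoeff (e : OpenPartialHomeomorph X (Cn n)) (k l : Fin n) (z : Cn n) :
    conj (localCoeff h.form e k l z) = localCoeff h.form e l k z :=
  h.conj_symm _ _ _

lemma coeffForm_localCoeff_pos [IsManifold 𝓘(ℂ, Cn n) ω X] {e : OpenPartialHomeomorph X (Cn n)}
    (he : e ∈ atlas (Cn n) X) {z : Cn n} (hz : z ∈ e.target) {u : Cn n} (hu : u ≠ 0) :
    0 < (coeffForm (localCoeff h.form e) z u u).re := by
  rw [coeffForm_localCoeff]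
  refine h.pos (e.symm z) _ fun h0 ↦ hu ?_
  rw [← derivAt_comp_derivAt_symm he hz u]
  have h1 : derivAt n n e.symm z u = 0 := h0
  rw [h1, map_zero]

end Hermitian

/-! ### The extremal point and the contradiction with positivity -/

section Main

variable {n p : ℕ} {X : Type*} [TopologicalSpace X] [ChartedSpace (Cn n) X]
  [IsManifold 𝓘(ℂ, Cn n) ω X]
  {Y : Type*} [TopologicalSpace Y] [ChartedSpace (Cn p) Y] [IsManifold 𝓘(ℂ, Cn p) ω Y]
  {φ : atlas (Cn p) Y → Y → EReal} {f : X → Y} {Z : Set X}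

/-- This is the local finiteness needed for the global supremum, including at points of `Z`: the
bound on unit tuples is turned into one on all tuples by homogeneity. -/
lemma IsCanonicalWeight.exists_bound_exp_energyAt (hφ : IsCanonicalWeight φ)
    (h : HermitianMetric n X) (hZa : IsAnalyticSubset 𝓘(ℂ, Cn n) Z)
    (hZc : HasCodimAtLeastTwo 𝓘(ℂ, Cn n) Z) (hf : ContMDiffOn 𝓘(ℂ, Cn n) 𝓘(ℂ, Cn p) ω f Zᶜ)
    (x₀ : X) : ∃ C : ℝ, ∀ᶠ x in 𝓝 x₀, x ∉ Z → ∀ ξ : Fin p → Cn n,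
      jacWeight φ f x ξ ≤ C * Real.exp (h.energyAt x ξ) := by
  set e := chartAt (Cn n) x₀ with he
  have hea : e ∈ atlas (Cn n) X := chart_mem_atlas _ _
  have hx₀ : x₀ ∈ e.source := mem_chart_source _ _
  have hz₀ : e x₀ ∈ e.target := e.map_source hx₀
  obtain ⟨C, hC⟩ := hφ.exists_local_bound hZa hZc hf hea hz₀
  obtain ⟨ρ, hρ, hρe⟩ := Metric.nhds_basis_closedBall.mem_iff.1 (e.open_target.mem_nhds hz₀)
  obtain ⟨a, ha, hac⟩ := exists_mul_norm_sq_le_coeffForm (isCompact_closedBall (e x₀) ρ)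
    (fun k l ↦ (h.smooth e hea k l).continuousOn.mono hρe)
    (fun z hz u hu ↦ coeffForm_localCoeff_pos h hea (hρe hz) hu)
  refine ⟨max C 0 * (p.factorial / a ^ p), ?_⟩
  have hcont : Tendsto e (𝓝 x₀) (𝓝 (e x₀)) := e.continuousAt hx₀
  filter_upwards [hcont.eventually hC, hcont.eventually (Metric.closedBall_mem_nhds _ hρ),
    e.open_source.mem_nhds hx₀] with x h1 h2 h3 hxZ ξ
  have h4 := le_mul_exp_energy (c := localCoeff h.form e) (m := localJacWeight φ f e (e x))
    (z := e x) (fun ξ A ↦ localJacWeight_sum e (e x) ξ A) (le_max_right C 0)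
    (fun ξ hξ ↦ (h1 (by rwa [mem_preimage, e.left_inv h3]) ξ hξ).trans (le_max_left _ _)) ha
    (fun u ↦ hac _ h2 u) fun i ↦ derivAt n n e x (ξ i)
  have h5 : ∀ u, derivAt n n e.symm (e x) (derivAt n n e x u) = u := fun u ↦ by
    have := derivAt_symm_comp_derivAt hea (e.map_source h3) u
    rwa [e.left_inv h3] at this
  rw [energy_localCoeff, localJacWeight] at h4
  simpa only [h5, e.left_inv h3] using h4

/-- The supremum is taken over tuples at points off `Z`. Compactness of `X` gives a point `x₀` near
which it is approached; `x₀` may lie on `Z`, so no maximizer is claimed. -/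
theorem IsCanonicalWeight.exists_isExtremalAt [CompactSpace X] (hφ : IsCanonicalWeight φ)
    (hp : 1 ≤ p) (h : HermitianMetric n X) (hZa : IsAnalyticSubset 𝓘(ℂ, Cn n) Z)
    (hZc : HasCodimAtLeastTwo 𝓘(ℂ, Cn n) Z) (hf : ContMDiffOn 𝓘(ℂ, Cn n) 𝓘(ℂ, Cn p) ω f Zᶜ)
    {V : Set Y} (hV : IsOpen V) (hne : V.Nonempty) (hVf : V ⊆ f '' Zᶜ) :
    ∃ (x₀ : X) (M : ℝ), IsExtremalAt (p := p) (chartAt (Cn n) x₀).target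
      ((chartAt (Cn n) x₀).symm ⁻¹' Z) (localCoeff h.form (chartAt (Cn n) x₀))
      (localJacWeight φ f (chartAt (Cn n) x₀)) M (chartAt (Cn n) x₀ x₀) := by
  have hZ := hZa.isClosed
  obtain ⟨M, hM, hle, x₀, hx₀⟩ := exists_sup_of_locally_bounded
    (S := {q : X × (Fin p → Cn n) // q.1 ∉ Z}) (fun q ↦ q.1.1)
    (fun q ↦ jacWeight φ f q.1.1 q.1.2 * Real.exp (-h.energyAt q.1.1 q.1.2))
    (fun x ↦ by
      obtain ⟨C, hC⟩ := hφ.exists_bound_exp_energyAt h hZa hZc hf x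
      refine ⟨C, hC.mono ?_⟩
      rintro y hy ⟨⟨x', ξ⟩, hx'⟩ rfl
      rw [Real.exp_neg, ← div_eq_mul_inv, div_le_iff₀ (Real.exp_pos _)]
      exact hy hx' ξ)
    (by
      obtain ⟨x, hx, ξ, hξ⟩ := hφ.exists_pos hp hZ hf hV hne hVf
      exact ⟨⟨(x, ξ), hx⟩, mul_pos hξ (Real.exp_pos _)⟩)
  set e := chartAt (Cn n) x₀ with he
  have hea : e ∈ atlas (Cn n) X := chart_mem_atlas _ _
  have hxe : x₀ ∈ e.source := mem_chart_source _ _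
  refine ⟨x₀, M, e.open_target, e.map_source hxe, h.smooth e hea,
    fun z _ k l ↦ conj_localCoeff h e k l z,
    fun z hz u hu ↦ coeffForm_localCoeff_pos h hea hz hu,
    hZa.exists_analytic_in_chart hea (e.map_source hxe), fun _ _ ↦ jacWeight_nonneg _ _,
    fun z ξ A ↦ localJacWeight_sum e z ξ A, hφ.isLogPSH hZ hf hea,
    fun z hz ξ ↦ hφ.upperSemicontinuousAt hZ hf hea hz ξ, hM, fun z hz ξ ↦ ?_, ?_⟩
  · have h1 := hle ⟨(e.symm z, fun i ↦ derivAt n n e.symm z (ξ i)), hz.2⟩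
    rw [Real.exp_neg, ← div_eq_mul_inv, div_le_iff₀ (Real.exp_pos _)] at h1
    rwa [energy_localCoeff]
  · intro N hN M' hM'
    obtain ⟨⟨⟨x, ξ⟩, hxZ⟩, ⟨hxN, hxs⟩, hlt⟩ := hx₀ (e ⁻¹' N ∩ e.source)
      (inter_mem ((e.continuousAt hxe).preimage_mem_nhds hN) (e.open_source.mem_nhds hxe)) M' hM'
    have h5 : ∀ u, derivAt n n e.symm (e x) (derivAt n n e x u) = u := fun u ↦ by
      have := derivAt_symm_comp_derivAt hea (e.map_source hxs) u
      rwa [e.left_inv hxs] at this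
    refine ⟨e x, ⟨hxN, e.map_source hxs, by rwa [mem_preimage, e.left_inv hxs]⟩,
      fun i ↦ derivAt n n e x (ξ i), ?_⟩
    rw [energy_localCoeff, localJacWeight]
    simp only [← he, h5, e.left_inv hxs]
    rwa [← lt_div_iff₀ (Real.exp_pos _), div_eq_mul_inv, ← Real.exp_neg]

/-- The positivity condition on the curvature at `x₀`, in the coordinates of the preferred chart. -/
lemma exists_coeffCurvature_pos {h : HermitianMetric n X}
    (hpos : ∀ (x : X) (S : Submodule ℂ (TangentSpace 𝓘(ℂ, Cn n) x)),
      Module.finrank ℂ S = p → ∃ v : TangentSpace 𝓘(ℂ, Cn n) x,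
      ∀ ε : Fin p → TangentSpace 𝓘(ℂ, Cn n) x, (∀ i, ε i ∈ S) → h.IsUnitary x ε →
        0 < ∑ i, h.curvature x v (ε i)) (x₀ : X) {ξ : Fin p → Cn n}
    (hξ : ∀ i j, coeffForm (localCoeff h.form (chartAt (Cn n) x₀)) (chartAt (Cn n) x₀ x₀)
      (ξ i) (ξ j) = if i = j then 1 else 0) :
    ∃ V, 0 < ∑ i, (coeffCurvature (localCoeff h.form (chartAt (Cn n) x₀))
      (chartAt (Cn n) x₀ x₀) V (ξ i)).re := by
  set e := chartAt (Cn n) x₀ with he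
  have hea : e ∈ atlas (Cn n) X := chart_mem_atlas _ _
  have hxe : x₀ ∈ e.source := mem_chart_source _ _
  set ε : Fin p → Cn n := fun i ↦ derivAt n n e.symm (e x₀) (ξ i) with hε
  have hunit : ∀ i j, h.formAt x₀ (ε i) (ε j) = if i = j then 1 else 0 := by
    intro i j
    have h1 := hξ i j
    rwa [coeffForm_localCoeff, e.left_inv hxe] at h1
  have hli : LinearIndependent ℂ ε := by
    rw [Fintype.linearIndependent_iff]
    intro c hc i
    have h1 := congrArg (fun u ↦ h.formAt x₀ u (ε i)) hc
    simpa [map_sum, LinearMap.sum_apply, hunit] using h1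
  have hfin : Module.finrank ℂ (Submodule.span ℂ (range ε)) = p := by
    rw [finrank_span_eq_card hli, Fintype.card_fin]
  obtain ⟨v, hv⟩ := hpos x₀ (Submodule.span ℂ (range ε)) hfin
  have h1 := hv ε (fun i ↦ Submodule.subset_span ⟨i, rfl⟩) hunit
  refine ⟨derivAt n n e x₀ v, ?_⟩
  have h2 : ∀ i, derivAt n n e x₀ (ε i) = ξ i := fun i ↦ by
    have := derivAt_comp_derivAt_symm hea (e.map_source hxe) (ξ i)
    rwa [e.left_inv hxe] at this
  -- `curvature` is defined in the preferred chart at `x₀`, the very chart in which the extremal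
  -- problem is posed, so no invariance of the curvature under chart changes is needed.
  have h3 : ∀ i, h.curvature x₀ v (ε i) = (coeffCurvature (localCoeff h.form e) (e x₀)
      (derivAt n n e x₀ v) (derivAt n n e x₀ (ε i))).re := fun i ↦ rfl
  simpa only [h3, h2] using h1

end Main

end CplxGeom

theorem theorem1p1 (n p : ℕ) (hp : 1 ≤ p) (hpn : p ≤ n)
    (X : Type*) [TopologicalSpace X] [T2Space X] [CompactSpace X]
    [ChartedSpace (CplxGeom.Cn n) X] [IsManifold 𝓘(ℂ, CplxGeom.Cn n) ω X]
    (Y : Type*) [TopologicalSpace Y] [T2Space Y] [CompactSpace Y] [Nonempty Y]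
    [ChartedSpace (CplxGeom.Cn p) Y] [IsManifold 𝓘(ℂ, CplxGeom.Cn p) ω Y]
    (hX : CplxGeom.IsBCPositive p n X)
    (f : CplxGeom.MeromorphicMap n p X Y) (hf : f.IsDominant) :
    ¬ CplxGeom.IsPseudoEffective p (CplxGeom.canonicalBundle p Y) := by
  rintro ⟨φ, h1, h2, h3⟩
  obtain ⟨h, hpos⟩ := hX
  obtain ⟨V, hV, hVd, hVf⟩ := hf
  have hφ : CplxGeom.IsCanonicalWeight φ := ⟨h1, h2, h3⟩
  obtain ⟨x₀, M, H⟩ := hφ.exists_isExtremalAt hp h f.isAnalyticSubset_indet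
    f.hasCodimAtLeastTwo_indet f.holomorphicOn hV hVd.nonempty hVf
  obtain ⟨ξ, hξ, hle⟩ := H.exists_unitary_curvature_le hp
  obtain ⟨v, hv⟩ := CplxGeom.exists_coeffCurvature_pos hpos x₀ hξ
  exact (hle v).not_gt hv
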